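/- Let $\mathbb K$ be a field. For $\ell\ge 1$ let $Q$ be the ladder quiver of length $\ell$: its vertices are $x_0^+,\dots,x_\ell^+$ and $x_0^-,\dots,x_\ell^-$, and its edges are $x_{i}^{\pm}\to x_{i+1}^{\pm}$ for $0\le i<\ell$ and $x_i^+\to x_i^-$ for $0\le i\le \ell$. A finite-dimensional $\mathbb K$-representation $V$ of $Q$ is *nestfree* if any two paths of $Q$ with the same source and the same target act by the same linear map, and the barcodes of the top row $V^+$ and of the bottom row $V^-$ each contain no pair of strictly nested intervals, i.e. no intervals $[a,b]$, $[c,d]$ with $a<c\le d<b$. (The barcode of a representation of the equioriented line $x_0\to\dots\to x_\ell$ is the multiset of intervals in its decomposition into interval modules.) For a central charge $\alpha:Q_0\to\mathbb R$, the slope of a representation $V\ne 0$ is $\mu_\alpha(V)=\sum_x\alpha(x)\dim V_x\big/\sum_x\dim V_x$; $V$ is $\alpha$-semistable if $\mu_\alpha(U)\le\mu_\alpha(V)$ for every nonzero subrepresentation $U\subset V$; the Harder–Narasimhan (HN) filtration of $V$ is its unique filtration $0=V^0\subsetneq V^1\subsetneq\dots\subsetneq V^n=V$ with $\alpha$-semistable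 quotients $V^i/V^{i-1}$ of strictly decreasing slopes; and the HN type of $V$ along $\alpha$ is the sequence of dimension vectors of these quotients (the empty sequence if $V=0$). A set $A$ of central charges is *complete* on a full subcategory if any two of its objects that have the same HN type along every $\alpha\in A$ are isomorphic. For an integer $k$ and $S\subset Q_0$ let $\mathcal I_S^k$ be the class of indecomposable nestfree representations $I$ with $\sum_x\dim I_x=k$ such that $S$ is the set of minimal vertices of $\{x\mid I_x\ne0\}$, where $x\le y$ means that there is a (possibly trivial) path from $x$ to $y$. Let $\delta_x$ denote the skyscraper central charge ($1$ at $x$ and $0$ at the other vertices). Let $t=(t_{p,q})_{0\le q<p}$ be a family of irrational numbers with $$\frac{q}{p-q}<t_{p,q}<\frac{q+1}{p-(q+1)}\qquad(0\le q<p),$$ where the upper bound is read as $\infty$ if $p=q+1$. Such families exist, even with $t_{p,q}\neq t_{p',q}$ whenever $p\ne p'$. For every such family $t$ the following hold. For every $\ell\ge1$: 1. If $\mathcal I_S^k\neq\emptyset$, then either $S=\{x\}$ for a vertex $x$, or $S=\{x_a^+,x_c^-\}$ with $0\le c<a\le\ell$, and $x$, respectively $(a,c)$, is unique. Put $\alpha_S^k:=\delta_x$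 in the first case and $\alpha_S^k:=\delta_{x_a^+}+t_{k,a-c}\,\delta_{x_c^-}$ in the second. 2. The set $A=A(\ell)=\{\alpha_S^k\mid \mathcal I_S^k\ne\emptyset\}$ is finite and is complete on nestfree ladder persistence modules of length $\ell$. 3. For all $k$ and $S$, the set of dimension vectors $\{\underline{\dim}_I\mid I\in\mathcal I_S^k\}$ is linearly independent in $\mathbb R^{Q_0}$. 4. $|A(\ell)|\le\frac{2\ell^3+3\ell^2+13\ell+12}{6}$, with equality if for every $q$ the numbers $t_{p,q}$, $p>q$, are pairwise distinct. Moreover, $|A(\ell)|=\Theta(\ell^3)$ as $\ell\to\infty$. -/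

import Mathlib

open Filter Asymptotics

universe u

/-! ### Finite-dimensional representations of a quiver -/

/-- A finite-dimensional representation over the field `K` of the quiver with vertex set `Q`. -/
structure QuiverRep (K : Type u) [Field K] (Q : Type) [Quiver.{0} Q] where
  obj : Q → Type u
  [addCommGroup : ∀ x, AddCommGroup (obj x)]
  [module : ∀ x, Module K (obj x)]
  [finite : ∀ x, Module.Finite K (obj x)]
  map : ∀ {x y : Q}, (x ⟶ y) → obj x →ₗ[K] obj y

attribute [instance] QuiverRep.addCommGroup QuiverRep.module QuiverRep.finite

namespace QuiverRep

variable {K : Type u} [Field K] {Q : Type} [Quiver.{0} Q]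

/-- The dimension vector. -/
noncomputable def dimVec (V : QuiverRep K Q) (x : Q) : ℕ := Module.finrank K (V.obj x)

/-- The total dimension. -/
noncomputable def totalDim [Fintype Q] (V : QuiverRep K Q) : ℕ := ∑ x, V.dimVec x

/-- The support: all vertices carrying a nontrivial vector space. -/
def support (V : QuiverRep K Q) : Set Q := {x | Nontrivial (V.obj x)}

/-- The zero representation (up to isomorphism). -/
def IsZero (V : QuiverRep K Q) : Prop := ∀ x, Subsingleton (V.obj x)

/-- The representations `V` and `W` are isomorphic. -/
def Isomorphic (V W : QuiverRep K Q) : Prop :=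
  ∃ φ : ∀ x, V.obj x ≃ₗ[K] W.obj x,
    ∀ (x y : Q) (e : x ⟶ y) (v : V.obj x), φ y (V.map e v) = W.map e (φ x v)

/-- The direct sum of two representations. -/
def prod (V W : QuiverRep K Q) : QuiverRep K Q where
  obj x := V.obj x × W.obj x
  map e := (V.map e).prodMap (W.map e)

/-- The direct sum of a finite family of representations. -/
def directSum {n : ℕ} (V : Fin n → QuiverRep K Q) : QuiverRep K Q where
  obj x := ∀ i, (V i).obj x
  map e := LinearMap.pi fun i => (V i).map e ∘ₗ LinearMap.proj i

/-- A nonzero representation without nontrivial direct sum decompositions. -/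
def IsIndecomposable (V : QuiverRep K Q) : Prop :=
  ¬ V.IsZero ∧ ∀ U W : QuiverRep K Q, V.Isomorphic (U.prod W) → U.IsZero ∨ W.IsZero

/-- The composite linear map along a path. -/
def mapPath (V : QuiverRep K Q) {x : Q} : ∀ {y : Q}, Quiver.Path x y → (V.obj x →ₗ[K] V.obj y)
  | _, .nil => LinearMap.id
  | _, .cons p e => V.map e ∘ₗ V.mapPath p

/-- Any two paths with the same source and the same target act by the same map. -/
def IsEqualised (V : QuiverRep K Q) : Prop :=
  ∀ (x y : Q) (p q : Quiver.Path x y), V.mapPath p = V.mapPath q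

/-- Restriction of a representation along a morphism of quivers. -/
def restrict {P : Type} [Quiver.{0} P] (F : P ⥤q Q) (V : QuiverRep K Q) : QuiverRep K P where
  obj x := V.obj (F.obj x)
  map e := V.map (F.map e)

/-- The minimal vertices of the support for the flow order on vertices, in which `y ≤ x` when
there is a (possibly trivial) path from `y` to `x`. -/
def minSupport (V : QuiverRep K Q) : Set Q :=
  {x ∈ V.support | ∀ y ∈ V.support, Nonempty (Quiver.Path y x) → y = x}

/-! ### Subrepresentations and quotients -/

/-- A subrepresentation: subspaces preserved by all edge maps. -/
@[ext] structure Sub (V : QuiverRep K Q) where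
  carrier : ∀ x, Submodule K (V.obj x)
  stable : ∀ {x y : Q} (e : x ⟶ y), carrier x ≤ (carrier y).comap (V.map e)

namespace Sub

variable {V : QuiverRep K Q}

/-- Vertexwise inclusion. -/
instance : PartialOrder (Sub V) where
  le U W := ∀ x, U.carrier x ≤ W.carrier x
  le_refl _ _ := le_rfl
  le_trans _ _ _ h₁ h₂ x := (h₁ x).trans (h₂ x)
  le_antisymm _ _ h₁ h₂ := Sub.ext (funext fun x => le_antisymm (h₁ x) (h₂ x))

instance : Bot (Sub V) := ⟨⟨fun _ => ⊥, fun _ => bot_le⟩⟩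

instance : Top (Sub V) := ⟨⟨fun _ => ⊤, fun _ _ _ => trivial⟩⟩

/-- A subrepresentation, regarded as a representation. -/
def toRep (U : Sub V) : QuiverRep K Q where
  obj x := U.carrier x
  map e := (V.map e).restrict (U.stable e)

/-- The quotient representation `V / U`. -/
def quotient (U : Sub V) : QuiverRep K Q where
  obj x := V.obj x ⧸ U.carrier x
  map {x y} e := (U.carrier x).mapQ (U.carrier y) (V.map e) (U.stable e)

/-- The intersection `U ∩ W`, as a subrepresentation of `W`. -/
def inside (U W : Sub V) : Sub W.toRep where
  carrier x := (U.carrier x).submoduleOf (W.carrier x)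
  stable e _ hv := U.stable e hv

end Sub

/-! ### Harder-Narasimhan types -/

section HN

variable [Fintype Q]

/-- The slope of a nonzero representation along the central charge `α`. -/
noncomputable def slope (α : Q → ℝ) (V : QuiverRep K Q) : ℝ :=
  (∑ x, α x * (V.dimVec x : ℝ)) / ∑ x, (V.dimVec x : ℝ)

/-- Semistability along `α`: no nonzero subrepresentation has larger slope. -/
def IsSemistable (α : Q → ℝ) (V : QuiverRep K Q) : Prop :=
  ∀ U : Sub V, U ≠ ⊥ → U.toRep.slope α ≤ V.slope α

/-- A Harder-Narasimhan filtration along `α`: a strictly increasing chain from `0` to `V` whose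
successive quotients are semistable with strictly decreasing slopes. -/
structure HNFiltration (α : Q → ℝ) (V : QuiverRep K Q) where
  length : ℕ
  step : Fin (length + 1) → Sub V
  step_zero : step 0 = ⊥
  step_last : step (Fin.last length) = ⊤
  strictMono : StrictMono step
  semistable : ∀ i : Fin length,
    ((step i.castSucc).inside (step i.succ)).quotient.IsSemistable α
  slope_strictAnti : StrictAnti fun i : Fin length =>
    ((step i.castSucc).inside (step i.succ)).quotient.slope α

/-- The list of dimension vectors of the successive quotients of a filtration. -/
noncomputable def HNFiltration.type {α : Q → ℝ} {V : QuiverRep K Q} (F : HNFiltration α V) :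
    List (Q → ℕ) :=
  List.ofFn fun i : Fin F.length =>
    ((F.step i.castSucc).inside (F.step i.succ)).quotient.dimVec

open Classical in
/-- The Harder-Narasimhan type of `V` along `α`, read off from the Harder-Narasimhan filtration,
which always exists and is unique. It is the empty list for the zero representation. -/
noncomputable def hnType (α : Q → ℝ) (V : QuiverRep K Q) : List (Q → ℕ) :=
  if h : Nonempty (HNFiltration α V) then h.some.type else []

/-- The set `A` of central charges is complete on the full subcategory of the representations
satisfying `C`: there, the Harder-Narasimhan types along all members of `A` together determine a
representation up to isomorphism. -/
def IsCompleteOn (A : Set (Q → ℝ)) (C : QuiverRep K Q → Prop) : Prop :=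
  ∀ V W : QuiverRep K Q, C V → C W → (∀ α ∈ A, V.hnType α = W.hnType α) → V.Isomorphic W

end HN

end QuiverRep

/-! ### The equioriented line and its interval modules -/

/-- Vertices `x_0, …, x_ℓ` of the equioriented line quiver. -/
structure LineVertex (ℓ : ℕ) where
  idx : Fin (ℓ + 1)

/-- One edge from `x_i` to `x_{i+1}` for every `i`. -/
inductive LineEdge (ℓ : ℕ) : LineVertex ℓ → LineVertex ℓ → Type
  | edge {i j : Fin (ℓ + 1)} (h : i.val + 1 = j.val) : LineEdge ℓ ⟨i⟩ ⟨j⟩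

instance (ℓ : ℕ) : Quiver.{0} (LineVertex ℓ) := ⟨LineEdge ℓ⟩

/-- The vector space of the interval module on `[a, b]` at the vertex `x_i`: all of `K` for
`a ≤ i ≤ b` and `0` otherwise. -/
def intervalSpace (K : Type u) [Field K] {ℓ : ℕ} (a b i : Fin (ℓ + 1)) : Submodule K K :=
  if a ≤ i ∧ i ≤ b then ⊤ else ⊥

/-- The interval module on `[a, b]`: edge maps are the identity inside of `[a, b]`, and `0`
elsewhere. -/
def intervalModule (K : Type u) [Field K] {ℓ : ℕ} (a b : Fin (ℓ + 1)) :
    QuiverRep K (LineVertex ℓ) where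
  obj x := intervalSpace K a b x.idx
  map {x y} _ :=
    { toFun := fun v => ⟨if a ≤ y.idx ∧ y.idx ≤ b then v.1 else 0, by
        unfold intervalSpace; split_ifs <;> simp⟩
      map_add' := fun v w => by ext; simp only [Submodule.coe_add]; split_ifs <;> simp
      map_smul' := fun c v => by
        ext; simp only [Submodule.coe_smul, RingHom.id_apply]; split_ifs <;> simp }

/-- No barcode of the line representation `W` contains two strictly nested intervals. (The barcode
is the family of intervals in a decomposition of `W` as a direct sum of interval modules.) -/
def HasNoNestedIntervals {K : Type u} [Field K] {ℓ : ℕ} (W : QuiverRep K (LineVertex ℓ)) : Prop :=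
  ∀ (n : ℕ) (a b : Fin n → Fin (ℓ + 1)), (∀ i, a i ≤ b i) →
    W.Isomorphic (QuiverRep.directSum fun i => intervalModule K (a i) (b i)) →
      ¬ ∃ i j, a i < a j ∧ b j < b i

/-! ### Ladder quivers and nestfree representations -/

/-- Vertices of the ladder quiver of length `ℓ`: `top i` is `x_i^+`, and `bot i` is `x_i^-`. -/
inductive LadderVertex (ℓ : ℕ) where
  | top (i : Fin (ℓ + 1))
  | bot (i : Fin (ℓ + 1))
  deriving DecidableEq, Fintype

/-- Edges of the ladder quiver. -/
inductive LadderEdge (ℓ : ℕ) : LadderVertex ℓ → LadderVertex ℓ → Type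
  | top {i j : Fin (ℓ + 1)} (h : i.val + 1 = j.val) : LadderEdge ℓ (.top i) (.top j)
  | bot {i j : Fin (ℓ + 1)} (h : i.val + 1 = j.val) : LadderEdge ℓ (.bot i) (.bot j)
  | down (i : Fin (ℓ + 1)) : LadderEdge ℓ (.top i) (.bot i)

instance (ℓ : ℕ) : Quiver.{0} (LadderVertex ℓ) := ⟨LadderEdge ℓ⟩

/-- The inclusion of the top row. -/
def topRow (ℓ : ℕ) : LineVertex ℓ ⥤q LadderVertex ℓ where
  obj x := .top x.idx
  map e := match e with | .edge h => .top h

/-- The inclusion of the bottom row. -/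
def botRow (ℓ : ℕ) : LineVertex ℓ ⥤q LadderVertex ℓ where
  obj x := .bot x.idx
  map e := match e with | .edge h => .bot h

/-- Nestfree ladder persistence modules. -/
structure IsNestfree {K : Type u} [Field K] {ℓ : ℕ} (V : QuiverRep K (LadderVertex ℓ)) : Prop where
  equalised : V.IsEqualised
  top : HasNoNestedIntervals (V.restrict (topRow ℓ))
  bot : HasNoNestedIntervals (V.restrict (botRow ℓ))

/-- The class `I_S^k` of indecomposable nestfree representations of total dimension `k` whose
support has `S` as its set of minimal vertices. -/
def ladderClass (K : Type u) [Field K] (ℓ k : ℕ) (S : Set (LadderVertex ℓ)) :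
    Set (QuiverRep K (LadderVertex ℓ)) :=
  {V | V.IsIndecomposable ∧ IsNestfree V ∧ V.totalDim = k ∧ V.minSupport = S}

/-! ### The central charges -/

/-- The skyscraper central charge at `x`. -/
def skyscraper {ℓ : ℕ} (x : LadderVertex ℓ) : LadderVertex ℓ → ℝ := Pi.single x 1

/-- Irrational parameters `t p q`, for `0 ≤ q < p`, which satisfy
`q / (p - q) < t p q < (q + 1) / (p - (q + 1))`, where the upper bound is read as `∞` if
`p = q + 1`. -/
def IsAdmissibleParam (t : ℕ → ℕ → ℝ) : Prop :=
  ∀ p q : ℕ, q < p → Irrational (t p q) ∧ (q : ℝ) / ((p : ℝ) - q) < t p q ∧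
    (q + 1 < p → t p q < ((q : ℝ) + 1) / ((p : ℝ) - ((q : ℝ) + 1)))

/-- For each `q`, the parameters `t p q` with `p > q` are pairwise distinct. -/
def IsDistinctParam (t : ℕ → ℕ → ℝ) : Prop :=
  ∀ q : ℕ, Set.InjOn (fun p => t p q) {p | q < p}

/-- `α` is the central charge `α_S^k`, that is, `δ_x` if `S = {x}`, and `δ_y + t_{k,a-c} δ_z` if
`S = {y, z}` with `y = x_a^+`, `z = x_c^-` and `c < a`. -/
def IsLadderCharge (t : ℕ → ℕ → ℝ) {ℓ : ℕ} (k : ℕ) (S : Set (LadderVertex ℓ))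
    (α : LadderVertex ℓ → ℝ) : Prop :=
  (∃ x, S = {x} ∧ α = skyscraper x) ∨
  (∃ a c : Fin (ℓ + 1), c < a ∧ S = {.top a, .bot c} ∧
    α = skyscraper (.top a) + t k (a.val - c.val) • skyscraper (.bot c))

/-- The set of all the central charges `α_S^k` with `I_S^k` nonempty. -/
def ladderCharges (K : Type u) [Field K] (ℓ : ℕ) (t : ℕ → ℕ → ℝ) : Set (LadderVertex ℓ → ℝ) :=
  {α | ∃ k S, (ladderClass K ℓ k S).Nonempty ∧ IsLadderCharge t k S α}

/-! A nestfree ladder module is a direct sum of thin modules (all dimensions at most 1, identity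
maps) supported on blocks: an interval [a,b) of the top row together with an interval [c,d) of the
bottom row, where c ≤ a ≤ d ≤ b, or an interval of the bottom row alone. Indeed, if a row has no
strictly nested bars, then for x ≤ y ≤ z the kernel of y → z and the image of x → y are comparable
(`comparable_of_hasNoNestedIntervals`). Comparability passes to direct summands, and it is what
allows a generator to be lifted in the bottom row and a functional to be extended in the top row, so
that a block splits off (`exists_split_of_down_ne_zero`). Blocks are indecomposable, so the class
I_S^k consists of the thin modules on the blocks with k vertices and minimal vertices S; here S is
one vertex or a pair x_a^+, x_c^- with c < a.

Harder-Narasimhan types are handled through weights: for w = α - θ, the subrepresentations of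
maximal total weight have a smallest and a largest member, and the difference of their dimension
vectors is the entry of slope θ of the type (`HNFiltration.hasPart`). This entry is additive over
direct sums (`HasPart.prod`), so it can be computed block by block. Given a block R with minimal set
S and size k, take α = α_S^k and let θ be the total charge of S divided by k. A block P then
contributes the indicator of the part G of P generated by S if G is a block with minimal set S and
size k, and 0 otherwise (`exists_charge_hasPart`). For a pair with q = a - c, the part generated by
x_a^+ has k - q vertices and the part generated by x_c^- has at least q + 1; the bounds on t_{k,q}
make the slopes of both smaller than θ, and irrationality excludes accidental ties that would make
other blocks contribute.

Within one class, a block is determined by the right end of its top interval (or is unique, if S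
lies in the bottom row). This gives functionals dual to the indicators (`exists_dual`), hence linear
independence. Applied to the entry of slope θ, the functional of R counts the summands P in which S
generates exactly R. Such P are larger than R unless P = R, so these counts, taken over all R,
determine the multiset of summands (`perm_of_countP_eq`).

For the cardinality, a pair c < a occurs with the sizes a - c + 2 + i, 0 ≤ i ≤ 2(ℓ - a), and the 2(ℓ
+ 1) skyscrapers are added. Cubic growth does not need distinct parameters: for m ≤ q the intervals
prescribed for t_{q+m,q} are disjoint as soon as the values of m differ by at least 2
(`IsAdmissibleParam.lt_of_add_two_le`). -/

namespace QuiverRep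

/-! ### Morphisms, direct summands and transition maps -/

section Basic

open Classical in
/-- `K` on the vertices of `P` and `0` elsewhere. -/
noncomputable def thinSpace (K : Type u) [Field K] {Q : Type} (P : Set Q) (x : Q) : Submodule K K :=
  if x ∈ P then ⊤ else ⊥

theorem thinSpace_of_mem {K : Type u} [Field K] {Q : Type} {P : Set Q} {x : Q} (h : x ∈ P) :
    thinSpace K P x = ⊤ := if_pos h

theorem thinSpace_of_notMem {K : Type u} [Field K] {Q : Type} {P : Set Q} {x : Q} (h : x ∉ P) :
    thinSpace K P x = ⊥ := if_neg h

variable {K : Type u} [Field K] {Q : Type} [Quiver.{0} Q]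

/-- A morphism of representations. -/
structure Hom (V W : QuiverRep K Q) where
  app : ∀ x, V.obj x →ₗ[K] W.obj x
  naturality : ∀ {x y : Q} (e : x ⟶ y) (v : V.obj x), app y (V.map e v) = W.map e (app x v)

theorem Hom.mapPath {V W : QuiverRep K Q} (φ : Hom V W) {x y : Q} (p : Quiver.Path x y)
    (v : V.obj x) : φ.app y (V.mapPath p v) = W.mapPath p (φ.app x v) := by
  induction p with
  | nil => rfl
  | cons p e ih => simp only [QuiverRep.mapPath, LinearMap.comp_apply, φ.naturality, ih]

theorem mapPath_comp (V : QuiverRep K Q) {x y z : Q} (p : Quiver.Path x y) (q : Quiver.Path y z) :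
    V.mapPath (p.comp q) = V.mapPath q ∘ₗ V.mapPath p := by
  induction q with
  | nil => rfl
  | cons q e ih => rw [Quiver.Path.comp_cons]; simp only [QuiverRep.mapPath, ih, LinearMap.comp_assoc]

theorem Isomorphic.refl (V : QuiverRep K Q) : V.Isomorphic V :=
  ⟨fun _ => LinearEquiv.refl K _, fun _ _ _ _ => rfl⟩

theorem Isomorphic.symm {V W : QuiverRep K Q} (h : V.Isomorphic W) : W.Isomorphic V := by
  obtain ⟨φ, hφ⟩ := h
  refine ⟨fun x => (φ x).symm, fun x y e v => ?_⟩
  rw [LinearEquiv.symm_apply_eq, hφ, LinearEquiv.apply_symm_apply]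

theorem Isomorphic.trans {U V W : QuiverRep K Q} (h : U.Isomorphic V) (h' : V.Isomorphic W) :
    U.Isomorphic W := by
  obtain ⟨φ, hφ⟩ := h
  obtain ⟨ψ, hψ⟩ := h'
  exact ⟨fun x => (φ x).trans (ψ x), fun x y e v => by simp [hφ, hψ]⟩

theorem Isomorphic.prod_congr {V V' W W' : QuiverRep K Q} (h : V.Isomorphic V')
    (h' : W.Isomorphic W') : (V.prod W).Isomorphic (V'.prod W') := by
  obtain ⟨φ, hφ⟩ := h
  obtain ⟨ψ, hψ⟩ := h'
  exact ⟨fun x => (φ x).prodCongr (ψ x),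
    fun x y e v => Prod.ext (hφ x y e v.1) (hψ x y e v.2)⟩

theorem isomorphic_prod_left_comm (U V W : QuiverRep K Q) :
    (U.prod (V.prod W)).Isomorphic (V.prod (U.prod W)) :=
  ⟨fun _ =>
    { toFun := fun v => (v.2.1, v.1, v.2.2)
      invFun := fun v => (v.2.1, v.1, v.2.2)
      left_inv := fun _ => rfl
      right_inv := fun _ => rfl
      map_add' := fun _ _ => rfl
      map_smul' := fun _ _ => rfl }, fun _ _ _ _ => rfl⟩

theorem isomorphic_of_isZero {V W : QuiverRep K Q} (hV : V.IsZero) (hW : W.IsZero) :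
    V.Isomorphic W := by
  refine ⟨fun x => ?_, fun x y e v => ?_⟩
  · have := hV x
    have := hW x
    exact 0
  · have := hW y
    exact Subsingleton.elim _ _

theorem isomorphic_prod_of_isZero (V : QuiverRep K Q) {W : QuiverRep K Q} (hW : W.IsZero) :
    (V.prod W).Isomorphic V := by
  refine ⟨fun x => LinearEquiv.ofBijective (LinearMap.fst K _ _) ⟨fun v w h => ?_, fun v => ?_⟩,
    fun _ _ _ _ => rfl⟩
  · have := hW x
    exact Prod.ext h (Subsingleton.elim _ _)
  · exact ⟨(v, 0), rfl⟩

theorem Isomorphic.dimVec_eq {V W : QuiverRep K Q} (h : V.Isomorphic W) (x : Q) :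
    V.dimVec x = W.dimVec x := by
  obtain ⟨φ, -⟩ := h
  exact (φ x).finrank_eq

theorem dimVec_prod (V W : QuiverRep K Q) (x : Q) :
    (V.prod W).dimVec x = V.dimVec x + W.dimVec x :=
  Module.finrank_prod (R := K) (M := V.obj x) (M' := W.obj x)

theorem mem_support_iff {V : QuiverRep K Q} {x : Q} : x ∈ V.support ↔ V.dimVec x ≠ 0 := by
  unfold support dimVec
  rw [Set.mem_ofPred_eq, ← Module.finrank_pos_iff (R := K), Nat.pos_iff_ne_zero]

theorem isZero_iff {V : QuiverRep K Q} : V.IsZero ↔ ∀ x, V.dimVec x = 0 := by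
  unfold IsZero dimVec
  exact forall_congr' fun x => Module.finrank_zero_iff.symm

/-- `W` is a direct summand of `V`. -/
def IsRetract (W V : QuiverRep K Q) : Prop :=
  ∃ (ι : Hom W V) (π : Hom V W), ∀ x w, π.app x (ι.app x w) = w

theorem IsRetract.of_isomorphic_prod {V T W : QuiverRep K Q} (h : V.Isomorphic (T.prod W)) :
    IsRetract W V := by
  obtain ⟨φ, hφ⟩ := h
  refine ⟨⟨fun x => (φ x).symm.toLinearMap ∘ₗ LinearMap.inr K (T.obj x) (W.obj x), ?_⟩,
    ⟨fun x => LinearMap.snd K (T.obj x) (W.obj x) ∘ₗ (φ x).toLinearMap, ?_⟩, ?_⟩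
  · intro x y e v
    apply (φ y).injective
    have h1 := (hφ x y e ((φ x).symm (0, v))).trans
      (congrArg ((T.prod W).map e) ((φ x).apply_symm_apply (0, v)))
    refine Eq.trans ?_ h1.symm
    refine ((φ y).apply_symm_apply _).trans ?_
    exact Prod.ext (map_zero (T.map e)).symm rfl
  · intro x y e v
    exact congrArg Prod.snd (hφ x y e v)
  · intro x w
    exact congrArg Prod.snd ((φ x).apply_symm_apply (0, w))

theorem IsRetract.of_isomorphic {V W : QuiverRep K Q} (h : V.Isomorphic W) : IsRetract V W := by
  obtain ⟨φ, hφ⟩ := h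
  refine ⟨⟨fun x => (φ x).toLinearMap, fun {x y} e v => hφ x y e v⟩,
    ⟨fun x => (φ x).symm.toLinearMap, fun {x y} e v => ?_⟩, fun x w => (φ x).symm_apply_apply w⟩
  change (φ y).symm _ = V.map e ((φ x).symm v)
  rw [LinearEquiv.symm_apply_eq, hφ, LinearEquiv.apply_symm_apply]

theorem IsRetract.isEqualised {V W : QuiverRep K Q} (h : IsRetract W V) (hV : V.IsEqualised) :
    W.IsEqualised := by
  obtain ⟨ι, π, hπ⟩ := h
  intro x y p q
  ext v
  rw [← hπ y (W.mapPath p v), ← hπ y (W.mapPath q v), ι.mapPath, ι.mapPath, hV x y p q]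

open Classical in
/-- The linear map along any path, and `0` if there is none. -/
noncomputable def tr (V : QuiverRep K Q) (x y : Q) : V.obj x →ₗ[K] V.obj y :=
  if h : Nonempty (Quiver.Path x y) then V.mapPath h.some else 0

theorem IsEqualised.tr_eq {V : QuiverRep K Q} (hV : V.IsEqualised) {x y : Q}
    (p : Quiver.Path x y) : V.tr x y = V.mapPath p := by
  unfold tr
  rw [dif_pos ⟨p⟩]
  exact hV _ _ _ _

theorem IsEqualised.tr_self {V : QuiverRep K Q} (hV : V.IsEqualised) {x : Q} (v : V.obj x) :
    V.tr x x v = v := by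
  rw [hV.tr_eq Quiver.Path.nil]; rfl

theorem IsEqualised.map_eq_tr {V : QuiverRep K Q} (hV : V.IsEqualised) {x y : Q} (e : x ⟶ y) :
    V.map e = V.tr x y := by
  rw [hV.tr_eq e.toPath]; rfl

theorem IsEqualised.tr_tr {V : QuiverRep K Q} (hV : V.IsEqualised) {x y z : Q}
    (p : Nonempty (Quiver.Path x y)) (q : Nonempty (Quiver.Path y z)) (v : V.obj x) :
    V.tr y z (V.tr x y v) = V.tr x z v := by
  obtain ⟨p⟩ := p
  obtain ⟨q⟩ := q
  rw [hV.tr_eq p, hV.tr_eq q, hV.tr_eq (p.comp q), mapPath_comp]; rfl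

theorem Hom.tr {V W : QuiverRep K Q} (φ : Hom V W) {x y : Q} (v : V.obj x) :
    φ.app y (V.tr x y v) = W.tr x y (φ.app x v) := by
  unfold QuiverRep.tr
  split_ifs with h
  · exact φ.mapPath _ _
  · simp

/-- The kernel of the map from `y` to `z` and the image of the map from `x` to `y` are
comparable. -/
def Comparable (V : QuiverRep K Q) (x y z : Q) : Prop :=
  LinearMap.ker (V.tr y z) ≤ LinearMap.range (V.tr x y) ∨
    LinearMap.range (V.tr x y) ≤ LinearMap.ker (V.tr y z)

/-- Kernels and images of W are cut out of those of V by the inclusion and the projection. This is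
why the induction that splits off summands is run with comparability: it is inherited elementwise,
without any uniqueness of barcodes. -/
theorem IsRetract.comparable {V W : QuiverRep K Q} (h : IsRetract W V) {x y z : Q}
    (hV : V.Comparable x y z) : W.Comparable x y z := by
  obtain ⟨ι, π, hπ⟩ := h
  refine hV.imp (fun h w hw => ?_) (fun h w hw => ?_)
  · have : ι.app y w ∈ LinearMap.ker (V.tr y z) := by
      rw [LinearMap.mem_ker] at hw ⊢
      rw [← ι.tr, hw, map_zero]
    obtain ⟨u, hu⟩ := h this
    exact ⟨π.app x u, by rw [← π.tr, hu, hπ]⟩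
  · obtain ⟨u, rfl⟩ := hw
    have : V.tr x y (ι.app x u) ∈ LinearMap.ker (V.tr y z) := h ⟨_, rfl⟩
    rw [LinearMap.mem_ker] at this ⊢
    rw [← hπ z (W.tr y z _), ι.tr, ι.tr, this, map_zero]

theorem mapPath_restrict {P : Type} [Quiver.{0} P] (F : P ⥤q Q) (V : QuiverRep K Q) {x y : P}
    (p : Quiver.Path x y) : (V.restrict F).mapPath p = V.mapPath (F.mapPath p) := by
  induction p with
  | nil => rfl
  | cons p e ih =>
    simp only [Prefunctor.mapPath_cons]
    unfold QuiverRep.mapPath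
    rw [ih]; rfl

theorem IsEqualised.restrict {P : Type} [Quiver.{0} P] (F : P ⥤q Q) {V : QuiverRep K Q}
    (hV : V.IsEqualised) : (V.restrict F).IsEqualised := by
  intro x y p q
  rw [mapPath_restrict, mapPath_restrict]
  exact hV _ _ _ _

theorem IsEqualised.tr_restrict {P : Type} [Quiver.{0} P] (F : P ⥤q Q) {V : QuiverRep K Q}
    (hV : V.IsEqualised) {x y : P} (h : Nonempty (Quiver.Path x y)) :
    (V.restrict F).tr x y = V.tr (F.obj x) (F.obj y) := by
  obtain ⟨p⟩ := h
  rw [(hV.restrict F).tr_eq p, mapPath_restrict, hV.tr_eq (F.mapPath p)]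

/-! ### Thin representations -/

open Classical in
/-- The thin representation supported on `P`, with all edges inside of `P` acting by the
identity. -/
noncomputable def thin (K : Type u) [Field K] (P : Set Q) : QuiverRep K Q where
  obj x := thinSpace K P x
  map {x y} _ :=
    { toFun := fun v => ⟨if y ∈ P then v.1 else 0, by
        split_ifs with h
        · rw [thinSpace_of_mem h]; trivial
        · exact zero_mem _⟩
      map_add' := fun v w => by ext; simp only [Submodule.coe_add]; split_ifs <;> simp
      map_smul' := fun c v => by
        ext; simp only [Submodule.coe_smul, RingHom.id_apply]; split_ifs <;> simp }

theorem thin_map_of_mem {P : Set Q} {x y : Q} (e : x ⟶ y) (h : y ∈ P) (v : (thin K P).obj x) :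
    ((thin K P).map e v).1 = v.1 := if_pos h

theorem thin_obj_eq_zero {P : Set Q} {x : Q} (h : x ∉ P) (v : (thin K P).obj x) : v = 0 := by
  have h1 : v.1 ∈ thinSpace K P x := v.2
  have h2 : v.1 ∈ (⊥ : Submodule K K) := (thinSpace_of_notMem (K := K) h) ▸ h1
  exact Subtype.ext ((Submodule.mem_bot K).mp h2)

open Classical in
theorem dimVec_thin (P : Set Q) (x : Q) : (thin K P).dimVec x = if x ∈ P then 1 else 0 := by
  change Module.finrank K (thinSpace K P x) = _
  split_ifs with h
  · rw [thinSpace_of_mem h, finrank_top, Module.finrank_self]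
  · rw [thinSpace_of_notMem h, finrank_bot]

theorem support_thin (P : Set Q) : (thin K P).support = P := by
  classical
  ext x
  rw [mem_support_iff, dimVec_thin]
  simp

theorem totalDim_thin [Fintype Q] (P : Set Q) : (thin K P).totalDim = P.ncard := by
  classical
  unfold totalDim
  simp only [dimVec_thin]
  rw [Finset.sum_ite, Finset.sum_const_zero, add_zero, Finset.sum_const, smul_eq_mul, mul_one,
    ← Set.ncard_coe_finset]
  simp

/-- The splitting criterion for thin direct summands. -/
theorem exists_isomorphic_thin_prod (V : QuiverRep K Q) (P : Set Q) (e : ∀ x, V.obj x)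
    (ξ : ∀ x, V.obj x →ₗ[K] K) (he : ∀ x ∉ P, e x = 0) (hξ : ∀ x ∉ P, ξ x = 0)
    (h1 : ∀ x ∈ P, ξ x (e x) = 1)
    (hemap : ∀ (x y : Q) (f : x ⟶ y), x ∈ P → V.map f (e x) = e y)
    (hξmap : ∀ (x y : Q) (f : x ⟶ y), y ∈ P → ∀ v, ξ y (V.map f v) = ξ x v) :
    ∃ W : QuiverRep K Q, V.Isomorphic ((thin K P).prod W) := by
  -- The sections e span a copy of the thin representation and ξ retracts onto it, so the complement
  -- is ker ξ, through the decomposition v = ξ(v) e + (v - ξ(v) e).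
  let U : Sub V :=
    { carrier := fun x => LinearMap.ker (ξ x)
      stable := fun {x y} f v hv => by
        by_cases hy : y ∈ P
        · simpa [hξmap x y f hy] using hv
        · simp [hξ y hy] }
  have key : ∀ x v, v - ξ x v • e x ∈ LinearMap.ker (ξ x) := fun x v => by
    by_cases hx : x ∈ P
    · simp [h1 x hx]
    · simp [hξ x hx]
  have hmem : ∀ x v, ξ x v ∈ thinSpace K P x := fun x v => by
    by_cases hx : x ∈ P
    · simp [thinSpace_of_mem hx]
    · simp [hξ x hx]
  refine ⟨U.toRep, fun x => LinearEquiv.ofBijective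
    ((LinearMap.codRestrict (thinSpace K P x) (ξ x) (hmem x)).prod
      (LinearMap.codRestrict (LinearMap.ker (ξ x))
        (LinearMap.id - (ξ x).smulRight (e x)) (key x))) ⟨?_, ?_⟩, ?_⟩
  · rw [← LinearMap.ker_eq_bot, LinearMap.ker_eq_bot']
    intro v hv
    have h2 : ξ x v = 0 := congrArg (fun p => (p.1 : K)) hv
    have h3 : v - ξ x v • e x = 0 := congrArg (fun p => (p.2 : V.obj x)) hv
    simpa [h2] using h3
  · rintro ⟨⟨c, hc⟩, ⟨w, hw⟩⟩
    have hw' : ξ x w = 0 := hw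
    refine ⟨c • e x + w, ?_⟩
    have h2 : ξ x (c • e x + w) = c := by
      by_cases hx : x ∈ P
      · simp [h1 x hx, hw']
      · rw [thinSpace_of_notMem hx] at hc
        simp [hξ x hx, (Submodule.mem_bot K).mp hc]
    refine Prod.ext (Subtype.ext h2) (Subtype.ext ?_)
    change c • e x + w - ξ x (c • e x + w) • e x = w
    rw [h2]; abel
  · intro x y f v
    refine Prod.ext (Subtype.ext ?_) (Subtype.ext ?_)
    · by_cases hy : y ∈ P
      · exact (hξmap x y f hy v).trans
          (thin_map_of_mem f hy (⟨ξ x v, hmem x v⟩ : (thin K P).obj x)).symm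
      · have : ξ y (V.map f v) = 0 := by simp [hξ y hy]
        exact this.trans (congrArg Subtype.val (thin_obj_eq_zero hy _)).symm
    · change V.map f v - ξ y (V.map f v) • e y = V.map f (v - ξ x v • e x)
      rw [map_sub, map_smul]
      congr 1
      by_cases hx : x ∈ P
      · rw [hemap x y f hx]
        by_cases hy : y ∈ P
        · rw [hξmap x y f hy]
        · rw [he y hy, smul_zero, smul_zero]
      · rw [hξ x hx, LinearMap.zero_apply, zero_smul]
        by_cases hy : y ∈ P
        · rw [hξmap x y f hy, hξ x hx, LinearMap.zero_apply, zero_smul]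
        · rw [he y hy, smul_zero]

/-- The zero representation. -/
def zero (K : Type u) [Field K] (Q : Type) [Quiver.{0} Q] : QuiverRep K Q where
  obj _ := PUnit
  map _ := 0

theorem isZero_zero : (zero K Q).IsZero := fun _ => inferInstanceAs (Subsingleton PUnit)

/-- The direct sum of the thin representations on the members of a list. -/
noncomputable def listSum (K : Type u) [Field K] : List (Set Q) → QuiverRep K Q
  | [] => zero K Q
  | P :: l => (thin K P).prod (listSum K l)

theorem listSum_perm {l l' : List (Set Q)} (h : l.Perm l') :
    (listSum K l).Isomorphic (listSum K l') := by
  induction h with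
  | nil => exact .refl _
  | cons P _ ih => exact (Isomorphic.refl _).prod_congr ih
  | swap P R l => exact isomorphic_prod_left_comm _ _ _
  | trans _ _ ih ih' => exact ih.trans ih'

theorem totalDim_prod [Fintype Q] (V W : QuiverRep K Q) :
    (V.prod W).totalDim = V.totalDim + W.totalDim := by
  unfold totalDim
  simp only [dimVec_prod, Finset.sum_add_distrib]

theorem Isomorphic.totalDim_eq [Fintype Q] {V W : QuiverRep K Q} (h : V.Isomorphic W) :
    V.totalDim = W.totalDim := Finset.sum_congr rfl fun x _ => h.dimVec_eq x

/-- If every nonzero member of a class `C`, closed under direct summands, has a thin direct summand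
supported on a nonempty set satisfying `p`, then every member is a sum of such. -/
theorem exists_isomorphic_listSum [Fintype Q] {C : QuiverRep K Q → Prop} {p : Set Q → Prop}
    (hC : ∀ V W, C V → IsRetract W V → C W)
    (hsplit : ∀ V, C V → ¬ V.IsZero → ∃ P W, p P ∧ P.Nonempty ∧
      V.Isomorphic ((thin K P).prod W)) (V : QuiverRep K Q) (hV : C V) :
    ∃ l : List (Set Q), (∀ P ∈ l, p P) ∧ V.Isomorphic (listSum K l) := by
  induction hn : V.totalDim using Nat.strong_induction_on generalizing V with
  | _ n ih =>
    by_cases h0 : V.IsZero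
    · exact ⟨[], by simp, isomorphic_of_isZero h0 isZero_zero⟩
    · obtain ⟨P, W, hP, hne, hiso⟩ := hsplit V hV h0
      have hpos : 0 < P.ncard := (Set.ncard_pos P.toFinite).mpr hne
      have hdim := hiso.totalDim_eq
      rw [totalDim_prod, totalDim_thin] at hdim
      obtain ⟨l, hl, hWl⟩ := ih W.totalDim (by omega) W
        (hC V W hV (.of_isomorphic_prod hiso)) rfl
      exact ⟨P :: l, by simpa using ⟨hP, hl⟩, hiso.trans ((Isomorphic.refl _).prod_congr hWl)⟩

end Basic

end QuiverRep

namespace QuiverRep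

/-- Splitting off a thin summand which is generated at `a` and cogenerated at `b`. -/
theorem IsEqualised.exists_isomorphic_thin_prod {K : Type u} [Field K] {Q : Type}
    [Quiver.{0} Q] {V : QuiverRep K Q} (hV : V.IsEqualised) {a b : Q} {P : Set Q}
    (hP : ∀ x ∈ P, Nonempty (Quiver.Path a x) ∧ Nonempty (Quiver.Path x b))
    (e : V.obj a) (ξ : V.obj b →ₗ[K] K) (h1 : ξ (V.tr a b e) = 1)
    (hout : ∀ (x y : Q) (_ : x ⟶ y), x ∈ P → y ∉ P → V.tr a y e = 0)
    (hin : ∀ (x y : Q) (_ : x ⟶ y), x ∉ P → y ∈ P → ∀ v, ξ (V.tr x b v) = 0) :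
    ∃ W : QuiverRep K Q, V.Isomorphic ((thin K P).prod W) := by
  classical
  refine QuiverRep.exists_isomorphic_thin_prod V P (fun x => if x ∈ P then V.tr a x e else 0)
    (fun x => if x ∈ P then ξ ∘ₗ V.tr x b else 0) (fun x hx => if_neg hx) (fun x hx => if_neg hx)
    (fun x hx => ?_) (fun x y f hx => ?_) (fun x y f hy v => ?_)
  · rw [if_pos hx, if_pos hx, LinearMap.comp_apply, hV.tr_tr (hP x hx).1 (hP x hx).2, h1]
  · rw [if_pos hx, hV.map_eq_tr f, hV.tr_tr (hP x hx).1 ⟨f.toPath⟩]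
    split_ifs with hy
    · rfl
    · exact hout x y f hx hy
  · rw [if_pos hy, hV.map_eq_tr f, LinearMap.comp_apply, hV.tr_tr ⟨f.toPath⟩ (hP y hy).2]
    split_ifs with hx
    · rfl
    · exact hin x y f hx hy v

end QuiverRep

/-! ### Representations of the line -/

open QuiverRep

section Line

variable {ℓ : ℕ}

noncomputable instance : Fintype (LineVertex ℓ) :=
  Fintype.ofEquiv (Fin (ℓ + 1)) ⟨LineVertex.mk, LineVertex.idx, fun _ => rfl, fun _ => rfl⟩

theorem nonempty_line_path_iff {i j : Fin (ℓ + 1)} :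
    Nonempty (Quiver.Path (⟨i⟩ : LineVertex ℓ) ⟨j⟩) ↔ i ≤ j := by
  constructor
  · rintro ⟨p⟩
    have : ∀ {x y : LineVertex ℓ}, Quiver.Path x y → x.idx ≤ y.idx := by
      intro x y p
      induction p with
      | nil => exact le_rfl
      | cons p e ih =>
        obtain ⟨h⟩ := e
        exact ih.trans (Fin.le_def.mpr (by simp; omega))
    exact this p
  · intro h
    obtain ⟨n, hn⟩ := Nat.exists_eq_add_of_le (Fin.le_def.mp h)
    induction n generalizing j with
    | zero =>
      obtain rfl : i = j := Fin.ext (by omega)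
      exact ⟨.nil⟩
    | succ n ih =>
      obtain ⟨p⟩ := @ih ⟨i + n, by omega⟩ (Fin.le_def.mpr (by simp)) rfl
      exact ⟨p.cons (.edge (by simp; omega))⟩

/-- The vertices of an interval. -/
def lineInterval (a b : Fin (ℓ + 1)) : Set (LineVertex ℓ) := {x | a ≤ x.idx ∧ x.idx ≤ b}

/-- Whether a set of vertices is a nonempty interval. -/
def IsLineInterval (P : Set (LineVertex ℓ)) : Prop := ∃ a b, a ≤ b ∧ P = lineInterval a b

variable {K : Type u} [Field K]

theorem exists_linearMap_eq_one {M : Type*} [AddCommGroup M] [Module K M] (N : Submodule K M)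
    {v : M} (hv : v ∉ N) : ∃ ξ : M →ₗ[K] K, (∀ w ∈ N, ξ w = 0) ∧ ξ v = 1 := by
  obtain ⟨f, hf, hN⟩ := Submodule.exists_le_ker_of_notMem hv
  refine ⟨(f v)⁻¹ • f, fun w hw => ?_, ?_⟩
  · simp [LinearMap.mem_ker.mp (hN hw)]
  · simp [hf]

/-- A nonzero vector at the first nonzero vertex a, followed until its last nonzero image at b,
spans a summand: nothing enters from the left of a, and the vector dies after b. Any functional
equal to 1 on its image at b gives the retraction. -/
theorem QuiverRep.IsEqualised.exists_line_split {V : QuiverRep K (LineVertex ℓ)}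
    (hV : V.IsEqualised) (h0 : ¬ V.IsZero) : ∃ P W, IsLineInterval P ∧ P.Nonempty ∧
      V.Isomorphic ((thin K P).prod W) := by
  have hex : {a | Nontrivial (V.obj ⟨a⟩)}.Nonempty := by
    by_contra hcon
    refine h0 fun ⟨i⟩ => ?_
    by_contra hi
    exact hcon ⟨i, not_subsingleton_iff_nontrivial.mp hi⟩
  obtain ⟨a, ha, hamin⟩ := wellFounded_lt.has_min _ hex
  obtain ⟨e, he⟩ := @exists_ne _ ha 0
  obtain ⟨b, ⟨hab, hb⟩, hbmax⟩ := wellFounded_gt.has_min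
    {b : Fin (ℓ + 1) | a ≤ b ∧ V.tr ⟨a⟩ ⟨b⟩ e ≠ 0} ⟨a, le_rfl, by rwa [hV.tr_self]⟩
  obtain ⟨ξ, -, hξ⟩ := exists_linearMap_eq_one (K := K) ⊥ (by simpa using hb)
  obtain ⟨W, hW⟩ := hV.exists_isomorphic_thin_prod (P := lineInterval a b) (a := ⟨a⟩) (b := ⟨b⟩)
    (fun x hx => ⟨nonempty_line_path_iff.mpr hx.1, nonempty_line_path_iff.mpr hx.2⟩) e ξ hξ
    (by
      rintro _ _ (@⟨i, j, hij⟩) hx hy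
      by_contra hne
      have hx1 : a ≤ i := hx.1
      have haj : a ≤ j := hx1.trans (Fin.le_def.mpr (by omega))
      refine hbmax j ⟨haj, hne⟩ ?_
      by_contra hlt
      exact hy ⟨haj, not_lt.mp hlt⟩)
    (by
      rintro _ _ (@⟨i, j, hij⟩) hx hy v
      have hia : i < a := by
        by_contra hlt
        have hy2 : j ≤ b := hy.2
        exact hx ⟨not_lt.mp hlt, le_trans (Fin.le_def.mpr (by simp; omega)) hy2⟩
      have : Subsingleton (V.obj ⟨i⟩) :=
        not_nontrivial_iff_subsingleton.mp fun h => hamin i h hia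
      rw [Subsingleton.elim v 0, map_zero, map_zero])
  exact ⟨_, W, ⟨a, b, hab, rfl⟩, ⟨⟨a⟩, le_rfl, hab⟩, hW⟩

theorem isomorphic_intervalModule (a b : Fin (ℓ + 1)) :
    (thin K (lineInterval a b)).Isomorphic (intervalModule K a b) := by
  have hsp : ∀ x, thinSpace K (lineInterval a b) x = intervalSpace K a b x.idx := fun x => by
    unfold thinSpace intervalSpace
    congr
  refine ⟨fun x => LinearEquiv.ofEq _ _ (hsp x), fun x y f v => Subtype.ext ?_⟩
  by_cases hy : y ∈ lineInterval a b
  · exact (thin_map_of_mem f hy v).trans (if_pos hy : ite (a ≤ y.idx ∧ y.idx ≤ b) v.1 0 = _).symm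
  · exact (congrArg Subtype.val (thin_obj_eq_zero hy _)).trans
      (if_neg hy : ite (a ≤ y.idx ∧ y.idx ≤ b) v.1 0 = _).symm

theorem isomorphic_directSum_cons {Q : Type} [Quiver.{0} Q] {n : ℕ}
    (V : Fin (n + 1) → QuiverRep K Q) :
    ((V 0).prod (directSum fun i : Fin n => V i.succ)).Isomorphic (directSum V) := by
  refine ⟨fun x =>
    { toFun := fun v i => Fin.cases (motive := fun i => (V i).obj x) v.1 v.2 i
      invFun := fun v => (v 0, fun i => v i.succ)
      left_inv := fun _ => rfl
      right_inv := fun v => by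
        funext i
        cases i using Fin.cases <;> rfl
      map_add' := fun v w => by
        funext i
        cases i using Fin.cases <;> rfl
      map_smul' := fun c v => by
        funext i
        cases i using Fin.cases <;> rfl }, fun x y e v => ?_⟩
  funext i
  cases i using Fin.cases <;> rfl

theorem listSum_isomorphic_directSum (l : List (Set (LineVertex ℓ)))
    (hl : ∀ P ∈ l, IsLineInterval P) : ∃ (n : ℕ) (a b : Fin n → Fin (ℓ + 1)),
      (∀ i, a i ≤ b i) ∧
        (listSum K l).Isomorphic (directSum fun i => intervalModule K (a i) (b i)) := by
  induction l with
  | nil =>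
    refine ⟨0, finZeroElim, finZeroElim, fun i => i.elim0, isomorphic_of_isZero isZero_zero ?_⟩
    exact fun x => inferInstanceAs (Subsingleton (∀ i : Fin 0, _))
  | cons P l ih =>
    obtain ⟨n, a, b, hab, hiso⟩ := ih fun R hR => hl R (List.mem_cons_of_mem _ hR)
    obtain ⟨a', b', hab', rfl⟩ := hl P List.mem_cons_self
    refine ⟨n + 1, Fin.cons a' a, Fin.cons b' b, Fin.cases hab' hab, ?_⟩
    refine ((isomorphic_intervalModule a' b').prod_congr hiso).trans ?_
    exact isomorphic_directSum_cons
      fun i => intervalModule K ((Fin.cons a' a : Fin (n + 1) → Fin (ℓ + 1)) i)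
        ((Fin.cons b' b : Fin (n + 1) → Fin (ℓ + 1)) i)

/-- Every equalised representation of the line has a barcode. -/
theorem QuiverRep.IsEqualised.exists_barcode {V : QuiverRep K (LineVertex ℓ)}
    (hV : V.IsEqualised) : ∃ (n : ℕ) (a b : Fin n → Fin (ℓ + 1)), (∀ i, a i ≤ b i) ∧
      V.Isomorphic (directSum fun i => intervalModule K (a i) (b i)) := by
  obtain ⟨l, hl, hiso⟩ := exists_isomorphic_listSum (C := fun V => V.IsEqualised)
    (fun V W h hW => hW.isEqualised h) (fun V h h0 => h.exists_line_split h0) V hV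
  obtain ⟨n, a, b, hab, hiso'⟩ := listSum_isomorphic_directSum (K := K) l hl
  exact ⟨n, a, b, hab, hiso.trans hiso'⟩

theorem intervalModule_obj_eq_zero {a b : Fin (ℓ + 1)} {x : LineVertex ℓ}
    (h : ¬ (a ≤ x.idx ∧ x.idx ≤ b)) (v : (intervalModule K a b).obj x) : v.1 = 0 := by
  have h1 : v.1 ∈ intervalSpace K a b x.idx := v.2
  have h2 : v.1 ∈ (⊥ : Submodule K K) := (if_neg h : intervalSpace K a b x.idx = ⊥) ▸ h1
  exact (Submodule.mem_bot K).mp h2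

theorem intervalModule_mapPath {a b : Fin (ℓ + 1)} {x y : LineVertex ℓ} (p : Quiver.Path x y)
    (hx : a ≤ x.idx) (hy : y.idx ≤ b) (v : (intervalModule K a b).obj x) :
    ((intervalModule K a b).mapPath p v).1 = v.1 := by
  induction p with
  | nil => rfl
  | @cons y z p e ih =>
    have hxy : x.idx ≤ y.idx := nonempty_line_path_iff.mp ⟨p⟩
    have hyz : y.idx ≤ z.idx := nonempty_line_path_iff.mp ⟨e.toPath⟩
    refine Eq.trans ?_ (ih (hyz.trans hy))
    exact if_pos ⟨hx.trans (hxy.trans hyz), hy⟩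

theorem intervalModule_tr {a b : Fin (ℓ + 1)} {x y : LineVertex ℓ} (hxy : x.idx ≤ y.idx)
    (hx : a ≤ x.idx) (hy : y.idx ≤ b) (v : (intervalModule K a b).obj x) :
    ((intervalModule K a b).tr x y v).1 = v.1 := by
  unfold QuiverRep.tr
  rw [dif_pos (nonempty_line_path_iff.mpr hxy)]
  exact intervalModule_mapPath _ hx hy v

/-- The projection of a direct sum onto a summand. -/
def directSumProj {Q : Type} [Quiver.{0} Q] {n : ℕ} (V : Fin n → QuiverRep K Q) (i : Fin n) :
    Hom (directSum V) (V i) where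
  app _ := LinearMap.proj i
  naturality _ _ := rfl

/-- Failure of both inclusions produces two bars: one that contains x and z, because some image is
not killed, and one that contains y but neither x nor z, because some kernel element is not an
image. The second is strictly nested in the first. -/
theorem comparable_of_hasNoNestedIntervals {V : QuiverRep K (LineVertex ℓ)}
    (hV : V.IsEqualised) (hn : HasNoNestedIntervals V) {x y z : LineVertex ℓ}
    (hxy : x.idx ≤ y.idx) (hyz : y.idx ≤ z.idx) : V.Comparable x y z := by
  obtain ⟨n, a, b, hab, hiso⟩ := hV.exists_barcode
  have hnn := hn n a b hab hiso
  have hret := IsRetract.of_isomorphic hiso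
  set D := directSum fun i => intervalModule K (a i) (b i)
  refine hret.comparable ?_
  have htr : ∀ {x y : LineVertex ℓ} (v : D.obj x) (i : Fin n),
      D.tr x y v i = (intervalModule K (a i) (b i)).tr x y (v i) :=
    fun v i => (directSumProj _ i).tr v
  by_contra hcon
  unfold Comparable at hcon
  push Not at hcon
  obtain ⟨h1, h2⟩ := hcon
  obtain ⟨w, hw, hw'⟩ := Set.not_subset.mp h1
  obtain ⟨_, ⟨u, rfl⟩, hu⟩ := Set.not_subset.mp h2
  have hw : D.tr y z w = 0 := hw
  have hu : D.tr y z (D.tr x y u) ≠ 0 := hu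
  -- an interval containing both `x` and `z`
  obtain ⟨i, hi⟩ : ∃ i, D.tr y z (D.tr x y u) i ≠ 0 := by
    by_contra hc
    push Not at hc
    exact hu (funext hc)
  have hai : a i ≤ x.idx := by
    by_contra hc
    have : u i = 0 := Subtype.ext (intervalModule_obj_eq_zero (fun h => hc h.1) _)
    rw [htr, htr, this, map_zero, map_zero] at hi
    exact hi rfl
  have hbi : z.idx ≤ b i := by
    by_contra hc
    exact hi (Subtype.ext (intervalModule_obj_eq_zero (fun h => hc h.2) _))
  -- an interval born after `x` which contains `y`
  obtain ⟨j, hj, hj'⟩ : ∃ j, w j ≠ 0 ∧ x.idx < a j := by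
    by_contra hc
    push Not at hc
    have hz : ∀ j, ¬ y.idx ≤ b j → w j = 0 := fun j hc' =>
      Subtype.ext (intervalModule_obj_eq_zero (fun h => hc' h.2) (w j))
    have hmem : ∀ j, (w j).1 ∈ intervalSpace K (a j) (b j) x.idx := fun j => by
      by_cases hwj : w j = 0
      · rw [hwj]; exact zero_mem _
      · have hyb : y.idx ≤ b j := by
          by_contra hc'
          exact hwj (hz j hc')
        have : intervalSpace K (a j) (b j) x.idx = ⊤ := if_pos ⟨hc j hwj, hxy.trans hyb⟩
        rw [this]; trivial
    -- If every bar on which w is nonzero were already alive at x, the coordinates of w could be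
    -- read at x and would give a preimage of w.
    let u' : D.obj x := fun j => ⟨(w j).1, hmem j⟩
    refine hw' ⟨u', funext fun j => (htr u' j).trans ?_⟩
    by_cases hwj : w j = 0
    · have h0 : (w j).1 = 0 := by rw [hwj]; rfl
      have : u' j = 0 := Subtype.ext h0
      rw [this, map_zero, hwj]
    · have hyb : y.idx ≤ b j := by
        by_contra hc'
        exact hwj (hz j hc')
      exact Subtype.ext (intervalModule_tr hxy (hc j hwj) hyb _)
  -- The bar j must end before z, since otherwise the nonzero coordinate of w there would survive to
  -- z, although w lies in the kernel.
  refine hnn ⟨i, j, hai.trans_lt hj', lt_of_lt_of_le ?_ hbi⟩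
  by_contra hc
  have hajy : a j ≤ y.idx := by
    by_contra hc'
    exact hj (Subtype.ext (intervalModule_obj_eq_zero (fun h => hc' h.1) _))
  have h3 := congrFun hw j
  rw [htr] at h3
  exact hj (Subtype.ext ((intervalModule_tr hyz hajy (not_lt.mp hc) (w j)).symm.trans
    (congrArg Subtype.val h3)))

/-- Two nested bars both contain the birth of the inner one, which forces dimension at least 2
there. -/
theorem hasNoNestedIntervals_of_dimVec_le_one {V : QuiverRep K (LineVertex ℓ)}
    (h : ∀ x, V.dimVec x ≤ 1) : HasNoNestedIntervals V := by
  rintro n a b hab hiso ⟨i, j, hij, hji⟩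
  have hd := hiso.dimVec_eq ⟨a j⟩
  have h1 := h ⟨a j⟩
  rw [hd] at h1
  have hsum : (directSum fun i => intervalModule K (a i) (b i)).dimVec ⟨a j⟩ =
      ∑ i, Module.finrank K (intervalSpace K (a i) (b i) (a j)) :=
    Module.finrank_pi_fintype K
  have hone : ∀ k ∈ ({i, j} : Finset (Fin n)),
      1 ≤ Module.finrank K (intervalSpace K (a k) (b k) (a j)) := by
    intro k hk
    have : a k ≤ a j ∧ a j ≤ b k := by
      rcases Finset.mem_insert.mp hk with rfl | hk
      · exact ⟨hij.le, (hab j).trans hji.le⟩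
      · rw [Finset.mem_singleton.mp hk]; exact ⟨le_rfl, hab j⟩
    unfold intervalSpace
    rw [if_pos this, finrank_top, Module.finrank_self]
  have hne : i ≠ j := fun h => by rw [h] at hij; exact lt_irrefl _ hij
  have h2 := Finset.card_nsmul_le_sum _ _ _ hone
  rw [Finset.card_pair hne] at h2
  have h3 := Finset.sum_le_sum_of_subset (f := fun k =>
    Module.finrank K (intervalSpace K (a k) (b k) (a j))) (Finset.subset_univ {i, j})
  rw [hsum] at h1
  simp only [smul_eq_mul] at h2
  omega

end Line

/-! ### Representations of the ladder -/

section Ladder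

variable {ℓ : ℕ}

/-- The horizontal coordinate of a vertex. -/
def LadderVertex.col : LadderVertex ℓ → ℕ
  | .top i => i.val
  | .bot i => i.val

/-- The row of a vertex, `0` for the top row and `1` for the bottom row. -/
def LadderVertex.row : LadderVertex ℓ → ℕ
  | .top _ => 0
  | .bot _ => 1

theorem nonempty_ladder_path_iff {x y : LadderVertex ℓ} :
    Nonempty (Quiver.Path x y) ↔ x.row ≤ y.row ∧ x.col ≤ y.col := by
  constructor
  · rintro ⟨p⟩
    induction p with
    | nil => exact ⟨le_rfl, le_rfl⟩
    | cons p e ih =>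
      obtain ⟨h⟩ | ⟨h⟩ | ⟨i⟩ := e <;> simp only [LadderVertex.row, LadderVertex.col] at ih ⊢ <;> omega
  · rintro ⟨h1, h2⟩
    have htop : ∀ {i j : Fin (ℓ + 1)}, i ≤ j →
        Nonempty (Quiver.Path (.top i : LadderVertex ℓ) (.top j)) := fun h =>
      (nonempty_line_path_iff.mpr h).map (topRow ℓ).mapPath
    have hbot : ∀ {i j : Fin (ℓ + 1)}, i ≤ j →
        Nonempty (Quiver.Path (.bot i : LadderVertex ℓ) (.bot j)) := fun h =>
      (nonempty_line_path_iff.mpr h).map (botRow ℓ).mapPath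
    rcases x with i | i <;> rcases y with j | j
    · exact htop h2
    · exact (htop h2).map fun p => p.cons (.down j)
    · simp [LadderVertex.row] at h1
    · exact hbot h2

/-- The vertices `top i` with `a ≤ i < b` and `bot j` with `c ≤ j < d`. -/
def block (ℓ a b c d : ℕ) : Set (LadderVertex ℓ) :=
  {x | match x with
    | .top i => a ≤ i.val ∧ i.val < b
    | .bot j => c ≤ j.val ∧ j.val < d}

theorem top_mem_block {a b c d : ℕ} {i : Fin (ℓ + 1)} :
    .top i ∈ block ℓ a b c d ↔ a ≤ i.val ∧ i.val < b := Iff.rfl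

theorem bot_mem_block {a b c d : ℕ} {i : Fin (ℓ + 1)} :
    .bot i ∈ block ℓ a b c d ↔ c ≤ i.val ∧ i.val < d := Iff.rfl

/-- The parameters of the supports of indecomposable nestfree representations. Representations
supported in the top row have `c = d = a`, and those supported in the bottom row have
`a = b = 0`. -/
def BlockShape (ℓ a b c d : ℕ) : Prop :=
  (a < b ∧ b ≤ ℓ + 1 ∧ c ≤ a ∧ a ≤ d ∧ d ≤ b ∧ (a = d → c = a)) ∨
    (a = 0 ∧ b = 0 ∧ c < d ∧ d ≤ ℓ + 1)

/-- The supports of indecomposable nestfree representations. -/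
def IsBlock (P : Set (LadderVertex ℓ)) : Prop :=
  ∃ a b c d, BlockShape ℓ a b c d ∧ P = block ℓ a b c d

variable {K : Type u} [Field K]

/-- The range of the dual map of f is the annihilator of ker f. -/
theorem exists_linearMap_comp_eq {M N : Type*} [AddCommGroup M] [Module K M] [AddCommGroup N]
    [Module K N] (f : M →ₗ[K] N) (g : M →ₗ[K] K) (h : ∀ v, f v = 0 → g v = 0) :
    ∃ ξ : N →ₗ[K] K, ∀ v, ξ (f v) = g v := by
  have hg : g ∈ LinearMap.range f.dualMap := by
    rw [LinearMap.range_dualMap_eq_dualAnnihilator_ker, Submodule.mem_dualAnnihilator]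
    exact fun v hv => h v hv
  obtain ⟨ξ, rfl⟩ := hg
  exact ⟨ξ, fun v => rfl⟩

/-- The splitting criterion for the summand supported on a block with both rows nonempty. -/
theorem QuiverRep.IsEqualised.exists_block_split {V : QuiverRep K (LadderVertex ℓ)}
    (hV : V.IsEqualised) {a b c d : Fin (ℓ + 1)} (hca : c ≤ a) (had : a ≤ d) (hdb : d ≤ b)
    (e : V.obj (.top a)) (f : V.obj (.bot c)) (ξ : V.obj (.top b) →ₗ[K] K)
    (η : V.obj (.bot d) →ₗ[K] K)
    (hef : V.tr (.bot c) (.bot a) f = V.tr (.top a) (.bot a) e)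
    (hξη : ∀ v, ξ (V.tr (.top d) (.top b) v) = η (V.tr (.top d) (.bot d) v))
    (h1 : η (V.tr (.top a) (.bot d) e) = 1)
    (heb : ∀ i, b < i → V.tr (.top a) (.top i) e = 0)
    (hed : ∀ i, d < i → V.tr (.top a) (.bot i) e = 0)
    (hηa : ∀ i, i < a → ∀ v, η (V.tr (.top i) (.bot d) v) = 0)
    (hηc : ∀ i, i < c → ∀ v, η (V.tr (.bot i) (.bot d) v) = 0) :
    ∃ W, V.Isomorphic ((thin K (block ℓ a (b + 1) c (d + 1))).prod W) := by
  classical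
  have tt : ∀ {i j : Fin (ℓ + 1)}, i.val ≤ j.val →
      Nonempty (Quiver.Path (.top i : LadderVertex ℓ) (.top j)) := fun h =>
    nonempty_ladder_path_iff.mpr ⟨le_rfl, h⟩
  have tb : ∀ {i j : Fin (ℓ + 1)}, i.val ≤ j.val →
      Nonempty (Quiver.Path (.top i : LadderVertex ℓ) (.bot j)) := fun h =>
    nonempty_ladder_path_iff.mpr ⟨Nat.zero_le _, h⟩
  have bb : ∀ {i j : Fin (ℓ + 1)}, i.val ≤ j.val →
      Nonempty (Quiver.Path (.bot i : LadderVertex ℓ) (.bot j)) := fun h =>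
    nonempty_ladder_path_iff.mpr ⟨le_rfl, h⟩
  simp only [Fin.le_def, Fin.lt_def] at hca had hdb heb hed hηa hηc
  -- From column a on, f and e have the same images in the bottom row; dually, `hξη'` identifies ξ
  -- and η on the top row up to column d. These two compatibilities glue the row data into one
  -- section and one functional on the whole block.
  have hfe : ∀ j : Fin (ℓ + 1), a.val ≤ j.val →
      V.tr (.bot c) (.bot j) f = V.tr (.top a) (.bot j) e := fun j hj => by
    rw [← hV.tr_tr (bb hca) (bb hj), hef, hV.tr_tr (tb le_rfl) (bb hj)]
  have hξη' : ∀ (i : Fin (ℓ + 1)) (v : V.obj (.top i)), i.val ≤ d.val →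
      ξ (V.tr (.top i) (.top b) v) = η (V.tr (.top i) (.bot d) v) := fun i v hi => by
    rw [← hV.tr_tr (tt hi) (tt hdb), hξη, hV.tr_tr (tt hi) (tb le_rfl)]
  set P := block ℓ a (b + 1) c (d + 1) with hP
  let E : ∀ x, V.obj x := fun x => match x with
    | .top i => V.tr (.top a) (.top i) e
    | .bot j => V.tr (.bot c) (.bot j) f
  let Ξ : ∀ x, V.obj x →ₗ[K] K := fun x => match x with
    | .top i => ξ ∘ₗ V.tr (.top i) (.top b)
    | .bot j => η ∘ₗ V.tr (.bot j) (.bot d)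
  refine QuiverRep.exists_isomorphic_thin_prod V P (fun x => if x ∈ P then E x else 0)
    (fun x => if x ∈ P then Ξ x else 0) (fun x hx => if_neg hx) (fun x hx => if_neg hx)
    (fun x hx => ?_) (fun x y g hx => ?_) (fun x y g hy v => ?_)
  · rw [if_pos hx, if_pos hx]
    rcases x with i | j
    · rw [hP, top_mem_block] at hx
      change ξ (V.tr _ _ (V.tr _ _ e)) = 1
      rw [hV.tr_tr (tt hx.1) (tt (by omega)), hξη' a e had, h1]
    · rw [hP, bot_mem_block] at hx
      change η (V.tr _ _ (V.tr _ _ f)) = 1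
      rw [hV.tr_tr (bb hx.1) (bb (by omega)), hfe d had, h1]
  · rw [if_pos hx, hV.map_eq_tr g]
    obtain @⟨i, j, h⟩ | @⟨i, j, h⟩ | ⟨i⟩ := g
    · rw [hP, top_mem_block] at hx
      change V.tr _ _ (V.tr _ _ e) = _
      rw [hV.tr_tr (tt hx.1) (tt (by omega))]
      split_ifs with hy
      · rfl
      · rw [hP, top_mem_block] at hy
        exact heb j (by omega)
    · rw [hP, bot_mem_block] at hx
      change V.tr _ _ (V.tr _ _ f) = _
      rw [hV.tr_tr (bb hx.1) (bb (by omega))]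
      split_ifs with hy
      · rfl
      · rw [hP, bot_mem_block] at hy
        rw [hfe j (by omega)]
        exact hed j (by omega)
    · rw [hP, top_mem_block] at hx
      change V.tr _ _ (V.tr _ _ e) = _
      rw [hV.tr_tr (tt hx.1) (tb le_rfl)]
      split_ifs with hy
      · exact (hfe i hx.1).symm
      · rw [hP, bot_mem_block] at hy
        exact hed i (by omega)
  · rw [if_pos hy, hV.map_eq_tr g]
    obtain @⟨i, j, h⟩ | @⟨i, j, h⟩ | ⟨i⟩ := g
    · rw [hP, top_mem_block] at hy
      change ξ (V.tr _ _ (V.tr _ _ v)) = _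
      rw [hV.tr_tr (tt (by omega)) (tt (by omega))]
      split_ifs with hx
      · rfl
      · rw [hP, top_mem_block] at hx
        rw [hξη' i v (by omega)]
        exact hηa i (by omega) v
    · rw [hP, bot_mem_block] at hy
      change η (V.tr _ _ (V.tr _ _ v)) = _
      rw [hV.tr_tr (bb (by omega)) (bb (by omega))]
      split_ifs with hx
      · rfl
      · rw [hP, bot_mem_block] at hx
        exact hηc i (by omega) v
    · rw [hP, bot_mem_block] at hy
      change η (V.tr _ _ (V.tr _ _ v)) = _
      rw [hV.tr_tr (tb le_rfl) (bb (by omega))]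
      split_ifs with hx
      · exact (hξη' i v (by omega)).symm
      · rw [hP, top_mem_block] at hx
        exact hηa i (by omega) v

/-- Splitting off a summand on which the vertical maps are nonzero. -/
theorem QuiverRep.IsEqualised.exists_split_of_down_ne_zero {V : QuiverRep K (LadderVertex ℓ)}
    (hV : V.IsEqualised)
    (htop : ∀ i j k : Fin (ℓ + 1), i ≤ j → j ≤ k → V.Comparable (.top i) (.top j) (.top k))
    (hbot : ∀ i j k : Fin (ℓ + 1), i ≤ j → j ≤ k → V.Comparable (.bot i) (.bot j) (.bot k))
    (hdown : ∃ i : Fin (ℓ + 1), V.tr (.top i) (.bot i) ≠ 0) :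
    ∃ P W, IsBlock P ∧ P.Nonempty ∧ V.Isomorphic ((thin K P).prod W) := by
  have tt : ∀ {i j : Fin (ℓ + 1)}, i ≤ j →
      Nonempty (Quiver.Path (.top i : LadderVertex ℓ) (.top j)) := fun h =>
    nonempty_ladder_path_iff.mpr ⟨le_rfl, h⟩
  have tb : ∀ {i j : Fin (ℓ + 1)}, i ≤ j →
      Nonempty (Quiver.Path (.top i : LadderVertex ℓ) (.bot j)) := fun h =>
    nonempty_ladder_path_iff.mpr ⟨Nat.zero_le _, h⟩
  have bb : ∀ {i j : Fin (ℓ + 1)}, i ≤ j →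
      Nonempty (Quiver.Path (.bot i : LadderVertex ℓ) (.bot j)) := fun h =>
    nonempty_ladder_path_iff.mpr ⟨le_rfl, h⟩
  -- The last column with a nonzero vertical map is where the bottom interval will end: everything
  -- coming from the top row dies in the bottom row after d.
  obtain ⟨d, hd, hdmax⟩ := wellFounded_gt.has_min
    {i : Fin (ℓ + 1) | V.tr (.top i) (.bot i) ≠ 0} hdown
  have hX0 : ∀ i j : Fin (ℓ + 1), i ≤ j → d < j → ∀ v, V.tr (.top i) (.bot j) v = 0 := by
    intro i j hij hdj v
    have : V.tr (.top j) (.bot j) = 0 := by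
      by_contra hne
      exact hdmax j hne hdj
    rw [← hV.tr_tr (tt hij) (tb le_rfl), this, LinearMap.zero_apply]
  -- the birth of the bottom interval
  obtain ⟨c, ⟨hcd, hc⟩, hcmin⟩ := wellFounded_lt.has_min
    {c : Fin (ℓ + 1) | c ≤ d ∧ LinearMap.range (V.tr (.top d) (.bot d)) ≤
      LinearMap.range (V.tr (.bot c) (.bot d))} ⟨d, le_rfl, by
        rintro v -
        exact ⟨v, hV.tr_self v⟩⟩
  -- L is the space of vectors at the bottom of column d that are born before c: the image from
  -- column c - 1, or 0 if c = 0. Minimality of c says that the image of the top row is not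
  -- contained in L.
  obtain ⟨L, hL, hdL⟩ : ∃ L : Submodule K (V.obj (.bot d)),
      (∀ i, i < c → LinearMap.range (V.tr (.bot i) (.bot d)) ≤ L) ∧
        ∃ v, V.tr (.top d) (.bot d) v ∉ L := by
    by_cases hc0 : c.val = 0
    · refine ⟨⊥, fun i hi => absurd (Fin.lt_def.mp hi) (by omega), ?_⟩
      by_contra hcon
      push Not at hcon
      exact hd (LinearMap.ext fun v => (Submodule.mem_bot K).mp (hcon v))
    · have hc1 : (⟨c - 1, by omega⟩ : Fin (ℓ + 1)) < c := by
        rw [Fin.lt_def]; change c.val - 1 < c.val; omega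
      refine ⟨LinearMap.range (V.tr (.bot ⟨c - 1, by omega⟩) (.bot d)), ?_, ?_⟩
      · rintro i hi _ ⟨v, rfl⟩
        have hi' : i ≤ (⟨c - 1, by omega⟩ : Fin (ℓ + 1)) :=
          Fin.le_def.mpr (by have := Fin.lt_def.mp hi; simp; omega)
        exact ⟨V.tr _ _ v, hV.tr_tr (bb hi') (bb (hc1.le.trans hcd)) v⟩
      · by_contra hcon
        push Not at hcon
        refine hcmin _ ⟨hc1.le.trans hcd, ?_⟩ hc1
        rintro _ ⟨v, rfl⟩
        exact hcon v
  -- the birth of the top interval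
  obtain ⟨a, ⟨had, ha⟩, hamin⟩ := wellFounded_lt.has_min
    {a : Fin (ℓ + 1) | a ≤ d ∧ ∃ e, V.tr (.top a) (.bot d) e ∉ L} ⟨d, le_rfl, hdL⟩
  have haL : ∀ i, i < a → ∀ v, V.tr (.top i) (.bot d) v ∈ L := by
    intro i hi v
    by_contra hcon
    exact hamin i ⟨hi.le.trans had, v, hcon⟩ hi
  -- If a came before c, the vector at the top of column a would reach the bottom of column d
  -- through the bottom of column a, hence land in L.
  have hca : c ≤ a := by
    by_contra hac
    obtain ⟨e, he⟩ := ha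
    refine he (hL a (not_le.mp hac) ⟨V.tr (.top a) (.bot a) e, ?_⟩)
    exact hV.tr_tr (tb le_rfl) (bb had) e
  -- the death of the top interval
  have hℓ : ∃ e, V.tr (.top a) (.bot d) e ∉ L ∧
      ∀ i : Fin (ℓ + 1), ℓ + 1 ≤ i.val → V.tr (.top a) (.top i) e = 0 := by
    obtain ⟨e, he⟩ := ha
    exact ⟨e, he, fun i hi => absurd i.isLt (by omega)⟩
  obtain ⟨n, ⟨e, he, hen⟩, hnmin⟩ := wellFounded_lt.has_min
    {n : ℕ | ∃ e, V.tr (.top a) (.bot d) e ∉ L ∧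
      ∀ i : Fin (ℓ + 1), n ≤ i.val → V.tr (.top a) (.top i) e = 0} ⟨ℓ + 1, hℓ⟩
  have hnℓ : n ≤ ℓ + 1 := by
    by_contra hcon
    exact hnmin _ hℓ (not_le.mp hcon)
  have hdn : d.val < n := by
    by_contra hcon
    apply he
    rw [← hV.tr_tr (tt had) (tb le_rfl), hen d (not_lt.mp hcon), map_zero]
    exact zero_mem _
  obtain ⟨b, rfl⟩ : ∃ b : Fin (ℓ + 1), n = b.val + 1 :=
    ⟨⟨n - 1, by omega⟩, by simp; omega⟩
  have hdb : d ≤ b := Fin.le_def.mpr (by omega)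
  -- The vector e was chosen with the shortest life in the top row among all vectors at a that leave
  -- L, so every such vector survives at least up to b = n - 1.
  have hbmin : ∀ e', V.tr (.top a) (.bot d) e' ∉ L → V.tr (.top a) (.top b) e' ≠ 0 := by
    intro e' he' h0
    refine hnmin b ⟨e', he', fun i hi => ?_⟩ (Nat.lt_succ_self _)
    rw [← hV.tr_tr (tt (had.trans hdb)) (tt (Fin.le_def.mpr hi)), h0, map_zero]
  obtain ⟨η, hηL, hη1⟩ := exists_linearMap_eq_one (K := K) L he
  obtain ⟨f₀, hf₀⟩ : V.tr (.top a) (.bot d) e ∈ LinearMap.range (V.tr (.bot c) (.bot d)) :=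
    hc ⟨V.tr (.top a) (.top d) e, hV.tr_tr (tt had) (tb le_rfl) e⟩
  -- A lift f₀ of the image of e exists only as seen in column d. In column a, f₀ and e differ by an
  -- element of the kernel towards d, and comparability in the bottom row puts this difference into
  -- the image from c. In the other case f₀ would die before d, and e would map into L.
  obtain ⟨f, hf⟩ : V.tr (.top a) (.bot a) e ∈ LinearMap.range (V.tr (.bot c) (.bot a)) := by
    rcases hbot c a d hca had with h | h
    · have hmem : V.tr (.top a) (.bot a) e - V.tr (.bot c) (.bot a) f₀ ∈
          LinearMap.ker (V.tr (.bot a) (.bot d)) := by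
        rw [LinearMap.mem_ker, map_sub, hV.tr_tr (tb le_rfl) (bb had), hV.tr_tr (bb hca) (bb had),
          hf₀, sub_self]
      have h2 := Submodule.add_mem _ (h hmem) ⟨f₀, rfl⟩
      rwa [sub_add_cancel] at h2
    · have h0 : V.tr (.bot a) (.bot d) (V.tr (.bot c) (.bot a) f₀) = 0 := h ⟨f₀, rfl⟩
      rw [hV.tr_tr (bb hca) (bb had), hf₀] at h0
      exact absurd (h0 ▸ zero_mem L) he
  -- The functional η pulled back to the top of column d must vanish on vectors that die on the way
  -- to b. Otherwise comparability in the top row makes such a vector the image of some e' at a that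
  -- leaves L and is dead at b, or makes e itself dead at b; both contradict `hbmin`.
  obtain ⟨ξ, hξ⟩ := exists_linearMap_comp_eq (V.tr (.top d) (.top b))
    (η ∘ₗ V.tr (.top d) (.bot d)) (fun v hv => by
      by_contra hne
      have hvL : V.tr (.top d) (.bot d) v ∉ L := fun h => hne (hηL _ h)
      rcases htop a d b had hdb with h | h
      · obtain ⟨e', rfl⟩ := h hv
        rw [hV.tr_tr (tt had) (tb le_rfl)] at hvL
        rw [hV.tr_tr (tt had) (tt hdb)] at hv
        exact hbmin e' hvL hv
      · have h0 : V.tr (.top d) (.top b) (V.tr (.top a) (.top d) e) = 0 := h ⟨e, rfl⟩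
        rw [hV.tr_tr (tt had) (tt hdb)] at h0
        exact hbmin e he h0)
  obtain ⟨W, hW⟩ := hV.exists_block_split hca had hdb e f ξ η hf hξ hη1
    (fun i hi => hen i (Fin.lt_def.mp hi)) (fun i hi => hX0 a i (had.trans hi.le) hi e)
    (fun i hi v => hηL _ (haL i hi v)) (fun i hi v => hηL _ (hL i hi ⟨v, rfl⟩))
  have h1 := Fin.le_def.mp hca
  have h2 := Fin.le_def.mp had
  refine ⟨_, W, ⟨a, b + 1, c, d + 1, Or.inl ?_, rfl⟩, ⟨.top a, ?_⟩, hW⟩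
  · omega
  · rw [top_mem_block]; omega

/-- Without vertical maps the rows decouple, and the argument for the line applies to one row. The
bottom row is used only when the top row vanishes, so that nothing enters it from above. -/
theorem QuiverRep.IsEqualised.exists_split_of_down_eq_zero {V : QuiverRep K (LadderVertex ℓ)}
    (hV : V.IsEqualised) (hdown : ∀ i : Fin (ℓ + 1), V.tr (.top i) (.bot i) = 0)
    (h0 : ¬ V.IsZero) :
    ∃ P W, IsBlock P ∧ P.Nonempty ∧ V.Isomorphic ((thin K P).prod W) := by
  have tt : ∀ {i j : Fin (ℓ + 1)}, i.val ≤ j.val →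
      Nonempty (Quiver.Path (.top i : LadderVertex ℓ) (.top j)) := fun h =>
    nonempty_ladder_path_iff.mpr ⟨le_rfl, h⟩
  have tb : ∀ {i j : Fin (ℓ + 1)}, i.val ≤ j.val →
      Nonempty (Quiver.Path (.top i : LadderVertex ℓ) (.bot j)) := fun h =>
    nonempty_ladder_path_iff.mpr ⟨Nat.zero_le _, h⟩
  have bb : ∀ {i j : Fin (ℓ + 1)}, i.val ≤ j.val →
      Nonempty (Quiver.Path (.bot i : LadderVertex ℓ) (.bot j)) := fun h =>
    nonempty_ladder_path_iff.mpr ⟨le_rfl, h⟩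
  by_cases hex : {a : Fin (ℓ + 1) | Nontrivial (V.obj (.top a))}.Nonempty
  · obtain ⟨a, ha, hamin⟩ := wellFounded_lt.has_min _ hex
    obtain ⟨e, he⟩ := @exists_ne _ ha 0
    obtain ⟨b, ⟨hab, hb⟩, hbmax⟩ := wellFounded_gt.has_min
      {b : Fin (ℓ + 1) | a ≤ b ∧ V.tr (.top a) (.top b) e ≠ 0} ⟨a, le_rfl, by rwa [hV.tr_self]⟩
    obtain ⟨ξ, -, hξ⟩ := exists_linearMap_eq_one (K := K) ⊥ (by simpa using hb)
    have hab := Fin.le_def.mp hab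
    have key : ∀ x ∈ block ℓ a (b + 1) a a, ∃ i, x = .top i ∧ a.val ≤ i.val ∧ i.val ≤ b.val := by
      rintro (i | i) hx
      · rw [top_mem_block] at hx
        exact ⟨i, rfl, by omega, by omega⟩
      · rw [bot_mem_block] at hx
        omega
    obtain ⟨W, hW⟩ := hV.exists_isomorphic_thin_prod (P := block ℓ a (b + 1) a a) (a := .top a)
      (b := .top b)
      (fun x hx => by
        obtain ⟨i, rfl, h1, h2⟩ := key x hx
        exact ⟨tt h1, tt h2⟩) e ξ hξ
      (by
        intro x y g hx hy
        obtain ⟨i, rfl, h1, h2⟩ := key x hx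
        obtain @⟨i, j, h⟩ | _ | ⟨i⟩ := g
        · by_contra hne
          rw [top_mem_block] at hy
          exact hbmax j ⟨Fin.le_def.mpr (by omega), hne⟩ (Fin.lt_def.mpr (by omega))
        · rw [← hV.tr_tr (tt h1) (tb le_rfl), hdown, LinearMap.zero_apply])
      (by
        intro x y g hx hy v
        obtain ⟨i, rfl, h1, h2⟩ := key y hy
        obtain @⟨i, j, h⟩ := g
        rw [top_mem_block] at hx
        have : Subsingleton (V.obj (.top i)) :=
          not_nontrivial_iff_subsingleton.mp fun h => hamin i h (Fin.lt_def.mpr (by omega))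
        rw [Subsingleton.elim v 0, map_zero, map_zero])
    refine ⟨_, W, ⟨a, b + 1, a, a, Or.inl ?_, rfl⟩, ⟨.top a, ?_⟩, hW⟩
    · omega
    · rw [top_mem_block]; omega
  · have hsub : ∀ i : Fin (ℓ + 1), Subsingleton (V.obj (.top i)) := fun i => by
      by_contra hi
      exact hex ⟨i, not_subsingleton_iff_nontrivial.mp hi⟩
    have hex' : {a : Fin (ℓ + 1) | Nontrivial (V.obj (.bot a))}.Nonempty := by
      by_contra hcon
      refine h0 fun x => ?_
      rcases x with i | i
      · exact hsub i
      · by_contra hi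
        exact hcon ⟨i, not_subsingleton_iff_nontrivial.mp hi⟩
    obtain ⟨a, ha, hamin⟩ := wellFounded_lt.has_min _ hex'
    obtain ⟨e, he⟩ := @exists_ne _ ha 0
    obtain ⟨b, ⟨hab, hb⟩, hbmax⟩ := wellFounded_gt.has_min
      {b : Fin (ℓ + 1) | a ≤ b ∧ V.tr (.bot a) (.bot b) e ≠ 0} ⟨a, le_rfl, by rwa [hV.tr_self]⟩
    obtain ⟨ξ, -, hξ⟩ := exists_linearMap_eq_one (K := K) ⊥ (by simpa using hb)
    have hab := Fin.le_def.mp hab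
    have key : ∀ x ∈ block ℓ 0 0 a (b + 1), ∃ i, x = .bot i ∧ a.val ≤ i.val ∧ i.val ≤ b.val := by
      rintro (i | i) hx
      · rw [top_mem_block] at hx
        omega
      · rw [bot_mem_block] at hx
        exact ⟨i, rfl, by omega, by omega⟩
    obtain ⟨W, hW⟩ := hV.exists_isomorphic_thin_prod (P := block ℓ 0 0 a (b + 1)) (a := .bot a)
      (b := .bot b)
      (fun x hx => by
        obtain ⟨i, rfl, h1, h2⟩ := key x hx
        exact ⟨bb h1, bb h2⟩) e ξ hξ
      (by
        intro x y g hx hy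
        obtain ⟨i, rfl, h1, h2⟩ := key x hx
        obtain _ | @⟨i, j, h⟩ := g
        by_contra hne
        rw [bot_mem_block] at hy
        exact hbmax j ⟨Fin.le_def.mpr (by omega), hne⟩ (Fin.lt_def.mpr (by omega)))
      (by
        intro x y g hx hy v
        obtain ⟨i, rfl, h1, h2⟩ := key y hy
        obtain _ | @⟨i, j, h⟩ | _ := g
        · rw [bot_mem_block] at hx
          have : Subsingleton (V.obj (.bot i)) :=
            not_nontrivial_iff_subsingleton.mp fun h => hamin i h (Fin.lt_def.mpr (by omega))
          rw [Subsingleton.elim v 0, map_zero, map_zero]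
        · have := hsub i
          rw [Subsingleton.elim v 0, map_zero, map_zero])
    refine ⟨_, W, ⟨0, 0, a, b + 1, Or.inr ?_, rfl⟩, ⟨.bot a, ?_⟩, hW⟩
    · omega
    · rw [bot_mem_block]; omega

/-- Nestfree ladder persistence modules are direct sums of thin representations on blocks. -/
theorem IsNestfree.exists_isomorphic_listSum {V : QuiverRep K (LadderVertex ℓ)}
    (hV : IsNestfree V) :
    ∃ l : List (Set (LadderVertex ℓ)), (∀ P ∈ l, IsBlock P) ∧ V.Isomorphic (listSum K l) := by
  -- The induction needs a class closed under direct summands, so nestfreeness is replaced by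
  -- comparability in both rows.
  refine QuiverRep.exists_isomorphic_listSum (C := fun V : QuiverRep K (LadderVertex ℓ) =>
    V.IsEqualised ∧
    (∀ i j k : Fin (ℓ + 1), i ≤ j → j ≤ k → V.Comparable (.top i) (.top j) (.top k)) ∧
    (∀ i j k : Fin (ℓ + 1), i ≤ j → j ≤ k → V.Comparable (.bot i) (.bot j) (.bot k)))
    (fun V W h hW => ⟨hW.isEqualised h.1, fun i j k hij hjk => hW.comparable (h.2.1 i j k hij hjk),
      fun i j k hij hjk => hW.comparable (h.2.2 i j k hij hjk)⟩)
    (fun V h h0 => ?_) V ⟨hV.equalised, fun i j k hij hjk => ?_, fun i j k hij hjk => ?_⟩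
  · by_cases hd : ∃ i : Fin (ℓ + 1), V.tr (.top i) (.bot i) ≠ 0
    · exact h.1.exists_split_of_down_ne_zero h.2.1 h.2.2 hd
    · push Not at hd
      exact h.1.exists_split_of_down_eq_zero hd h0
  · have := comparable_of_hasNoNestedIntervals (x := ⟨i⟩) (y := ⟨j⟩) (z := ⟨k⟩)
      (hV.equalised.restrict (topRow ℓ)) hV.top hij hjk
    unfold Comparable at this ⊢
    rwa [hV.equalised.tr_restrict _ (nonempty_line_path_iff.mpr hij),
      hV.equalised.tr_restrict _ (nonempty_line_path_iff.mpr hjk)] at this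
  · have := comparable_of_hasNoNestedIntervals (x := ⟨i⟩) (y := ⟨j⟩) (z := ⟨k⟩)
      (hV.equalised.restrict (botRow ℓ)) hV.bot hij hjk
    unfold Comparable at this ⊢
    rwa [hV.equalised.tr_restrict _ (nonempty_line_path_iff.mpr hij),
      hV.equalised.tr_restrict _ (nonempty_line_path_iff.mpr hjk)] at this

end Ladder

/-! ### Harder-Narasimhan filtrations -/

namespace QuiverRep

/-! ### Subrepresentations, semistable quotients and existence of the filtration -/

section Sub

variable {K : Type u} [Field K] {Q : Type} [Quiver.{0} Q] {V W : QuiverRep K Q}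

namespace Sub

instance : Lattice (Sub V) :=
  { (inferInstance : PartialOrder (Sub V)) with
    sup := fun U W => ⟨fun x => U.carrier x ⊔ W.carrier x, fun e =>
      sup_le ((U.stable e).trans (Submodule.comap_mono le_sup_left))
        ((W.stable e).trans (Submodule.comap_mono le_sup_right))⟩
    inf := fun U W => ⟨fun x => U.carrier x ⊓ W.carrier x, fun e =>
      le_inf (inf_le_left.trans (U.stable e)) (inf_le_right.trans (W.stable e))⟩
    le_sup_left := fun _ _ _ => le_sup_left
    le_sup_right := fun _ _ _ => le_sup_right
    sup_le := fun _ _ _ h1 h2 x => sup_le (h1 x) (h2 x)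
    inf_le_left := fun _ _ _ => inf_le_left
    inf_le_right := fun _ _ _ => inf_le_right
    le_inf := fun _ _ _ h1 h2 x => le_inf (h1 x) (h2 x) }

/-- The dimension vector of a subrepresentation. -/
noncomputable def dim (U : Sub V) (x : Q) : ℕ := Module.finrank K (U.carrier x)

theorem dim_mono {U W : Sub V} (h : U ≤ W) (x : Q) : U.dim x ≤ W.dim x :=
  Submodule.finrank_mono (h x)

theorem le_top' (U : Sub V) : U ≤ ⊤ := fun _ => le_top

theorem bot_le' (U : Sub V) : ⊥ ≤ U := fun _ => bot_le

theorem eq_of_le_of_dim_le {U W : Sub V} (h : U ≤ W) (hd : ∀ x, W.dim x ≤ U.dim x) : U = W :=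
  Sub.ext (funext fun x => Submodule.eq_of_le_of_finrank_le (h x) (hd x))

theorem dim_sup_add_dim_inf (U W : Sub V) (x : Q) :
    (U ⊔ W).dim x + (U ⊓ W).dim x = U.dim x + W.dim x :=
  Submodule.finrank_sup_add_finrank_inf_eq (U.carrier x) (W.carrier x)

/-- The subrepresentation `X` of the quotient `W / U`, as a subrepresentation between `U`
and `W`. -/
def lift (U W : Sub V) (X : Sub (U.inside W).quotient) : Sub V where
  carrier x := ((X.carrier x).comap ((U.inside W).carrier x).mkQ).map (W.carrier x).subtype
  stable := by
    rintro x y e _ ⟨v, hv, rfl⟩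
    exact ⟨⟨V.map e v.1, W.stable e v.2⟩, X.stable e hv, rfl⟩

/-- The image in the quotient `W / U` of a subrepresentation `X`. -/
def image (U W X : Sub V) : Sub (U.inside W).quotient where
  carrier x := ((X.carrier x).submoduleOf (W.carrier x)).map ((U.inside W).carrier x).mkQ
  stable := by
    rintro x y e _ ⟨v, hv, rfl⟩
    exact ⟨⟨V.map e v.1, W.stable e v.2⟩, X.stable e hv, rfl⟩

theorem dimVec_quotient {U W : Sub V} (h : U ≤ W) (x : Q) :
    (U.inside W).quotient.dimVec x + U.dim x = W.dim x := by
  have h1 := Submodule.finrank_quotient_add_finrank ((U.carrier x).submoduleOf (W.carrier x))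
  rw [(Submodule.submoduleOfEquivOfLe (h x)).finrank_eq] at h1
  exact h1

theorem finrank_comap_mkQ {M : Type*} [AddCommGroup M] [Module K M] [Module.Finite K M]
    (N : Submodule K M) (X : Submodule K (M ⧸ N)) :
    Module.finrank K (X.comap N.mkQ) = Module.finrank K X + Module.finrank K N := by
  have h := LinearMap.finrank_range_add_finrank_ker (N.mkQ.domRestrict (X.comap N.mkQ))
  rw [LinearMap.range_domRestrict, Submodule.map_comap_eq_of_surjective N.mkQ_surjective] at h
  rw [← h]
  congr 1
  have hle : N ≤ X.comap N.mkQ := fun v hv => by simp [(Submodule.Quotient.mk_eq_zero N).mpr hv]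
  have : LinearMap.ker (N.mkQ.domRestrict (X.comap N.mkQ)) = N.submoduleOf (X.comap N.mkQ) := by
    ext v
    simp [Submodule.submoduleOf]
  rw [this]
  exact (Submodule.submoduleOfEquivOfLe hle).finrank_eq

theorem dim_lift {U W : Sub V} (h : U ≤ W) (X : Sub (U.inside W).quotient) (x : Q) :
    (lift U W X).dim x = X.dim x + U.dim x := by
  have h1 := finrank_comap_mkQ ((U.carrier x).submoduleOf (W.carrier x)) (X.carrier x)
  rw [(Submodule.submoduleOfEquivOfLe (h x)).finrank_eq] at h1
  refine Eq.trans ?_ h1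
  exact LinearEquiv.finrank_eq (Submodule.equivMapOfInjective _ (W.carrier x).injective_subtype _).symm

theorem le_lift {U W : Sub V} (h : U ≤ W) (X : Sub (U.inside W).quotient) :
    U ≤ lift U W X := by
  intro x v hv
  refine ⟨⟨v, h x hv⟩, ?_, rfl⟩
  have : ((U.inside W).carrier x).mkQ ⟨v, h x hv⟩ = 0 :=
    (Submodule.Quotient.mk_eq_zero _).mpr hv
  change ((U.inside W).carrier x).mkQ ⟨v, h x hv⟩ ∈ X.carrier x
  rw [this]
  exact zero_mem _

theorem lift_le {U W : Sub V} (X : Sub (U.inside W).quotient) : lift U W X ≤ W := by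
  rintro x _ ⟨v, -, rfl⟩
  exact v.2

theorem lift_image {U W X : Sub V} (h : U ≤ X) (h' : X ≤ W) : lift U W (image U W X) = X := by
  refine Sub.ext (funext fun x => le_antisymm ?_ fun v hv => ?_)
  · rintro _ ⟨v, ⟨(w : W.carrier x), hw, hwv⟩, rfl⟩
    have h1 : v - w ∈ (U.carrier x).submoduleOf (W.carrier x) :=
      (Submodule.Quotient.eq _).mp hwv.symm
    have h2 : v.1 - w.1 ∈ X.carrier x := h x h1
    have h3 := Submodule.add_mem _ h2 (show w.1 ∈ X.carrier x from hw)
    rw [sub_add_cancel] at h3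
    exact h3
  · exact ⟨⟨v, h' x hv⟩, ⟨⟨v, h' x hv⟩, hv, rfl⟩, rfl⟩

section Weights

variable [Fintype Q]

/-- The dimension of a subrepresentation, weighted by `w`. -/
noncomputable def wdim (w : Q → ℝ) (U : Sub V) : ℝ := ∑ x, w x * (U.dim x : ℝ)

/-- The total dimension of a subrepresentation, as a real number. -/
noncomputable def size (U : Sub V) : ℝ := wdim 1 U

theorem wdim_sup_add_wdim_inf (w : Q → ℝ) (U W : Sub V) :
    (U ⊔ W).wdim w + (U ⊓ W).wdim w = U.wdim w + W.wdim w := by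
  unfold wdim
  simp only [← Finset.sum_add_distrib, ← mul_add, ← Nat.cast_add, dim_sup_add_dim_inf]

theorem wdim_sub_const (α : Q → ℝ) (θ : ℝ) (U : Sub V) :
    U.wdim (fun x => α x - θ) = U.wdim α - θ * U.size := by
  unfold size wdim
  simp only [sub_mul, Finset.sum_sub_distrib, Finset.mul_sum, Pi.one_apply, one_mul]

theorem size_mono {U W : Sub V} (h : U ≤ W) : U.size ≤ W.size := by
  unfold size wdim
  refine Finset.sum_le_sum fun x _ => ?_
  simpa using dim_mono h x

theorem size_strictMono {U W : Sub V} (h : U < W) : U.size < W.size := by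
  by_contra hcon
  refine h.ne (eq_of_le_of_dim_le h.le fun x => ?_)
  by_contra hx
  refine hcon (Finset.sum_lt_sum (fun y _ => ?_) ⟨x, Finset.mem_univ x, ?_⟩)
  · simpa using dim_mono h.le y
  · simpa using hx

/-- There may be infinitely many subrepresentations, but only finitely many dimension vectors, and g
depends on these alone. -/
theorem exists_max {p : Sub V → Prop} (hp : ∃ U, p U) (g : (Q → ℕ) → ℝ) :
    ∃ U, p U ∧ ∀ W, p W → g W.dim ≤ g U.dim := by
  classical
  have hfin : ((fun U : Sub V => U.dim) '' {U | p U}).Finite :=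
    (Set.finite_Iic (fun x => V.dimVec x)).subset (by
      rintro _ ⟨U, -, rfl⟩ x
      exact Submodule.finrank_le _)
  obtain ⟨_, ⟨U, hU, rfl⟩, hmax⟩ := hfin.exists_maximalFor g _
    (by
      obtain ⟨U, hU⟩ := hp
      exact ⟨_, U, hU, rfl⟩)
  refine ⟨U, hU, fun W hW => ?_⟩
  rcases le_total (g W.dim) (g U.dim) with h | h
  · exact h
  · exact hmax ⟨W, hW, rfl⟩ h

/-- The slope of `W / U`. -/
noncomputable def relSlope (α : Q → ℝ) (U W : Sub V) : ℝ :=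
  (W.wdim α - U.wdim α) / (W.size - U.size)

theorem slope_quotient (α : Q → ℝ) {U W : Sub V} (h : U ≤ W) :
    (U.inside W).quotient.slope α = relSlope α U W := by
  unfold slope relSlope size wdim
  have hd : ∀ x, ((U.inside W).quotient.dimVec x : ℝ) = W.dim x - U.dim x := fun x => by
    rw [← dimVec_quotient h x]; push_cast; ring
  simp only [hd, mul_sub, Finset.sum_sub_distrib, Pi.one_apply, one_mul]

/-- Semistability of `W / U`. -/
def RelSemistable (α : Q → ℝ) (U W : Sub V) : Prop :=
  ∀ X, U < X → X ≤ W → relSlope α U X ≤ relSlope α U W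

theorem slope_toRep_quotient (α : Q → ℝ) {U W : Sub V} (h : U ≤ W)
    (X : Sub (U.inside W).quotient) : X.toRep.slope α = relSlope α U (lift U W X) := by
  unfold slope relSlope size wdim
  have hd : ∀ x, (X.toRep.dimVec x : ℝ) = (lift U W X).dim x - U.dim x := fun x => by
    rw [dim_lift h]; push_cast
    change ((Module.finrank K (X.carrier x) : ℕ) : ℝ) = _
    unfold dim
    ring
  simp only [hd, mul_sub, Finset.sum_sub_distrib, Pi.one_apply, one_mul]

theorem isSemistable_quotient_iff {α : Q → ℝ} {U W : Sub V} (h : U ≤ W) :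
    (U.inside W).quotient.IsSemistable α ↔ RelSemistable α U W := by
  constructor
  · intro hs X hUX hXW
    have h1 := hs (image U W X) (by
      intro hbot
      have h2 := lift_image hUX.le hXW
      rw [hbot] at h2
      refine hUX.ne (eq_of_le_of_dim_le hUX.le fun x => ?_)
      rw [← h2, dim_lift h]
      have : (⊥ : Sub (U.inside W).quotient).dim x = 0 := finrank_bot _ _
      rw [this, zero_add])
    rwa [slope_toRep_quotient α h, lift_image hUX.le hXW, slope_quotient α h] at h1
  · intro hs X hX
    rw [slope_toRep_quotient α h, slope_quotient α h]
    refine hs _ (lt_of_le_of_ne (le_lift h X) fun heq => hX ?_) (lift_le X)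
    refine (eq_of_le_of_dim_le (bot_le' X) fun x => ?_).symm
    have h1 := dim_lift h X x
    rw [← heq] at h1
    omega

theorem relSlope_mul {α : Q → ℝ} {U W : Sub V} (h : U < W) :
    relSlope α U W * (W.size - U.size) = W.wdim α - U.wdim α :=
  div_mul_cancel₀ _ (sub_pos.mpr (size_strictMono h)).ne'

/-- Clearing denominators makes semistability usable for X = U as well, where the slope is the
meaningless quotient 0/0. -/
theorem RelSemistable.mul_le {α : Q → ℝ} {U W X : Sub V} (hs : RelSemistable α U W)
    (hUX : U ≤ X) (hXW : X ≤ W) :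
    X.wdim α - U.wdim α ≤ relSlope α U W * (X.size - U.size) := by
  rcases hUX.eq_or_lt with rfl | hlt
  · simp
  · rw [← relSlope_mul hlt]
    exact mul_le_mul_of_nonneg_right (hs X hlt hXW) (sub_nonneg.mpr (size_mono hUX))

/-- Subrepresentations of maximal weighted dimension. -/
def IsMaximizer (w : Q → ℝ) (U : Sub V) : Prop := ∀ W : Sub V, W.wdim w ≤ U.wdim w

/-- Replacing X by X + W changes the weight by that of W / (X ∩ W). This is a quotient of the
semistable W / U, so its slope is at least that of W / U and exceeds θ; unless it is zero, the
weight would grow. The companion `IsMaximizer.le_step` is dual: X is replaced by X ∩ U, and (X + U)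
/ U has slope below θ. -/
theorem IsMaximizer.step_le {α : Q → ℝ} {θ : ℝ} {U W X : Sub V}
    (hX : IsMaximizer (fun x => α x - θ) X) (hUW : U < W) (hs : RelSemistable α U W)
    (hθ : θ < relSlope α U W) (hUX : U ≤ X) : W ≤ X := by
  by_contra hcon
  have hlt : X ⊓ W < W := lt_of_le_of_ne inf_le_right fun h => hcon (inf_eq_right.mp h)
  have h1 := hX (X ⊔ W)
  have h2 := wdim_sup_add_wdim_inf (fun x => α x - θ) X W
  have h3 := hs.mul_le (le_inf hUX hUW.le) hlt.le
  have h4 := relSlope_mul (α := α) hUW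
  have h5 := mul_pos (sub_pos.mpr hθ) (sub_pos.mpr (size_strictMono hlt))
  simp only [wdim_sub_const] at h1 h2
  nlinarith

theorem IsMaximizer.le_step {α : Q → ℝ} {θ : ℝ} {U W X : Sub V}
    (hX : IsMaximizer (fun x => α x - θ) X) (hUW : U < W) (hs : RelSemistable α U W)
    (hθ : relSlope α U W < θ) (hXW : X ≤ W) : X ≤ U := by
  by_contra hcon
  have hlt : U < X ⊔ U := lt_of_le_of_ne le_sup_right fun h => hcon (sup_eq_right.mp h.symm)
  have h1 := hX (X ⊓ U)
  have h2 := wdim_sup_add_wdim_inf (fun x => α x - θ) X U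
  have h3 := hs.mul_le hlt.le (sup_le hXW hUW.le)
  have h5 := mul_pos (sub_pos.mpr hθ) (sub_pos.mpr (size_strictMono hlt))
  simp only [wdim_sub_const] at h1 h2
  nlinarith

theorem exists_isMaximizer (w : Q → ℝ) : ∃ U : Sub V, IsMaximizer w U := by
  obtain ⟨U, -, hU⟩ := exists_max (V := V) (p := fun _ => True) ⟨⊥, trivial⟩
    (fun d => ∑ x, w x * (d x : ℝ))
  exact ⟨U, fun W => hU W trivial⟩

/-- The next step above U is a subrepresentation of largest relative slope and, among those, of
largest size. The first condition gives semistability and the second the strict decrease of slopes.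
The recursion is on the codimension of U. -/
theorem exists_chain (α : Q → ℝ) (U : Sub V) :
    ∃ (n : ℕ) (s : Fin (n + 1) → Sub V), s 0 = U ∧ s (Fin.last n) = ⊤ ∧
      (∀ i : Fin n, s i.castSucc < s i.succ) ∧
      (∀ i : Fin n, RelSemistable α (s i.castSucc) (s i.succ)) ∧
      ∀ i j : Fin n, i.val + 1 = j.val →
        relSlope α (s j.castSucc) (s j.succ) < relSlope α (s i.castSucc) (s i.succ) := by
  induction hN : (∑ x, V.dimVec x) - ∑ x, U.dim x using Nat.strong_induction_on generalizing U with
  | _ N ih =>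
    by_cases hU : U = ⊤
    · exact ⟨0, fun _ => U, rfl, hU, fun i => i.elim0, fun i => i.elim0, fun i => i.elim0⟩
    · have hUtop : U < ⊤ := lt_of_le_of_ne (le_top' U) hU
      obtain ⟨Y, hUY, hY⟩ := exists_max (p := fun X => U < X) ⟨⊤, hUtop⟩
        (fun d => ((∑ x, α x * (d x : ℝ)) - U.wdim α) /
          ((∑ x, (1 : Q → ℝ) x * (d x : ℝ)) - U.size))
      have hY : ∀ X, U < X → relSlope α U X ≤ relSlope α U Y := hY
      obtain ⟨X, ⟨hUX, hXY⟩, hX⟩ := exists_max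
        (p := fun X => U < X ∧ relSlope α U X = relSlope α U Y) ⟨Y, hUY, rfl⟩
        (fun d => ∑ x, (1 : Q → ℝ) x * (d x : ℝ))
      have hX : ∀ Z, U < Z → relSlope α U Z = relSlope α U Y → Z.size ≤ X.size :=
        fun Z h h' => hX Z ⟨h, h'⟩
      have hlt : (∑ x, V.dimVec x) - ∑ x, X.dim x < N := by
        have h1 := size_strictMono hUX
        have h2 : ∑ x, X.dim x ≤ ∑ x, V.dimVec x :=
          Finset.sum_le_sum fun x _ => Submodule.finrank_le _
        simp only [size, wdim, Pi.one_apply, one_mul] at h1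
        have h3 : ∑ x, U.dim x < ∑ x, X.dim x := by exact_mod_cast h1
        omega
      obtain ⟨n, s, hs0, hsl, hmono, hsemi, hanti⟩ := ih _ hlt X rfl
      refine ⟨n + 1, Fin.cons U s, rfl, ?_, fun i => ?_, fun i => ?_, fun i j hij => ?_⟩
      · rw [← Fin.succ_last, Fin.cons_succ, hsl]
      · cases i using Fin.cases with
        | zero => simpa [hs0] using hUX
        | succ i => simpa [← Fin.succ_castSucc] using hmono i
      · cases i using Fin.cases with
        | zero =>
          simp only [Fin.castSucc_zero, Fin.cons_zero, Fin.cons_succ, hs0]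
          intro Z hZ _
          rw [hXY]
          exact hY Z hZ
        | succ i => simpa [← Fin.succ_castSucc] using hsemi i
      · cases j using Fin.cases with
        | zero => simp at hij
        | succ j =>
          cases i using Fin.cases with
          | zero =>
            have hj : j.castSucc = 0 := Fin.ext (by simp at hij ⊢; omega)
            simp only [Fin.castSucc_zero, Fin.cons_zero, Fin.cons_succ, hs0,
              ← Fin.succ_castSucc, hj]
            have hXZ : X < s j.succ := by
              have := hmono j
              rwa [hj, hs0] at this
            by_contra hcon
            have hUZ := hUX.trans hXZ
            have h1 := relSlope_mul (α := α) hUX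
            have h2 := relSlope_mul (α := α) hXZ
            have h3 := relSlope_mul (α := α) hUZ
            have h4 := size_strictMono hXZ
            have h5 := size_strictMono hUZ
            -- If the next slope were not smaller, then the slope of Z / U, a weighted mean of those
            -- of X / U and Z / X, would also be at least the maximal one, and Z would beat X in
            -- size.
            have h6 : relSlope α U X * ((s j.succ).size - U.size) ≤
                relSlope α U (s j.succ) * ((s j.succ).size - U.size) := by
              have := mul_le_mul_of_nonneg_right (not_lt.mp hcon) (sub_pos.mpr h4).le
              nlinarith
            have h7 := le_of_mul_le_mul_right h6 (sub_pos.mpr h5)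
            have h8 := hX _ hUZ (le_antisymm (hY _ hUZ) (hXY ▸ h7))
            linarith
          | succ i =>
            simpa [← Fin.succ_castSucc] using hanti i j (by simpa using hij)

end Weights

end Sub

end Sub

/-! ### Subrepresentations of direct sums -/

section Prod

variable {K : Type u} [Field K] {Q : Type} [Quiver.{0} Q]

/-- The direct sum of two subrepresentations. -/
def Sub.prod {V W : QuiverRep K Q} (A : Sub V) (B : Sub W) : Sub (V.prod W) where
  carrier x := (A.carrier x).prod (B.carrier x)
  stable e _ hv := ⟨A.stable e hv.1, B.stable e hv.2⟩

/-- The projection of a subrepresentation of a direct sum to the first summand. -/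
def Sub.mapFst {V W : QuiverRep K Q} (U : Sub (V.prod W)) : Sub V where
  carrier x := (U.carrier x).map (LinearMap.fst K (V.obj x) (W.obj x))
  stable := by
    rintro x y e _ ⟨v, hv, rfl⟩
    exact ⟨(V.prod W).map e v, U.stable e hv, rfl⟩

/-- The projection of a subrepresentation of a direct sum to the second summand. -/
def Sub.mapSnd {V W : QuiverRep K Q} (U : Sub (V.prod W)) : Sub W where
  carrier x := (U.carrier x).map (LinearMap.snd K (V.obj x) (W.obj x))
  stable := by
    rintro x y e _ ⟨v, hv, rfl⟩
    exact ⟨(V.prod W).map e v, U.stable e hv, rfl⟩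

/-- The intersection of a subrepresentation of a direct sum with the first summand. -/
def Sub.comapInl {V W : QuiverRep K Q} (U : Sub (V.prod W)) : Sub V where
  carrier x := (U.carrier x).comap (LinearMap.inl K (V.obj x) (W.obj x))
  stable := fun {x y} e v hv => by
    have h1 : (V.prod W).map e (v, (0 : W.obj x)) ∈ U.carrier y := U.stable e hv
    have h2 : (V.prod W).map e (v, (0 : W.obj x)) = (V.map e v, (0 : W.obj y)) :=
      Prod.ext rfl (map_zero (W.map e))
    rw [h2] at h1
    exact h1

/-- The intersection of a subrepresentation of a direct sum with the second summand. -/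
def Sub.comapInr {V W : QuiverRep K Q} (U : Sub (V.prod W)) : Sub W where
  carrier x := (U.carrier x).comap (LinearMap.inr K (V.obj x) (W.obj x))
  stable := fun {x y} e v hv => by
    have h1 : (V.prod W).map e ((0 : V.obj x), v) ∈ U.carrier y := U.stable e hv
    have h2 : (V.prod W).map e ((0 : V.obj x), v) = ((0 : V.obj y), W.map e v) :=
      Prod.ext (map_zero (V.map e)) rfl
    rw [h2] at h1
    exact h1

theorem Sub.dim_prod {V W : QuiverRep K Q} (A : Sub V) (B : Sub W) (x : Q) :
    (A.prod B).dim x = A.dim x + B.dim x := by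
  have h : Module.finrank K (A.carrier x × B.carrier x) = A.dim x + B.dim x :=
    Module.finrank_prod
  rw [← h]
  exact LinearEquiv.finrank_eq
    { toFun := fun v : (A.carrier x).prod (B.carrier x) =>
        ((⟨v.1.1, v.2.1⟩, ⟨v.1.2, v.2.2⟩) : A.carrier x × B.carrier x)
      invFun := fun v => ⟨(v.1.1, v.2.1), v.1.2, v.2.2⟩
      left_inv := fun _ => rfl
      right_inv := fun _ => rfl
      map_add' := fun _ _ => rfl
      map_smul' := fun _ _ => rfl }

end Prod

/-! ### Harder-Narasimhan types read through weight maximizers -/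

section Part

variable {K : Type u} [Field K] {Q : Type} [Quiver.{0} Q] [Fintype Q]

theorem nonempty_hnFiltration (α : Q → ℝ) (V : QuiverRep K Q) : Nonempty (HNFiltration α V) := by
  obtain ⟨n, s, h0, hl, hmono, hsemi, hanti⟩ := Sub.exists_chain α (⊥ : Sub V)
  refine ⟨⟨n, s, h0, hl, Fin.strictMono_iff_lt_succ.mpr hmono, fun i => ?_, ?_⟩⟩
  · exact (Sub.isSemistable_quotient_iff (hmono i).le).mpr (hsemi i)
  · simp only [fun i : Fin n => Sub.slope_quotient α (hmono i).le]
    cases n with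
    | zero => exact fun i => i.elim0
    | succ n =>
      exact Fin.strictAnti_iff_succ_lt.mpr fun i => hanti i.castSucc i.succ (by simp)

/-- The subrepresentations of `V` of maximal weighted dimension have a smallest and a largest
element, and `d` is the difference of the dimension vectors of these. -/
def HasPart (w : Q → ℝ) (V : QuiverRep K Q) (d : Q → ℕ) : Prop :=
  ∃ A B : Sub V, A.IsMaximizer w ∧ B.IsMaximizer w ∧
    (∀ X : Sub V, X.IsMaximizer w → A ≤ X ∧ X ≤ B) ∧ ∀ x, B.dim x = d x + A.dim x

theorem HasPart.unique {w : Q → ℝ} {V : QuiverRep K Q} {d d' : Q → ℕ} (h : V.HasPart w d)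
    (h' : V.HasPart w d') : d = d' := by
  obtain ⟨A, B, hA, hB, hAB, hd⟩ := h
  obtain ⟨A', B', hA', hB', hAB', hd'⟩ := h'
  obtain rfl : A = A' := le_antisymm (hAB _ hA').1 (hAB' _ hA).1
  obtain rfl : B = B' := le_antisymm (hAB' _ hB).2 (hAB _ hB').2
  funext x
  have h1 := hd x
  have h2 := hd' x
  omega

open Classical in
/-- The entry of slope `θ` of a Harder-Narasimhan type, or `0` if there is none. -/
noncomputable def partOfSlope (α : Q → ℝ) (θ : ℝ) (L : List (Q → ℕ)) : Q → ℕ :=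
  (L.map fun d => if (∑ x, α x * (d x : ℝ)) / ∑ x, (d x : ℝ) = θ then d else 0).sum

/-- Every maximizer of α - θ contains all steps of slope greater than θ and stays inside the last
step before the slopes drop below θ. If θ is a slope, the two bounds are the ends of the layer of
slope θ and both are maximizers; if not, they coincide. -/
theorem HNFiltration.hasPart {α : Q → ℝ} {V : QuiverRep K Q} (F : HNFiltration α V) (θ : ℝ) :
    V.HasPart (fun x => α x - θ) (partOfSlope α θ F.type) := by
  classical
  set n := F.length
  set s : Fin (n + 1) → Sub V := F.step
  have h0 : s 0 = ⊥ := F.step_zero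
  have hl : s (Fin.last n) = ⊤ := F.step_last
  have hlt : ∀ i : Fin n, s i.castSucc < s i.succ := fun i => F.strictMono Fin.castSucc_lt_succ
  have hsemi : ∀ i : Fin n, Sub.RelSemistable α (s i.castSucc) (s i.succ) := fun i =>
    (Sub.isSemistable_quotient_iff (hlt i).le).mp (F.semistable i)
  have hslope := fun i : Fin n => Sub.slope_quotient α (hlt i).le
  set μ : Fin n → ℝ := fun i => Sub.relSlope α (s i.castSucc) (s i.succ) with hμ
  have hanti : StrictAnti μ := fun i j hij =>
    lt_of_eq_of_lt (hslope j).symm (lt_of_lt_of_eq (F.slope_strictAnti hij) (hslope i))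
  have hpart : partOfSlope α θ F.type =
      ∑ i : Fin n, if μ i = θ then (((s i.castSucc).inside (s i.succ)).quotient.dimVec) else 0 := by
    unfold partOfSlope HNFiltration.type
    rw [List.map_ofFn, List.sum_ofFn]
    refine Finset.sum_congr rfl fun i _ => ?_
    have h1 := hslope i
    unfold slope at h1
    exact if_congr (by rw [h1]) rfl rfl
  rw [hpart]
  have hup : ∀ X : Sub V, X.IsMaximizer (fun x => α x - θ) → ∀ j : Fin (n + 1),
      (∀ i : Fin n, i.castSucc < j → θ < μ i) → s j ≤ X := by
    intro X hX j
    induction j using Fin.induction with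
    | zero => intro _; rw [h0]; exact Sub.bot_le' X
    | succ j ih =>
      intro hj
      exact hX.step_le (hlt j) (hsemi j) (hj j Fin.castSucc_lt_succ)
        (ih fun i hi => hj i (hi.trans Fin.castSucc_lt_succ))
  have hdown : ∀ X : Sub V, X.IsMaximizer (fun x => α x - θ) → ∀ j : Fin (n + 1),
      (∀ i : Fin n, j ≤ i.castSucc → μ i < θ) → X ≤ s j := by
    intro X hX j
    induction j using Fin.reverseInduction with
    | last => intro _; rw [hl]; exact Sub.le_top' X
    | cast j ih =>
      intro hj
      exact hX.le_step (hlt j) (hsemi j) (hj j le_rfl)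
        (ih fun i hi => hj i (Fin.castSucc_lt_succ.le.trans hi))
  obtain ⟨X, hX⟩ := Sub.exists_isMaximizer (V := V) (fun x => α x - θ)
  by_cases hex : ∃ i, μ i = θ
  · obtain ⟨i, hi⟩ := hex
    have hU : ∀ j : Fin n, j.castSucc < i.castSucc → θ < μ j := fun j hj =>
      hi ▸ hanti (Fin.castSucc_lt_castSucc_iff.mp hj)
    have hD : ∀ j : Fin n, i.succ ≤ j.castSucc → μ j < θ := fun j hj =>
      hi ▸ hanti (Fin.succ_le_castSucc_iff.mp hj)
    have hXA := hup X hX _ hU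
    have hXB := hdown X hX _ hD
    -- Semistability of the layer of slope θ says that X / A has nonpositive weight for α - θ, so A
    -- has maximal weight too; the whole layer has weight 0, so B does as well.
    have h1 := (hsemi i).mul_le hXA hXB
    have h2 := Sub.relSlope_mul (α := α) (hlt i)
    have hi' : Sub.relSlope α (s i.castSucc) (s i.succ) = θ := hi
    rw [hi'] at h1 h2
    have hA : (s i.castSucc).IsMaximizer (fun x => α x - θ) := fun Y => by
      have h3 := hX Y
      simp only [Sub.wdim_sub_const] at h3 ⊢
      linarith
    have hB : (s i.succ).IsMaximizer (fun x => α x - θ) := fun Y => by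
      have h3 := hA Y
      simp only [Sub.wdim_sub_const] at h3 ⊢
      linarith
    refine ⟨_, _, hA, hB, fun Y hY => ⟨hup Y hY _ hU, hdown Y hY _ hD⟩, fun x => ?_⟩
    rw [Finset.sum_eq_single i (fun j _ hj => if_neg fun h => hj (hanti.injective (h.trans hi.symm)))
      (fun h => absurd (Finset.mem_univ i) h), if_pos hi]
    exact (Sub.dimVec_quotient (hlt i).le x).symm
  · push Not at hex
    obtain ⟨j, hU, hD⟩ : ∃ j : Fin (n + 1), (∀ i : Fin n, i.castSucc < j → θ < μ i) ∧
        ∀ i : Fin n, j ≤ i.castSucc → μ i < θ := by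
      -- The cut is the first index from which all slopes are below θ.
      have hn : ∃ j : ℕ, ∀ i : Fin n, j ≤ i.val → μ i < θ := ⟨n, fun i hi => by omega⟩
      have hle : Nat.find hn ≤ n := Nat.find_min' hn fun i hi => by omega
      refine ⟨⟨Nat.find hn, by omega⟩, fun i hi => ?_, fun i hi => Nat.find_spec hn i hi⟩
      have h1 := Nat.find_min hn (m := i.val) hi
      push Not at h1
      obtain ⟨k, hik, hk⟩ := h1
      exact lt_of_le_of_ne (hk.trans (hanti.antitone (Fin.le_def.mpr hik))) (hex i).symm
    have hXj : ∀ Y : Sub V, Y.IsMaximizer (fun x => α x - θ) → Y = s j := fun Y hY =>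
      le_antisymm (hdown Y hY j hD) (hup Y hY j hU)
    have hj := hXj X hX ▸ hX
    refine ⟨s j, s j, hj, hj, fun Y hY => ⟨(hXj Y hY).ge, (hXj Y hY).le⟩, fun x => ?_⟩
    rw [Finset.sum_eq_zero fun i _ => if_neg (hex i)]
    simp

theorem hasPart_hnType (α : Q → ℝ) (θ : ℝ) (V : QuiverRep K Q) :
    V.HasPart (fun x => α x - θ) (partOfSlope α θ (V.hnType α)) := by
  unfold hnType
  rw [dif_pos (nonempty_hnFiltration α V)]
  exact HNFiltration.hasPart _ θ

/-- The image of a subrepresentation under an isomorphism. -/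
def Sub.mapEquiv {V W : QuiverRep K Q} (φ : ∀ x, V.obj x ≃ₗ[K] W.obj x)
    (hφ : ∀ (x y : Q) (e : x ⟶ y) (v : V.obj x), φ y (V.map e v) = W.map e (φ x v))
    (U : Sub V) : Sub W where
  carrier x := (U.carrier x).map (φ x).toLinearMap
  stable := by
    rintro x y e _ ⟨v, hv, rfl⟩
    exact ⟨V.map e v, U.stable e hv, hφ x y e v⟩

theorem Isomorphic.hasPart {V W : QuiverRep K Q} (h : V.Isomorphic W) {w : Q → ℝ} {d : Q → ℕ}
    (hV : V.HasPart w d) : W.HasPart w d := by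
  obtain ⟨φ, hφ⟩ := h
  have hψ : ∀ (x y : Q) (e : x ⟶ y) (v : W.obj x),
      (φ y).symm (W.map e v) = V.map e ((φ x).symm v) := fun x y e v => by
    rw [LinearEquiv.symm_apply_eq, hφ, LinearEquiv.apply_symm_apply]
  have hdim : ∀ (U : Sub V) x, (U.mapEquiv φ hφ).dim x = U.dim x := fun U x =>
    LinearEquiv.finrank_map_eq _ _
  have hdim' : ∀ (U : Sub W) x, (U.mapEquiv _ hψ).dim x = U.dim x := fun U x =>
    LinearEquiv.finrank_map_eq _ _
  have hw : ∀ U : Sub V, (U.mapEquiv φ hφ).wdim w = U.wdim w := fun U => by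
    unfold Sub.wdim
    simp only [hdim]
  have hw' : ∀ U : Sub W, (U.mapEquiv _ hψ).wdim w = U.wdim w := fun U => by
    unfold Sub.wdim
    simp only [hdim']
  obtain ⟨A, B, hA, hB, hAB, hd⟩ := hV
  refine ⟨A.mapEquiv φ hφ, B.mapEquiv φ hφ, fun X => ?_, fun X => ?_, fun X hX => ?_, fun x => ?_⟩
  · rw [hw, ← hw' X]; exact hA _
  · rw [hw, ← hw' X]; exact hB _
  · have h1 := hAB (X.mapEquiv _ hψ) fun Y => by rw [hw', ← hw Y]; exact hX _
    constructor
    · rintro x _ ⟨v, hv, rfl⟩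
      obtain ⟨u, hu, huv⟩ := h1.1 x hv
      rw [← huv]
      simpa using hu
    · intro x v hv
      exact ⟨(φ x).symm v, h1.2 x ⟨v, hv, rfl⟩, by simp⟩
  · rw [hdim, hdim, hd]

theorem IsZero.hasPart {V : QuiverRep K Q} (hV : V.IsZero) (w : Q → ℝ) : V.HasPart w 0 := by
  have h : ∀ U : Sub V, U = ⊥ := fun U => Sub.ext (funext fun x => by
    have := hV x
    exact Subsingleton.elim _ _)
  have hmax : (⊥ : Sub V).IsMaximizer w := fun X => by rw [h X]
  exact ⟨⊥, ⊥, hmax, hmax, fun X _ => by rw [h X]; exact ⟨le_rfl, le_rfl⟩, fun x => by simp⟩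

theorem Sub.wdim_prod (w : Q → ℝ) {V W : QuiverRep K Q} (A : Sub V) (B : Sub W) :
    (A.prod B).wdim w = A.wdim w + B.wdim w := by
  unfold Sub.wdim
  simp only [Sub.dim_prod, Nat.cast_add, mul_add, Finset.sum_add_distrib]

/-- Modularity with V ⊕ 0: the sum is V ⊕ pr₂(U) and the intersection is (U ∩ V) ⊕ 0. -/
theorem Sub.wdim_eq_mapSnd (w : Q → ℝ) {V W : QuiverRep K Q} (U : Sub (V.prod W)) :
    U.wdim w = U.comapInl.wdim w + U.mapSnd.wdim w := by
  have h := Sub.wdim_sup_add_wdim_inf w U ((⊤ : Sub V).prod (⊥ : Sub W))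
  have h1 : U ⊔ (⊤ : Sub V).prod (⊥ : Sub W) = (⊤ : Sub V).prod U.mapSnd := by
    refine le_antisymm (sup_le ?_ ?_) ?_
    · exact fun x v hv => ⟨trivial, v, hv, rfl⟩
    · exact fun x v hv => ⟨trivial, hv.2 ▸ zero_mem _⟩
    · rintro x ⟨v, w⟩ ⟨-, ⟨v', w'⟩, hu, rfl⟩
      refine Submodule.mem_sup.mpr ⟨(v', w'), hu, (v - v', 0), ⟨trivial, rfl⟩, ?_⟩
      exact Prod.ext (add_sub_cancel _ _) (add_zero _)
  have h2 : U ⊓ (⊤ : Sub V).prod (⊥ : Sub W) = U.comapInl.prod (⊥ : Sub W) := by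
    refine le_antisymm ?_ (le_inf ?_ ?_)
    · rintro x ⟨v, w⟩ ⟨hu, -, hw⟩
      obtain rfl : w = 0 := hw
      exact ⟨hu, rfl⟩
    · rintro x ⟨v, w⟩ ⟨hu, hw⟩
      obtain rfl : w = 0 := hw
      exact hu
    · exact fun x v hv => ⟨trivial, hv.2⟩
  rw [h1, h2, Sub.wdim_prod, Sub.wdim_prod, Sub.wdim_prod] at h
  linarith

theorem Sub.wdim_eq_mapFst (w : Q → ℝ) {V W : QuiverRep K Q} (U : Sub (V.prod W)) :
    U.wdim w = U.mapFst.wdim w + U.comapInr.wdim w := by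
  have h := Sub.wdim_sup_add_wdim_inf w U ((⊥ : Sub V).prod (⊤ : Sub W))
  have h1 : U ⊔ (⊥ : Sub V).prod (⊤ : Sub W) = U.mapFst.prod (⊤ : Sub W) := by
    refine le_antisymm (sup_le ?_ ?_) ?_
    · exact fun x v hv => ⟨⟨v, hv, rfl⟩, trivial⟩
    · exact fun x v hv => ⟨hv.1 ▸ zero_mem _, trivial⟩
    · rintro x ⟨v, w⟩ ⟨⟨⟨v', w'⟩, hu, rfl⟩, -⟩
      refine Submodule.mem_sup.mpr ⟨(v', w'), hu, (0, w - w'), ⟨rfl, trivial⟩, ?_⟩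
      exact Prod.ext (add_zero _) (add_sub_cancel _ _)
  have h2 : U ⊓ (⊥ : Sub V).prod (⊤ : Sub W) = (⊥ : Sub V).prod U.comapInr := by
    refine le_antisymm ?_ (le_inf ?_ ?_)
    · rintro x ⟨v, w⟩ ⟨hu, hv, -⟩
      obtain rfl : v = 0 := hv
      exact ⟨rfl, hu⟩
    · rintro x ⟨v, w⟩ ⟨hv, hu⟩
      obtain rfl : v = 0 := hv
      exact hu
    · exact fun x v hv => ⟨hv.1, trivial⟩
  rw [h1, h2, Sub.wdim_prod, Sub.wdim_prod, Sub.wdim_prod] at h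
  linarith

/-- A maximizer X of the sum need not be a direct sum itself. The two weight formulas show that its
projections and its intersections with the summands are all maximizers; X lies between the sum of
the intersections and the sum of the projections, hence between A ⊕ A' and B ⊕ B'. -/
theorem HasPart.prod {w : Q → ℝ} {V W : QuiverRep K Q} {d d' : Q → ℕ} (h : V.HasPart w d)
    (h' : W.HasPart w d') : (V.prod W).HasPart w (d + d') := by
  obtain ⟨A, B, hA, hB, hAB, hd⟩ := h
  obtain ⟨A', B', hA', hB', hAB', hd'⟩ := h'
  refine ⟨A.prod A', B.prod B', fun X => ?_, fun X => ?_, fun X hX => ?_, fun x => ?_⟩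
  · rw [X.wdim_eq_mapSnd, Sub.wdim_prod]
    exact add_le_add (hA _) (hA' _)
  · rw [X.wdim_eq_mapSnd, Sub.wdim_prod]
    exact add_le_add (hB _) (hB' _)
  · have h1 := hX (A.prod A')
    rw [Sub.wdim_prod] at h1
    have h2 := X.wdim_eq_mapSnd w
    have h3 := X.wdim_eq_mapFst w
    have m1 : X.comapInl.IsMaximizer w := fun Y =>
      (hA Y).trans (by have := hA' X.mapSnd; linarith)
    have m2 : X.mapSnd.IsMaximizer w := fun Y =>
      (hA' Y).trans (by have := hA X.comapInl; linarith)
    have m3 : X.mapFst.IsMaximizer w := fun Y =>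
      (hA Y).trans (by have := hA' X.comapInr; linarith)
    have m4 : X.comapInr.IsMaximizer w := fun Y =>
      (hA' Y).trans (by have := hA X.mapFst; linarith)
    constructor
    · rintro x ⟨v, w⟩ ⟨hv, hw⟩
      have h4 : (v, (0 : W.obj x)) ∈ X.carrier x := (hAB _ m1).1 x hv
      have h5 : ((0 : V.obj x), w) ∈ X.carrier x := (hAB' _ m4).1 x hw
      have h6 := Submodule.add_mem _ h4 h5
      have h7 : (v, (0 : W.obj x)) + ((0 : V.obj x), w) = (v, w) :=
        Prod.ext (add_zero _) (zero_add _)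
      exact h7 ▸ h6
    · intro x v hv
      exact ⟨(hAB _ m3).2 x ⟨v, hv, rfl⟩, (hAB' _ m2).2 x ⟨v, hv, rfl⟩⟩
  · rw [Sub.dim_prod, Sub.dim_prod, hd, hd', Pi.add_apply]
    ring

theorem hasPart_listSum {w : Q → ℝ} {D : Set Q → Q → ℕ} {l : List (Set Q)}
    (h : ∀ P ∈ l, (thin K P).HasPart w (D P)) : (listSum K l).HasPart w (l.map D).sum := by
  induction l with
  | nil => exact isZero_zero.hasPart w
  | cons P l ih =>
    rw [List.map_cons, List.sum_cons]
    exact (h P List.mem_cons_self).prod (ih fun R hR => h R (List.mem_cons_of_mem _ hR))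

end Part

end QuiverRep

/-! ### Subrepresentations of thin representations -/

section Sets

variable {Q : Type} [Quiver.{0} Q]

/-- `U` is a subset of `P` which is closed under paths within `P`. -/
def IsUpIn (P U : Set Q) : Prop :=
  U ⊆ P ∧ ∀ x ∈ U, ∀ y ∈ P, Nonempty (Quiver.Path x y) → y ∈ U

/-- All paths between members of `P` stay in `P`. -/
def PathConvex (P : Set Q) : Prop :=
  ∀ x ∈ P, ∀ z ∈ P, ∀ y, Nonempty (Quiver.Path x y) → Nonempty (Quiver.Path y z) → y ∈ P

/-- The members of `P` which can be reached from `S`. -/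
def gen (P S : Set Q) : Set Q := {y ∈ P | ∃ x ∈ S, Nonempty (Quiver.Path x y)}

/-- The minimal members of `R`. -/
def minSet (R : Set Q) : Set Q := {x ∈ R | ∀ y ∈ R, Nonempty (Quiver.Path y x) → y = x}

theorem isUpIn_empty (P : Set Q) : IsUpIn P ∅ := ⟨Set.empty_subset _, fun _ h => h.elim⟩

theorem isUpIn_gen (P S : Set Q) : IsUpIn P (gen P S) := by
  refine ⟨fun _ h => h.1, ?_⟩
  rintro x ⟨-, s, hs, ⟨p⟩⟩ y hy ⟨q⟩
  exact ⟨hy, s, hs, ⟨p.comp q⟩⟩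

theorem mem_gen_of_mem {P S : Set Q} {x : Q} (hP : x ∈ P) (hS : x ∈ S) : x ∈ gen P S :=
  ⟨hP, x, hS, ⟨.nil⟩⟩

theorem IsUpIn.gen_subset {P U S : Set Q} (h : IsUpIn P U) (hS : S ⊆ U) : gen P S ⊆ U := by
  rintro y ⟨hy, x, hx, hxy⟩
  exact h.2 x (hS hx) y hy hxy

end Sets

/-! ### Weights of vertex sets -/

section Weights

variable {Q : Type} [Fintype Q]

/-- The sum of the weights of the members of `U`. -/
noncomputable def wsum (w : Q → ℝ) (U : Set Q) : ℝ := ∑ x, U.indicator w x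

theorem wsum_sub_const (α : Q → ℝ) (θ : ℝ) (U : Set Q) :
    wsum (fun x => α x - θ) U = wsum α U - θ * U.ncard := by
  classical
  unfold wsum
  have h : (U.ncard : ℝ) = ∑ x, U.indicator (1 : Q → ℝ) x := by
    rw [Finset.sum_indicator_eq_sum_filter]
    simp only [Pi.one_apply, Finset.sum_const, nsmul_eq_mul, mul_one, Nat.cast_inj]
    rw [← Set.ncard_coe_finset]
    simp
  rw [h, Finset.mul_sum, ← Finset.sum_sub_distrib]
  refine Finset.sum_congr rfl fun x _ => ?_
  by_cases hx : x ∈ U <;> simp [hx]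

theorem wsum_single [DecidableEq Q] (s : Q) (r : ℝ) (U : Set Q) :
    wsum (r • Pi.single s (1 : ℝ)) U = U.indicator (fun _ => r) s := by
  unfold wsum
  rw [Finset.sum_eq_single s]
  · by_cases hs : s ∈ U <;> simp [hs]
  · intro x _ hx
    by_cases hs : x ∈ U <;> simp [hs, hx]
  · simp

theorem wsum_add (v w : Q → ℝ) (U : Set Q) : wsum (v + w) U = wsum v U + wsum w U := by
  unfold wsum
  rw [← Finset.sum_add_distrib]
  refine Finset.sum_congr rfl fun x _ => ?_
  by_cases hx : x ∈ U <;> simp [hx]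

theorem wsum_pair [DecidableEq Q] (s s' : Q) (t θ : ℝ) (U : Set Q) :
    wsum (fun x => (Pi.single s 1 + t • Pi.single s' 1 : Q → ℝ) x - θ) U =
      U.indicator (fun _ => 1) s + U.indicator (fun _ => t) s' - θ * U.ncard := by
  rw [wsum_sub_const, wsum_add, wsum_single, ← wsum_single s, one_smul]

end Weights

namespace QuiverRep

/-! ### Subrepresentations of thin representations as closed vertex sets -/

section Thin

variable {K : Type u} [Field K] {Q : Type} [Quiver.{0} Q]

theorem Sub.mapPath_mem {V : QuiverRep K Q} (U : Sub V) {x y : Q} (p : Quiver.Path x y)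
    {v : V.obj x} (hv : v ∈ U.carrier x) : V.mapPath p v ∈ U.carrier y := by
  induction p with
  | nil => exact hv
  | cons p e ih => exact U.stable e ih

theorem thin_mapPath {P : Set Q} (hP : PathConvex P) {x y : Q} (p : Quiver.Path x y)
    (hx : x ∈ P) (hy : y ∈ P) (v : (thin K P).obj x) : ((thin K P).mapPath p v).1 = v.1 := by
  induction p with
  | nil => rfl
  | @cons y z p e ih =>
    have h := ih (hP x hx z hy y ⟨p⟩ ⟨e.toPath⟩)
    exact (thin_map_of_mem e hy _).trans h

theorem thin_isEqualised {P : Set Q} (hP : PathConvex P) : (thin K P).IsEqualised := by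
  intro x y p q
  ext v
  refine Subtype.ext ?_
  by_cases hy : y ∈ P
  · by_cases hx : x ∈ P
    · rw [thin_mapPath hP p hx hy, thin_mapPath hP q hx hy]
    · rw [thin_obj_eq_zero hx v, map_zero, map_zero]
  · rw [thin_obj_eq_zero hy ((thin K P).mapPath p v), thin_obj_eq_zero hy ((thin K P).mapPath q v)]

/-- The vertices at which a subrepresentation is nonzero. -/
def Sub.supp {V : QuiverRep K Q} (U : Sub V) : Set Q := {x | U.carrier x ≠ ⊥}

theorem Sub.mem_of_mem_supp {P : Set Q} {U : Sub (thin K P)} {x : Q} (hx : x ∈ U.supp) :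
    x ∈ P := by
  by_contra h
  refine hx ((Submodule.eq_bot_iff _).mpr fun v _ => thin_obj_eq_zero h v)

theorem Sub.isUpIn_supp {P : Set Q} (hP : PathConvex P) (U : Sub (thin K P)) :
    IsUpIn P U.supp := by
  refine ⟨fun x hx => Sub.mem_of_mem_supp hx, ?_⟩
  rintro x hx y hy ⟨p⟩ hbot
  obtain ⟨v, hv, hv0⟩ := (Submodule.ne_bot_iff _).mp hx
  have h1 := U.mapPath_mem p hv
  rw [hbot, Submodule.mem_bot] at h1
  refine hv0 (Subtype.ext ?_)
  rw [← thin_mapPath hP p (Sub.mem_of_mem_supp hx) hy v, h1]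
  rfl

theorem Sub.carrier_eq_top {P : Set Q} {U : Sub (thin K P)} {x : Q} (hx : x ∈ U.supp) :
    U.carrier x = ⊤ := by
  classical
  refine Submodule.eq_top_of_finrank_eq (le_antisymm (Submodule.finrank_le _) ?_)
  have h1 : Module.finrank K ((thin K P).obj x) = 1 := by
    have := dimVec_thin (K := K) P x
    rwa [if_pos (Sub.mem_of_mem_supp hx)] at this
  rw [h1, Nat.one_le_iff_ne_zero]
  exact fun h => hx (Submodule.finrank_eq_zero.mp h)

theorem Sub.dim_thin {P : Set Q} (U : Sub (thin K P)) (x : Q) :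
    U.dim x = U.supp.indicator 1 x := by
  classical
  by_cases hx : x ∈ U.supp
  · rw [Set.indicator_of_mem hx]
    unfold Sub.dim
    rw [Sub.carrier_eq_top hx, finrank_top]
    have := dimVec_thin (K := K) P x
    rwa [if_pos (Sub.mem_of_mem_supp hx)] at this
  · rw [Set.indicator_of_notMem hx]
    unfold Sub.dim
    rw [not_not.mp hx, finrank_bot]

theorem Sub.le_iff_supp_subset {P : Set Q} {U W : Sub (thin K P)} : U ≤ W ↔ U.supp ⊆ W.supp := by
  constructor
  · intro h x hx hW
    exact hx (le_bot_iff.mp (hW ▸ h x))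
  · intro h x
    by_cases hx : x ∈ U.supp
    · rw [Sub.carrier_eq_top (h hx)]; exact le_top
    · rw [not_not.mp hx]; exact bot_le

open Classical in
/-- The subrepresentation of a thin representation supported on an upwards closed subset. -/
noncomputable def Sub.ofUpIn (K : Type u) [Field K] {P U : Set Q} (h : IsUpIn P U) : Sub (thin K P) where
  carrier x := if x ∈ U then ⊤ else ⊥
  stable := fun {x y} e => by
    by_cases hy : y ∈ U
    · rw [if_pos hy]; exact fun _ _ => trivial
    · rw [if_neg hy]
      by_cases hx : x ∈ U
      · have hyP : y ∉ P := fun hyP => hy (h.2 x hx y hyP ⟨e.toPath⟩)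
        exact fun v _ => thin_obj_eq_zero hyP _
      · rw [if_neg hx]; exact bot_le

theorem Sub.supp_ofUpIn {P U : Set Q} (h : IsUpIn P U) : (Sub.ofUpIn K h).supp = U := by
  classical
  ext x
  unfold Sub.supp Sub.ofUpIn
  by_cases hx : x ∈ U
  · simp only [hx, if_true, Set.mem_ofPred_eq, iff_true]
    intro htop
    have h1 := dimVec_thin (K := K) P x
    rw [if_pos (h.1 hx)] at h1
    have h2 : Module.finrank K (⊤ : Submodule K ((thin K P).obj x)) = 1 := by
      rw [finrank_top]; exact h1
    rw [htop, finrank_bot] at h2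
    exact zero_ne_one h2
  · simp [hx]

variable [Fintype Q]

theorem Sub.wdim_thin {P : Set Q} (w : Q → ℝ) (U : Sub (thin K P)) :
    U.wdim w = wsum w U.supp := by
  unfold Sub.wdim wsum
  refine Finset.sum_congr rfl fun x _ => ?_
  rw [Sub.dim_thin]
  by_cases hx : x ∈ U.supp <;> simp [hx]

/-- The maximal weight is 0, so the smallest maximizer is the zero subrepresentation, and R is the
largest. -/
theorem thin_hasPart_indicator {P R : Set Q} (hP : PathConvex P) {w : Q → ℝ} (hR : IsUpIn P R)
    (h0 : wsum w R = 0) (hle : ∀ U, IsUpIn P U → wsum w U ≤ 0)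
    (hmax : ∀ U, IsUpIn P U → wsum w U = 0 → U ⊆ R) :
    (thin K P).HasPart w (R.indicator 1) := by
  have hz : (⊥ : Sub (thin K P)).supp = ∅ := by
    ext x
    simp only [Set.mem_empty_iff_false, iff_false]
    exact fun h => h rfl
  have hz' : (⊥ : Sub (thin K P)).wdim w = 0 := by
    rw [Sub.wdim_thin, hz]; simp [wsum]
  refine ⟨⊥, Sub.ofUpIn K hR, fun X => ?_, fun X => ?_, fun X hX => ⟨Sub.bot_le' X, ?_⟩,
    fun x => ?_⟩
  · rw [hz', Sub.wdim_thin]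
    exact hle _ (X.isUpIn_supp hP)
  · rw [Sub.wdim_thin, Sub.wdim_thin, Sub.supp_ofUpIn, h0]
    exact hle _ (X.isUpIn_supp hP)
  · rw [Sub.le_iff_supp_subset, Sub.supp_ofUpIn]
    refine hmax _ (X.isUpIn_supp hP) (le_antisymm (hle _ (X.isUpIn_supp hP)) ?_)
    have := hX ⊥
    rwa [hz', Sub.wdim_thin] at this
  · rw [Sub.dim_thin, Sub.dim_thin, Sub.supp_ofUpIn, hz]
    simp

/-- The part vanishes when the maximizer is unique. -/
theorem thin_hasPart_zero {P : Set Q} (hP : PathConvex P) {w : Q → ℝ}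
    (h : ∀ U U', IsUpIn P U → IsUpIn P U' → (∀ X, IsUpIn P X → wsum w X ≤ wsum w U) →
      (∀ X, IsUpIn P X → wsum w X ≤ wsum w U') → U = U') : (thin K P).HasPart w 0 := by
  have hsupp : ∀ X : Sub (thin K P), X.IsMaximizer w →
      ∀ Y, IsUpIn P Y → wsum w Y ≤ wsum w X.supp := by
    intro X hX Y hY
    have := hX (Sub.ofUpIn K hY)
    rwa [Sub.wdim_thin, Sub.wdim_thin, Sub.supp_ofUpIn] at this
  obtain ⟨X, hX⟩ := Sub.exists_isMaximizer (V := thin K P) w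
  refine ⟨X, X, hX, hX, fun Y hY => ?_, fun x => by simp⟩
  have heq := h _ _ (X.isUpIn_supp hP) (Y.isUpIn_supp hP) (hsupp X hX) (hsupp Y hY)
  exact ⟨Sub.le_iff_supp_subset.mpr heq.le, Sub.le_iff_supp_subset.mpr heq.ge⟩

/-- The part of slope `1 / k` of a thin representation along a skyscraper central charge. -/
theorem thin_hasPart_single [DecidableEq Q] {P : Set Q} (hP : PathConvex P) {s : Q} {k : ℕ}
    (hk : 0 < k) (D : Q → ℕ)
    (hD : s ∈ P → (gen P {s}).ncard = k → D = (gen P {s}).indicator 1)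
    (hD0 : ¬ (s ∈ P ∧ (gen P {s}).ncard = k) → D = 0) :
    (thin K P).HasPart (fun x => (Pi.single s 1 : Q → ℝ) x - 1 / (k : ℝ)) D := by
  have hk' : (0 : ℝ) < k := by exact_mod_cast hk
  have hval : ∀ U : Set Q, wsum (fun x => (Pi.single s 1 : Q → ℝ) x - 1 / (k : ℝ)) U =
      U.indicator (fun _ => 1) s - 1 / (k : ℝ) * U.ncard := fun U => by
    rw [wsum_sub_const, ← wsum_single, one_smul]
  have hG : ∀ U, IsUpIn P U → s ∈ U → gen P {s} ⊆ U := fun U hU hs =>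
    hU.gen_subset (Set.singleton_subset_iff.mpr hs)
  by_cases hM : s ∈ P ∧ (gen P {s}).ncard = k
  · rw [hD hM.1 hM.2]
    have hsG : s ∈ gen P {s} := mem_gen_of_mem hM.1 rfl
    have hin : ∀ U, IsUpIn P U → s ∈ U → k ≤ U.ncard := fun U hU hs =>
      hM.2 ▸ Set.ncard_le_ncard (hG U hU hs) U.toFinite
    refine thin_hasPart_indicator hP (isUpIn_gen _ _) ?_ (fun U hU => ?_) (fun U hU h0 => ?_)
    · rw [hval, Set.indicator_of_mem hsG, hM.2]
      field_simp
      ring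
    · rw [hval]
      by_cases hs : s ∈ U
      · rw [Set.indicator_of_mem hs]
        have : (k : ℝ) ≤ U.ncard := by exact_mod_cast hin U hU hs
        have h2 := mul_le_mul_of_nonneg_left this (one_div_pos.mpr hk').le
        rw [one_div_mul_cancel hk'.ne'] at h2
        linarith
      · rw [Set.indicator_of_notMem hs]
        have : 0 ≤ 1 / (k : ℝ) * U.ncard := by positivity
        linarith
    · rw [hval] at h0
      by_cases hs : s ∈ U
      · rw [Set.indicator_of_mem hs] at h0
        field_simp at h0
        have h1 : U.ncard = k := by
          have : (U.ncard : ℝ) = k := by linarith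
          exact_mod_cast this
        exact (Set.eq_of_subset_of_ncard_le (hG U hU hs) (by omega) U.toFinite).ge
      · rw [Set.indicator_of_notMem hs] at h0
        have h1 : (U.ncard : ℝ) = 0 := by
          field_simp at h0
          linarith
        have h2 : U = ∅ := (Set.ncard_eq_zero U.toFinite).mp (by exact_mod_cast h1)
        rw [h2]; exact Set.empty_subset _
  · rw [hD0 hM]
    -- Only the set generated by s and the empty set can be maximizers. Their weights are 1 - |gen P
    -- {s}| / k and 0, which agree only when the generated set has size k.
    have hmax1 : ∀ U, IsUpIn P U → (∀ X, IsUpIn P X →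
        wsum (fun x => (Pi.single s 1 : Q → ℝ) x - 1 / (k : ℝ)) X ≤
          wsum (fun x => (Pi.single s 1 : Q → ℝ) x - 1 / (k : ℝ)) U) → s ∈ U →
        U = gen P {s} := by
      intro U hU hm hs
      have h1 := hm _ (isUpIn_gen P {s})
      rw [hval, hval, Set.indicator_of_mem hs,
        Set.indicator_of_mem (show s ∈ gen P {s} from mem_gen_of_mem (hU.1 hs) rfl)] at h1
      have h2 : 1 / (k : ℝ) * U.ncard ≤ 1 / (k : ℝ) * (gen P {s}).ncard := by linarith
      have h3 := le_of_mul_le_mul_left h2 (one_div_pos.mpr hk')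
      exact (Set.eq_of_subset_of_ncard_le (hG U hU hs) (by exact_mod_cast h3) U.toFinite).symm
    have hmax0 : ∀ U, IsUpIn P U → (∀ X, IsUpIn P X →
        wsum (fun x => (Pi.single s 1 : Q → ℝ) x - 1 / (k : ℝ)) X ≤
          wsum (fun x => (Pi.single s 1 : Q → ℝ) x - 1 / (k : ℝ)) U) → s ∉ U → U = ∅ := by
      intro U hU hm hs
      have h1 := hm _ (isUpIn_empty P)
      rw [hval, hval, Set.indicator_of_notMem hs, Set.indicator_of_notMem (Set.notMem_empty s)]
        at h1
      have h2 : 1 / (k : ℝ) * U.ncard ≤ 1 / (k : ℝ) * 0 := by simpa using h1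
      have h3 := le_of_mul_le_mul_left h2 (one_div_pos.mpr hk')
      exact (Set.ncard_eq_zero U.toFinite).mp (by
        have : U.ncard ≤ 0 := by exact_mod_cast h3
        omega)
    have hdiff : ∀ U U', IsUpIn P U → s ∈ U → U = gen P {s} → U' = ∅ →
        wsum (fun x => (Pi.single s 1 : Q → ℝ) x - 1 / (k : ℝ)) U =
          wsum (fun x => (Pi.single s 1 : Q → ℝ) x - 1 / (k : ℝ)) U' → False := by
      intro U U' hU hs hUG hU' heq
      rw [hval, hval, hU', Set.indicator_of_mem hs,
        Set.indicator_of_notMem (Set.notMem_empty s), Set.ncard_empty, hUG] at heq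
      field_simp at heq
      refine hM ⟨hU.1 hs, ?_⟩
      have : ((gen P {s}).ncard : ℝ) = k := by
        simp at heq
        linarith
      exact_mod_cast this
    refine thin_hasPart_zero hP fun U U' hU hU' hm hm' => ?_
    have heq := le_antisymm (hm' U hU) (hm U' hU')
    by_cases hs : s ∈ U <;> by_cases hs' : s ∈ U'
    · rw [hmax1 U hU hm hs, hmax1 U' hU' hm' hs']
    · exact (hdiff U U' hU hs (hmax1 U hU hm hs) (hmax0 U' hU' hm' hs') heq).elim
    · exact (hdiff U' U hU' hs' (hmax1 U' hU' hm' hs') (hmax0 U hU hm hs) heq.symm).elim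
    · rw [hmax0 U hU hm hs, hmax0 U' hU' hm' hs']

/-- Comparison of coefficients: 1 and t are linearly independent over the rationals. -/
theorem _root_.Irrational.eq_of_combination_eq {t : ℝ} (ht : Irrational t) {k i j m : ℤ}
    (hk : k ≠ 0) (h : (i : ℝ) + t * j = (1 + t) / k * m) : i * k = m ∧ j * k = m := by
  have hk' : (k : ℝ) ≠ 0 := by exact_mod_cast hk
  have h1 : t * ((j * k - m : ℤ) : ℝ) = ((m - i * k : ℤ) : ℝ) := by
    push_cast
    field_simp at h
    linarith
  by_cases hz : j * k - m = 0
  · rw [hz] at h1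
    have h2 : ((m - i * k : ℤ) : ℝ) = 0 := by rw [← h1]; simp
    have h3 : m - i * k = 0 := by exact_mod_cast h2
    constructor <;> linarith
  · have hz' : ((j * k - m : ℤ) : ℝ) ≠ 0 := by exact_mod_cast hz
    exact absurd (by rw [eq_div_iff hz', h1])
      ((irrational_iff_ne_rational t).mp ht (m - i * k) (j * k - m) hz)

open Classical in
-- To be applied to the membership of the two generators in two maximizers: if the differences
-- agree, then the maximizers contain the same generators, or one contains both and the other
-- neither.
theorem of_ite_sub_ite_eq {p p' q q' : Prop}
    (h : ((if p then 1 else 0 : ℤ) - (if p' then 1 else 0)) =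
      (if q then 1 else 0 : ℤ) - (if q' then 1 else 0)) :
    ((p ↔ p') ∧ (q ↔ q')) ∨ (p ∧ q ∧ ¬ p' ∧ ¬ q') ∨ (p' ∧ q' ∧ ¬ p ∧ ¬ q) := by
  by_cases h1 : p <;> by_cases h2 : p' <;> by_cases h3 : q <;> by_cases h4 : q' <;>
    simp [h1, h2, h3, h4] at h ⊢

/-- The last two hypotheses say that the sets generated by s alone and by s' alone have slope below
θ = (1 + t) / k. A closed set with exactly one generator therefore has negative weight, and one with
both has weight at most 0, with equality only for the set generated by both. -/
theorem thin_hasPart_pair_indicator [DecidableEq Q] {P : Set Q} (hP : PathConvex P) {s s' : Q}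
    {k : ℕ} (hk : 0 < k) {t : ℝ} (ht : 0 < t) (hs : s ∈ P) (hs' : s' ∈ P)
    (hG : (gen P {s, s'}).ncard = k) (h1 : 1 < (1 + t) / k * (gen P {s}).ncard)
    (h2 : t < (1 + t) / k * (gen P {s'}).ncard) :
    (thin K P).HasPart
      (fun x => (Pi.single s 1 + t • Pi.single s' 1 : Q → ℝ) x - (1 + t) / (k : ℝ))
      ((gen P {s, s'}).indicator 1) := by
  have hk' : (0 : ℝ) < k := by exact_mod_cast hk
  have hθ : 0 < (1 + t) / (k : ℝ) := by positivity
  set θ := (1 + t) / (k : ℝ) with hθdef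
  have hθk : θ * k = 1 + t := div_mul_cancel₀ _ hk'.ne'
  have hmono : ∀ {A B : Set Q}, A ⊆ B → θ * A.ncard ≤ θ * B.ncard := fun {A B} h =>
    mul_le_mul_of_nonneg_left (by exact_mod_cast Set.ncard_le_ncard h B.toFinite) hθ.le
  have key : ∀ U, IsUpIn P U →
      wsum (fun x => (Pi.single s 1 + t • Pi.single s' 1 : Q → ℝ) x - θ) U ≤ 0 ∧
      (wsum (fun x => (Pi.single s 1 + t • Pi.single s' 1 : Q → ℝ) x - θ) U = 0 →
        U ⊆ gen P {s, s'}) := by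
    intro U hU
    rw [wsum_pair]
    by_cases hsU : s ∈ U <;> by_cases hsU' : s' ∈ U
    · rw [Set.indicator_of_mem hsU, Set.indicator_of_mem hsU']
      have hsub : gen P {s, s'} ⊆ U := hU.gen_subset (by
        rintro x (rfl | rfl)
        · exact hsU
        · exact hsU')
      have h3 := hmono hsub
      rw [hG, hθk] at h3
      refine ⟨by linarith, fun h0 => ?_⟩
      have h4 : θ * U.ncard = θ * k := by linarith
      have h5 : (U.ncard : ℝ) = k := mul_left_cancel₀ hθ.ne' h4
      have h6 : U.ncard = k := by exact_mod_cast h5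
      exact (Set.eq_of_subset_of_ncard_le hsub (by omega) U.toFinite).ge
    · rw [Set.indicator_of_mem hsU, Set.indicator_of_notMem hsU']
      have h3 := hmono (hU.gen_subset (Set.singleton_subset_iff.mpr hsU))
      exact ⟨by linarith, fun h0 => by linarith⟩
    · rw [Set.indicator_of_notMem hsU, Set.indicator_of_mem hsU']
      have h3 := hmono (hU.gen_subset (Set.singleton_subset_iff.mpr hsU'))
      exact ⟨by linarith, fun h0 => by linarith⟩
    · rw [Set.indicator_of_notMem hsU, Set.indicator_of_notMem hsU']
      have h3 : 0 ≤ θ * U.ncard := by positivity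
      refine ⟨by linarith, fun h0 => ?_⟩
      have h4 : θ * U.ncard = θ * 0 := by linarith
      have h5 : (U.ncard : ℝ) = 0 := mul_left_cancel₀ hθ.ne' h4
      have h6 : U = ∅ := (Set.ncard_eq_zero U.toFinite).mp (by exact_mod_cast h5)
      rw [h6]; exact Set.empty_subset _
  refine thin_hasPart_indicator hP (isUpIn_gen _ _) ?_ (fun U hU => (key U hU).1)
    (fun U hU => (key U hU).2)
  rw [wsum_pair, Set.indicator_of_mem (mem_gen_of_mem hs (by simp)),
    Set.indicator_of_mem (mem_gen_of_mem hs' (by simp)), hG, hθk]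
  ring

/-- By irrationality, two distinct maximizers could only be the empty set and the set generated by
both, of size k. If the sets generated by s and by s' are disjoint, this tie is impossible: their
weights would be nonpositive with sum 0, hence both 0, which irrationality forbids for a single
generator. -/
theorem thin_hasPart_pair_zero [DecidableEq Q] {P : Set Q} (hP : PathConvex P) {s s' : Q}
    {k : ℕ} (hk : 0 < k) {t : ℝ} (ht : 0 < t) (hirr : Irrational t)
    (h : s ∈ P → s' ∈ P → (gen P {s, s'}).ncard = k → Disjoint (gen P {s}) (gen P {s'})) :
    (thin K P).HasPart
      (fun x => (Pi.single s 1 + t • Pi.single s' 1 : Q → ℝ) x - (1 + t) / (k : ℝ)) 0 := by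
  classical
  have hk' : (0 : ℝ) < k := by exact_mod_cast hk
  have hkZ : (k : ℤ) ≠ 0 := by exact_mod_cast hk.ne'
  have hθ : 0 < (1 + t) / (k : ℝ) := by positivity
  set w : Q → ℝ := fun x => (Pi.single s 1 + t • Pi.single s' 1 : Q → ℝ) x - (1 + t) / (k : ℝ)
    with hw
  have hval : ∀ U : Set Q, wsum w U = U.indicator (fun _ => 1) s + U.indicator (fun _ => t) s'
      - (1 + t) / (k : ℝ) * U.ncard := fun U => wsum_pair _ _ _ _ _
  -- maximizers are generated by the part of `{s, s'}` which they contain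
  have hgen : ∀ U, IsUpIn P U → (∀ X, IsUpIn P X → wsum w X ≤ wsum w U) →
      U = gen P (U ∩ {s, s'}) := by
    intro U hU hm
    have hsub : gen P (U ∩ {s, s'}) ⊆ U := hU.gen_subset Set.inter_subset_left
    have hmem : ∀ x ∈ ({s, s'} : Set Q), x ∈ gen P (U ∩ {s, s'}) ↔ x ∈ U := fun x hx =>
      ⟨fun h => hsub h, fun h => mem_gen_of_mem (hU.1 h) ⟨h, hx⟩⟩
    have h1 := hm _ (isUpIn_gen P (U ∩ {s, s'}))
    have hi1 : (gen P (U ∩ {s, s'})).indicator (fun _ => (1 : ℝ)) s =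
        U.indicator (fun _ => 1) s := by
      simp only [Set.indicator_apply, hmem s (by simp)]
    have hi2 : (gen P (U ∩ {s, s'})).indicator (fun _ => t) s' =
        U.indicator (fun _ => t) s' := by
      simp only [Set.indicator_apply, hmem s' (by simp)]
    rw [hval, hval, hi1, hi2] at h1
    have h3 := le_of_mul_le_mul_left (sub_le_sub_iff_left _ |>.mp h1) hθ
    exact (Set.eq_of_subset_of_ncard_le hsub (by exact_mod_cast h3) U.toFinite).symm
  have hind : ∀ (U : Set Q) (x : Q) (r : ℝ), U.indicator (fun _ => r) x =
      r * ((if x ∈ U then 1 else 0 : ℤ) : ℝ) := fun U x r => by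
    by_cases hx : x ∈ U <;> simp [hx]
  have hcomb : ∀ U U', wsum w U = wsum w U' →
      ((if s ∈ U then 1 else 0 : ℤ) - (if s ∈ U' then 1 else 0)) * k =
        (U.ncard : ℤ) - U'.ncard ∧
      ((if s' ∈ U then 1 else 0 : ℤ) - (if s' ∈ U' then 1 else 0)) * k =
        (U.ncard : ℤ) - U'.ncard := by
    intro U U' heq
    refine hirr.eq_of_combination_eq hkZ ?_
    rw [hval, hval] at heq
    simp only [hind] at heq
    push_cast at heq ⊢
    linarith
  -- a maximizer containing both generators and one containing neither cannot coexist
  have hcontra : ∀ U U', IsUpIn P U → IsUpIn P U' →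
      (∀ X, IsUpIn P X → wsum w X ≤ wsum w U) → (∀ X, IsUpIn P X → wsum w X ≤ wsum w U') →
      wsum w U = wsum w U' → s ∈ U → s' ∈ U → s ∉ U' → s' ∉ U' → False := by
    intro U U' hU hU' hm hm' heq hsU hsU' hnU hnU'
    have hUg : U = gen P {s, s'} := by
      have h1 := hgen U hU hm
      have h2 : U ∩ {s, s'} = {s, s'} := Set.inter_eq_right.mpr (by
        rintro x (rfl | rfl)
        · exact hsU
        · exact hsU')
      rwa [h2] at h1
    have hU'e : U' = ∅ := by
      have h1 := hgen U' hU' hm'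
      have h2 : U' ∩ {s, s'} = ∅ := by
        ext x
        simp only [Set.mem_inter_iff, Set.mem_insert_iff, Set.mem_singleton_iff,
          Set.mem_empty_iff_false, iff_false, not_and, not_or]
        intro hx
        constructor
        · rintro rfl; exact hnU hx
        · rintro rfl; exact hnU' hx
      rw [h2] at h1
      rw [h1]
      ext x
      simp [gen]
    have hk0 := (hcomb U U' heq).1
    rw [hU'e] at hk0
    simp only [hsU, if_true, Set.mem_empty_iff_false, if_false, Set.ncard_empty] at hk0
    have hUk : U.ncard = k := by
      push_cast at hk0
      omega
    have hdisj := h (hU.1 hsU) (hU.1 hsU') (hUg ▸ hUk)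
    have hsg : s ∈ gen P {s} := mem_gen_of_mem (hU.1 hsU) rfl
    have hsg' : s' ∈ gen P {s'} := mem_gen_of_mem (hU.1 hsU') rfl
    have hunion : U = gen P {s} ∪ gen P {s'} := by
      rw [hUg]
      ext x
      simp only [gen, Set.mem_union, Set.mem_ofPred_eq, Set.mem_insert_iff,
        Set.mem_singleton_iff, exists_eq_or_imp, exists_eq_left]
      tauto
    have hcard : (gen P {s}).ncard + (gen P {s'}).ncard = k := by
      rw [← Set.ncard_union_eq hdisj (Set.toFinite _) (Set.toFinite _), ← hunion, hUk]
    -- Since the empty set is a maximizer, neither generator alone gives positive weight; by `e3`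
    -- these two weights add up to 0, so 1 = θ |gen P {s}|. The coefficient of t is then 0, against
    -- the coefficient 1 of the constant term.
    have e1 := hm' _ (isUpIn_gen P {s})
    have e2 := hm' _ (isUpIn_gen P {s'})
    rw [hval, hval, hU'e, Set.indicator_of_mem hsg,
      Set.indicator_of_notMem (fun hx => Set.disjoint_left.mp hdisj hx hsg')] at e1
    rw [hval, hval, hU'e, Set.indicator_of_mem hsg',
      Set.indicator_of_notMem (fun hx => Set.disjoint_left.mp hdisj hsg hx)] at e2
    simp only [Set.indicator_empty, Set.ncard_empty, Nat.cast_zero, mul_zero, add_zero, sub_zero,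
      zero_add] at e1 e2
    have e3 : (1 + t) / (k : ℝ) * (gen P {s}).ncard + (1 + t) / (k : ℝ) * (gen P {s'}).ncard =
        1 + t := by
      rw [← mul_add, ← Nat.cast_add, hcard, div_mul_cancel₀ _ hk'.ne']
    have e4 : ((1 : ℤ) : ℝ) + t * ((0 : ℤ) : ℝ) =
        (1 + t) / ((k : ℤ) : ℝ) * (((gen P {s}).ncard : ℤ) : ℝ) := by
      push_cast
      linarith
    have e5 := hirr.eq_of_combination_eq hkZ e4
    omega
  refine thin_hasPart_zero hP fun U U' hU hU' hm hm' => ?_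
  have heq := le_antisymm (hm' U hU) (hm U' hU')
  obtain ⟨c1, c2⟩ := hcomb U U' heq
  have c3 := mul_right_cancel₀ hkZ (c1.trans c2.symm)
  rcases of_ite_sub_ite_eq c3 with ⟨hs, hs2⟩ | ⟨a1, a3, a2, a4⟩ | ⟨a2, a4, a1, a3⟩
  · rw [hgen U hU hm, hgen U' hU' hm']
    congr 1
    ext x
    simp only [Set.mem_inter_iff, Set.mem_insert_iff, Set.mem_singleton_iff]
    constructor
    · rintro ⟨hx, rfl | rfl⟩
      · exact ⟨hs.mp hx, Or.inl rfl⟩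
      · exact ⟨hs2.mp hx, Or.inr rfl⟩
    · rintro ⟨hx, rfl | rfl⟩
      · exact ⟨hs.mpr hx, Or.inl rfl⟩
      · exact ⟨hs2.mpr hx, Or.inr rfl⟩
  · exact (hcontra U U' hU hU' hm hm' heq a1 a3 a2 a4).elim
  · exact (hcontra U' U hU' hU hm' hm heq.symm a2 a4 a1 a3).elim

end Thin

end QuiverRep

/-! ### Blocks -/

section Blocks

variable {ℓ : ℕ}

theorem ncard_block {a b c d : ℕ} (hb : b ≤ ℓ + 1) (hd : d ≤ ℓ + 1) :
    (block ℓ a b c d).ncard = (b - a) + (d - c) := by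
  have hrow : ∀ a b : ℕ, b ≤ ℓ + 1 →
      {i : Fin (ℓ + 1) | a ≤ i.val ∧ i.val < b}.ncard = b - a := fun a b hb => by
    rw [← Set.ncard_image_of_injective _ Fin.val_injective, ← Nat.card_Ico,
      ← Set.ncard_coe_finset]
    congr 1
    ext n
    simp only [Set.mem_image, Set.mem_ofPred_eq, Finset.coe_Ico, Set.mem_Ico]
    constructor
    · rintro ⟨i, h, rfl⟩; exact h
    · intro h; exact ⟨⟨n, by omega⟩, h, rfl⟩
  have hun : block ℓ a b c d = (LadderVertex.top '' {i | a ≤ i.val ∧ i.val < b}) ∪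
      (LadderVertex.bot '' {i | c ≤ i.val ∧ i.val < d}) := by
    ext (i | i)
    · simp [top_mem_block]
    · simp [bot_mem_block]
  have hdisj : Disjoint (LadderVertex.top '' {i : Fin (ℓ + 1) | a ≤ i.val ∧ i.val < b})
      (LadderVertex.bot '' {i | c ≤ i.val ∧ i.val < d}) := by
    rw [Set.disjoint_left]
    rintro _ ⟨i, -, rfl⟩ ⟨j, -, h⟩
    cases h
  rw [hun, Set.ncard_union_eq hdisj, Set.ncard_image_of_injective _ fun _ _ h => by cases h; rfl,
    Set.ncard_image_of_injective _ fun _ _ h => by cases h; rfl, hrow a b hb, hrow c d hd]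

theorem minSet_block_top {a : Fin (ℓ + 1)} {b d : ℕ} (hab : a.val < b) :
    minSet (block ℓ a b a d) = {.top a} := by
  have ha : .top a ∈ block ℓ a b a d := top_mem_block.mpr ⟨le_rfl, hab⟩
  ext x
  simp only [minSet, Set.mem_ofPred_eq, Set.mem_singleton_iff, nonempty_ladder_path_iff]
  constructor
  · rintro ⟨hx, h⟩
    refine (h _ ha ⟨Nat.zero_le _, ?_⟩).symm
    rcases x with i | i
    · exact (top_mem_block.mp hx).1
    · exact (bot_mem_block.mp hx).1
  · rintro rfl
    refine ⟨ha, ?_⟩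
    rintro (i | i) hy ⟨h1, h2⟩
    · congr 1
      exact Fin.ext (le_antisymm h2 (top_mem_block.mp hy).1)
    · simp [LadderVertex.row] at h1

theorem minSet_block_pair {a c : Fin (ℓ + 1)} {b d : ℕ} (hab : a.val < b) (hca : c.val < a.val)
    (hcd : c.val < d) : minSet (block ℓ a b c d) = {.top a, .bot c} := by
  have ha : .top a ∈ block ℓ a b c d := top_mem_block.mpr ⟨le_rfl, hab⟩
  have hc : .bot c ∈ block ℓ a b c d := bot_mem_block.mpr ⟨le_rfl, hcd⟩
  ext x
  simp only [minSet, Set.mem_ofPred_eq, Set.mem_insert_iff, Set.mem_singleton_iff,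
    nonempty_ladder_path_iff]
  constructor
  · rintro ⟨hx, h⟩
    rcases x with i | i
    · exact Or.inl (h _ ha ⟨le_rfl, (top_mem_block.mp hx).1⟩).symm
    · exact Or.inr (h _ hc ⟨le_rfl, (bot_mem_block.mp hx).1⟩).symm
  · rintro (rfl | rfl)
    · refine ⟨ha, ?_⟩
      rintro (i | i) hy ⟨h1, h2⟩
      · congr 1
        exact Fin.ext (le_antisymm h2 (top_mem_block.mp hy).1)
      · simp [LadderVertex.row] at h1
    · refine ⟨hc, ?_⟩
      rintro (i | i) hy ⟨h1, h2⟩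
      · have h3 := (top_mem_block.mp hy).1
        simp only [LadderVertex.col] at h2
        omega
      · congr 1
        exact Fin.ext (le_antisymm h2 (bot_mem_block.mp hy).1)

theorem minSet_block_bot {c : Fin (ℓ + 1)} {d : ℕ} (hcd : c.val < d) :
    minSet (block ℓ 0 0 c d) = {.bot c} := by
  have hc : .bot c ∈ block ℓ 0 0 c d := bot_mem_block.mpr ⟨le_rfl, hcd⟩
  ext x
  simp only [minSet, Set.mem_ofPred_eq, Set.mem_singleton_iff, nonempty_ladder_path_iff]
  constructor
  · rintro ⟨hx, h⟩
    rcases x with i | i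
    · have := (top_mem_block.mp hx).2
      omega
    · exact (h _ hc ⟨le_rfl, (bot_mem_block.mp hx).1⟩).symm
  · rintro rfl
    refine ⟨hc, ?_⟩
    rintro (i | i) hy ⟨h1, h2⟩
    · have := (top_mem_block.mp hy).2
      omega
    · congr 1
      exact Fin.ext (le_antisymm h2 (bot_mem_block.mp hy).1)

/-- A block is generated by one vertex of the top row, by one vertex in each row, or by one vertex
of the bottom row. -/
theorem IsBlock.cases {P : Set (LadderVertex ℓ)} (h : IsBlock P) :
    (∃ (a : Fin (ℓ + 1)) (b d : ℕ), a.val < b ∧ b ≤ ℓ + 1 ∧ a.val ≤ d ∧ d ≤ b ∧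
      P = block ℓ a b a d) ∨
    (∃ (a c : Fin (ℓ + 1)) (b d : ℕ), c.val < a.val ∧ a.val < d ∧ d ≤ b ∧ b ≤ ℓ + 1 ∧
      P = block ℓ a b c d) ∨
    ∃ (c : Fin (ℓ + 1)) (d : ℕ), c.val < d ∧ d ≤ ℓ + 1 ∧ P = block ℓ 0 0 c d := by
  obtain ⟨a, b, c, d, ⟨h1, h2, h3, h4, h5, h6⟩ | ⟨rfl, rfl, h3, h4⟩, rfl⟩ := h
  · rcases h3.eq_or_lt with rfl | hca
    · exact Or.inl ⟨⟨c, by omega⟩, b, d, h1, h2, h4, h5, rfl⟩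
    · have had : a < d := lt_of_le_of_ne h4 fun h => hca.ne (h6 h)
      exact Or.inr (Or.inl ⟨⟨a, by omega⟩, ⟨c, by omega⟩, b, d, hca, had, h5, h2, rfl⟩)
  · exact Or.inr (Or.inr ⟨⟨c, by omega⟩, d, h3, h4, rfl⟩)

theorem isBlock_top {a : Fin (ℓ + 1)} {b d : ℕ} (hab : a.val < b) (hb : b ≤ ℓ + 1)
    (had : a.val ≤ d) (hdb : d ≤ b) : IsBlock (block ℓ a b a d) :=
  ⟨_, _, _, _, Or.inl ⟨hab, hb, le_rfl, had, hdb, fun _ => rfl⟩, rfl⟩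

theorem isBlock_pair {a c : Fin (ℓ + 1)} {b d : ℕ} (hca : c.val < a.val) (had : a.val < d)
    (hdb : d ≤ b) (hb : b ≤ ℓ + 1) : IsBlock (block ℓ a b c d) :=
  ⟨_, _, _, _, Or.inl ⟨by omega, hb, hca.le, had.le, hdb, by omega⟩, rfl⟩

theorem isBlock_bot {c : Fin (ℓ + 1)} {d : ℕ} (hcd : c.val < d) (hd : d ≤ ℓ + 1) :
    IsBlock (block ℓ 0 0 c d) :=
  ⟨_, _, _, _, Or.inr ⟨rfl, rfl, hcd, hd⟩, rfl⟩

theorem IsBlock.nonempty {P : Set (LadderVertex ℓ)} (h : IsBlock P) : P.Nonempty := by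
  rcases h.cases with ⟨a, b, d, hab, -, -, -, rfl⟩ | ⟨a, c, b, d, _, _, _, -, rfl⟩ |
    ⟨c, d, hcd, -, rfl⟩
  · exact ⟨.top a, top_mem_block.mpr ⟨le_rfl, hab⟩⟩
  · exact ⟨.top a, top_mem_block.mpr ⟨le_rfl, by omega⟩⟩
  · exact ⟨.bot c, bot_mem_block.mpr ⟨le_rfl, hcd⟩⟩

theorem IsBlock.pathConvex {P : Set (LadderVertex ℓ)} (h : IsBlock P) : PathConvex P := by
  obtain ⟨a, b, c, d, hs, rfl⟩ := h
  unfold BlockShape at hs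
  intro x hx z hz y hxy hyz
  rw [nonempty_ladder_path_iff] at hxy hyz
  rcases x with i | i <;> rcases y with j | j <;> rcases z with k | k <;>
    simp only [top_mem_block, bot_mem_block, LadderVertex.row, LadderVertex.col] at * <;> omega

theorem gen_block_top {a b c d : ℕ} {i : Fin (ℓ + 1)} (hs : BlockShape ℓ a b c d)
    (hi : .top i ∈ block ℓ a b c d) : gen (block ℓ a b c d) {.top i} = block ℓ i b i d := by
  rw [top_mem_block] at hi
  unfold BlockShape at hs
  ext (j | j) <;> simp only [gen, Set.mem_ofPred_eq, Set.mem_singleton_iff, exists_eq_left,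
    nonempty_ladder_path_iff, top_mem_block, bot_mem_block, LadderVertex.row, LadderVertex.col] <;>
    omega

theorem gen_block_bot {a b c d : ℕ} {i : Fin (ℓ + 1)}
    (hi : .bot i ∈ block ℓ a b c d) : gen (block ℓ a b c d) {.bot i} = block ℓ 0 0 i d := by
  rw [bot_mem_block] at hi
  ext (j | j) <;> simp only [gen, Set.mem_ofPred_eq, Set.mem_singleton_iff, exists_eq_left,
    nonempty_ladder_path_iff, top_mem_block, bot_mem_block, LadderVertex.row, LadderVertex.col] <;>
    omega

theorem gen_block_pair {a b c d : ℕ} {i j : Fin (ℓ + 1)} (hji : j.val ≤ i.val)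
    (hi : .top i ∈ block ℓ a b c d) (hj : .bot j ∈ block ℓ a b c d) :
    gen (block ℓ a b c d) {.top i, .bot j} = block ℓ i b j d := by
  rw [top_mem_block] at hi
  rw [bot_mem_block] at hj
  ext (k | k) <;> simp only [gen, Set.mem_ofPred_eq, Set.mem_singleton_iff, Set.mem_insert_iff,
    exists_eq_or_imp, exists_eq_left,
    nonempty_ladder_path_iff, top_mem_block, bot_mem_block, LadderVertex.row, LadderVertex.col] <;>
    omega

theorem IsBlock.gen_minSet {P : Set (LadderVertex ℓ)} (h : IsBlock P) : gen P (minSet P) = P := by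
  rcases h.cases with ⟨a, b, d, hab, hb, had, hdb, rfl⟩ | ⟨a, c, b, d, _, _, _, _, rfl⟩ |
    ⟨c, d, hcd, -, rfl⟩
  · rw [minSet_block_top hab, gen_block_top (Or.inl ⟨hab, hb, le_rfl, had, hdb, fun _ => rfl⟩)
      (top_mem_block.mpr ⟨le_rfl, hab⟩)]
  · rw [minSet_block_pair (by omega) (by omega) (by omega),
      gen_block_pair (by omega) (top_mem_block.mpr ⟨le_rfl, by omega⟩)
        (bot_mem_block.mpr ⟨le_rfl, by omega⟩)]
  · rw [minSet_block_bot hcd, gen_block_bot (bot_mem_block.mpr ⟨le_rfl, hcd⟩)]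

theorem isBlock_gen_top {P : Set (LadderVertex ℓ)} (h : IsBlock P) {i : Fin (ℓ + 1)}
    (hi : .top i ∈ P) : IsBlock (gen P {.top i}) ∧ minSet (gen P {.top i}) = {.top i} := by
  obtain ⟨a, b, c, d, hs, rfl⟩ := h
  rw [gen_block_top hs hi]
  rw [top_mem_block] at hi
  -- If column i lies beyond the bottom interval, the bottom part is empty, and its right end is
  -- moved to i to fit the normal form of blocks.
  have heq : block ℓ i b i d = block ℓ i b i (max i.val d) := by
    ext (j | j) <;> simp only [top_mem_block, bot_mem_block]
    omega
  rw [heq]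
  unfold BlockShape at hs
  exact ⟨isBlock_top (by omega) (by omega) (by omega) (by omega), minSet_block_top (by omega)⟩

theorem isBlock_gen_bot {P : Set (LadderVertex ℓ)} (h : IsBlock P) {i : Fin (ℓ + 1)}
    (hi : .bot i ∈ P) : IsBlock (gen P {.bot i}) ∧ minSet (gen P {.bot i}) = {.bot i} := by
  obtain ⟨a, b, c, d, hs, rfl⟩ := h
  rw [gen_block_bot hi]
  rw [bot_mem_block] at hi
  unfold BlockShape at hs
  exact ⟨isBlock_bot (by omega) (by omega), minSet_block_bot (by omega)⟩

theorem pair_eq_pair_iff {a a' c c' : Fin (ℓ + 1)} :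
    ({.top a, .bot c} : Set (LadderVertex ℓ)) = {.top a', .bot c'} ↔ a = a' ∧ c = c' := by
  constructor
  · intro h
    have h1 : LadderVertex.top a ∈ ({.top a', .bot c'} : Set (LadderVertex ℓ)) := h ▸ by simp
    have h2 : LadderVertex.bot c ∈ ({.top a', .bot c'} : Set (LadderVertex ℓ)) := h ▸ by simp
    simpa using And.intro h1 h2
  · rintro ⟨rfl, rfl⟩; rfl

theorem pair_ne_singleton {a c : Fin (ℓ + 1)} {x : LadderVertex ℓ} :
    ({.top a, .bot c} : Set (LadderVertex ℓ)) ≠ {x} := by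
  intro h
  have h1 : LadderVertex.top a ∈ ({x} : Set (LadderVertex ℓ)) := h ▸ by simp
  have h2 : LadderVertex.bot c ∈ ({x} : Set (LadderVertex ℓ)) := h ▸ by simp
  simp only [Set.mem_singleton_iff] at h1 h2
  rw [← h1] at h2
  cases h2

/-- Along the central charge of a block `R`, the part of appropriate slope of a thin
representation on a block detects whether `R` is a subrepresentation generated by the minimal
vertices of `R`. -/
theorem exists_charge_hasPart (K : Type u) [Field K] {t : ℕ → ℕ → ℝ} (ht : IsAdmissibleParam t)
    {R : Set (LadderVertex ℓ)} (hR : IsBlock R) :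
    ∃ (α : LadderVertex ℓ → ℝ) (θ : ℝ), IsLadderCharge t R.ncard (minSet R) α ∧
      ∀ P, IsBlock P → ∀ D : LadderVertex ℓ → ℕ,
        (IsBlock (gen P (minSet R)) ∧ minSet (gen P (minSet R)) = minSet R ∧
          (gen P (minSet R)).ncard = R.ncard → D = (gen P (minSet R)).indicator 1) →
        (¬ (IsBlock (gen P (minSet R)) ∧ minSet (gen P (minSet R)) = minSet R ∧
          (gen P (minSet R)).ncard = R.ncard) → D = 0) →
        (thin K P).HasPart (fun x => α x - θ) D := by
  have hpos : 0 < R.ncard := (Set.ncard_pos R.toFinite).mpr hR.nonempty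
  have hsingle : ∀ s, minSet R = {s} →
      (∀ P, IsBlock P → s ∈ P → IsBlock (gen P {s}) ∧ minSet (gen P {s}) = {s}) →
      ∃ (α : LadderVertex ℓ → ℝ) (θ : ℝ), IsLadderCharge t R.ncard (minSet R) α ∧
      ∀ P, IsBlock P → ∀ D : LadderVertex ℓ → ℕ,
        (IsBlock (gen P (minSet R)) ∧ minSet (gen P (minSet R)) = minSet R ∧
          (gen P (minSet R)).ncard = R.ncard → D = (gen P (minSet R)).indicator 1) →
        (¬ (IsBlock (gen P (minSet R)) ∧ minSet (gen P (minSet R)) = minSet R ∧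
          (gen P (minSet R)).ncard = R.ncard) → D = 0) →
        (thin K P).HasPart (fun x => α x - θ) D := by
    intro s hs hgen
    refine ⟨skyscraper s, 1 / (R.ncard : ℝ), Or.inl ⟨s, hs, rfl⟩, fun P hP D hD hD0 => ?_⟩
    rw [hs] at hD hD0
    refine thin_hasPart_single hP.pathConvex hpos D (fun h1 h2 => ?_) (fun h1 => ?_)
    · exact hD ⟨(hgen P hP h1).1, (hgen P hP h1).2, h2⟩
    · refine hD0 fun h2 => h1 ⟨?_, h2.2.2⟩
      have h3 : s ∈ minSet (gen P {s}) := by rw [h2.2.1]; rfl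
      exact h3.1.1
  rcases hR.cases with ⟨a, b, d, hab, hb, had, hdb, rfl⟩ | ⟨a, c, b, d, hca, had, hdb, hb, rfl⟩ |
    ⟨c, d, hcd, -, rfl⟩
  · exact hsingle _ (minSet_block_top hab) fun P hP hs => isBlock_gen_top hP hs
  · have hmin : minSet (block ℓ a b c d) = {.top a, .bot c} :=
      minSet_block_pair (by omega) hca (by omega)
    rw [hmin]
    set k := (block ℓ a b c d).ncard with hk
    have hkval : k = (b - a.val) + (d - c.val) := ncard_block hb (by omega)
    set q := a.val - c.val with hq
    -- The bottom interval has at least q + 1 vertices because it reaches column a, and the top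
    -- interval has at least one; hence the upper bound on the parameter is a finite one.
    have hqk : q + 1 < k := by omega
    obtain ⟨hirr, hlow, hupp⟩ := ht k q (by omega)
    replace hupp := hupp hqk
    set τ := t k q with hτ
    have hkq : (0 : ℝ) < (k : ℝ) - q := by
      have : (q : ℝ) + 1 < k := by exact_mod_cast hqk
      linarith
    have hkq1 : (0 : ℝ) < (k : ℝ) - (q + 1) := by
      have : (q : ℝ) + 1 < k := by exact_mod_cast hqk
      linarith
    have hτ0 : 0 < τ := lt_of_le_of_lt (by positivity) hlow
    rw [div_lt_iff₀ hkq] at hlow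
    rw [lt_div_iff₀ hkq1] at hupp
    have hkR : (0 : ℝ) < k := by exact_mod_cast hpos
    refine ⟨skyscraper (.top a) + τ • skyscraper (.bot c), (1 + τ) / k,
      Or.inr ⟨a, c, hca, rfl, rfl⟩, fun P hP D hD hD0 => ?_⟩
    by_cases hM : IsBlock (gen P {.top a, .bot c}) ∧
        minSet (gen P {.top a, .bot c}) = {.top a, .bot c} ∧
        (gen P {.top a, .bot c}).ncard = k
    · rw [hD hM]
      obtain ⟨hG, hGmin, hGk⟩ := hM
      have ha : .top a ∈ P := by
        have h3 : .top a ∈ minSet (gen P {.top a, .bot c}) := by rw [hGmin]; simp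
        exact h3.1.1
      have hc : .bot c ∈ P := by
        have h3 : .bot c ∈ minSet (gen P {.top a, .bot c}) := by rw [hGmin]; simp
        exact h3.1.1
      -- A block with two minimal vertices contains the vertex below the first, where the parts
      -- generated by the two meet.
      have hbot : .bot a ∈ P := by
        suffices h : .bot a ∈ gen P {.top a, .bot c} from h.1
        rcases hG.cases with ⟨a', b', d', hab', -, -, -, h⟩ | ⟨a', c', b', d', _, _, _, -, h⟩ |
          ⟨c', d', hcd', -, h⟩
        · rw [h, minSet_block_top hab'] at hGmin
          exact absurd hGmin.symm pair_ne_singleton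
        · rw [h, minSet_block_pair (by omega) (by omega) (by omega), pair_eq_pair_iff] at hGmin
          rw [h, bot_mem_block]
          obtain ⟨rfl, rfl⟩ := hGmin
          omega
        · rw [h, minSet_block_bot hcd'] at hGmin
          exact absurd hGmin.symm pair_ne_singleton
      refine thin_hasPart_pair_indicator hP.pathConvex hpos hτ0 ha hc hGk ?_ ?_
      -- The part generated by the top vertex lacks exactly the q bottom vertices in columns c to a
      -- - 1, so its size is k - q, and the lower bound on the parameter is the required slope
      -- inequality.
      · obtain ⟨a₀, b₀, c₀, d₀, hs, rfl⟩ := hP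
        rw [gen_block_pair hca.le ha hc] at hGk
        rw [gen_block_top hs ha]
        rw [top_mem_block] at ha
        rw [bot_mem_block] at hbot
        unfold BlockShape at hs
        rw [ncard_block (by omega) (by omega)] at hGk ⊢
        have h1 : ((b₀ - a.val + (d₀ - a.val) : ℕ) : ℝ) = k - q := by
          rw [eq_sub_iff_add_eq]
          exact_mod_cast (by omega)
        rw [h1, div_mul_eq_mul_div, lt_div_iff₀ hkR]
        linarith
      -- The required inequality is τ (b₀ - a) < k - (b₀ - a). The worst case is the longest
      -- possible top part, of length k - (q + 1), where it becomes the upper bound on the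
      -- parameter.
      · obtain ⟨a₀, b₀, c₀, d₀, hs, rfl⟩ := hP
        rw [gen_block_pair hca.le ha hc] at hGk
        rw [gen_block_bot hc]
        rw [top_mem_block] at ha
        rw [bot_mem_block] at hbot
        unfold BlockShape at hs
        rw [ncard_block (by omega) (by omega)] at hGk ⊢
        have h1 : ((0 - 0 + (d₀ - c.val) : ℕ) : ℝ) = k - (b₀ - a.val : ℕ) := by
          rw [eq_sub_iff_add_eq]
          exact_mod_cast (by omega)
        have h2 : ((b₀ - a.val : ℕ) : ℝ) ≤ k - (q + 1) := by
          have : b₀ - a.val + (q + 1) ≤ k := by omega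
          have : ((b₀ - a.val : ℕ) : ℝ) + (q + 1) ≤ k := by exact_mod_cast this
          linarith
        rw [h1, div_mul_eq_mul_div, lt_div_iff₀ hkR]
        nlinarith
    · rw [hD0 hM]
      refine thin_hasPart_pair_zero hP.pathConvex hpos hτ0 hirr fun ha hc hGk => ?_
      obtain ⟨a₀, b₀, c₀, d₀, hs, rfl⟩ := hP
      rw [gen_block_top hs ha, gen_block_bot hc]
      rw [gen_block_pair hca.le ha hc] at hM
      rw [gen_block_pair hca.le ha hc] at hGk
      rw [top_mem_block] at ha
      rw [bot_mem_block] at hc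
      unfold BlockShape at hs
      -- If the bottom interval of P reached column a, the generated set would be a block of the
      -- class. As it is not, the part generated by the top vertex stays in the top row and the
      -- other one in the bottom row.
      by_cases had₀ : a.val < d₀
      · exact absurd ⟨isBlock_pair hca had₀ (by omega) (by omega),
          minSet_block_pair (by omega) hca (by omega), hGk⟩ hM
      · rw [Set.disjoint_left]
        rintro (i | i) h1 h2
        · rw [top_mem_block] at h2
          omega
        · rw [bot_mem_block] at h1 h2
          omega
  · exact hsingle _ (minSet_block_bot hcd) fun P hP hs => isBlock_gen_bot hP hs

open Classical in
/-- Linear functionals which are biorthogonal to the indicator functions of the blocks of given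
size and given minimal vertices. -/
theorem exists_dual {R : Set (LadderVertex ℓ)} (hR : IsBlock R) :
    ∃ φ : (LadderVertex ℓ → ℝ) →ₗ[ℝ] ℝ, ∀ R', IsBlock R' → minSet R' = minSet R →
      R'.ncard = R.ncard → φ (R'.indicator 1) = if R' = R then 1 else 0 := by
  -- The entry in the last top column b - 1 minus the entry in column b (absent if b = ℓ + 1) is 1
  -- exactly when the top interval ends at b; the prescribed size then fixes d.
  have hdiff : ∀ (a c : Fin (ℓ + 1)) (b d : ℕ), a.val < b → b ≤ ℓ + 1 → c.val ≤ d → d ≤ ℓ + 1 →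
      ∃ φ : (LadderVertex ℓ → ℝ) →ₗ[ℝ] ℝ, ∀ b' d', a.val < b' → b' ≤ ℓ + 1 → c.val ≤ d' →
        d' ≤ ℓ + 1 → (block ℓ a b' c d').ncard = (block ℓ a b c d).ncard →
        φ ((block ℓ a b' c d').indicator 1) =
          if block ℓ a b' c d' = block ℓ a b c d then 1 else 0 := by
    intro a c b d hab hb hcd hd
    refine ⟨LinearMap.proj (.top ⟨b - 1, by omega⟩) -
      (if h : b < ℓ + 1 then LinearMap.proj (.top ⟨b, h⟩) else 0), ?_⟩
    intro b' d' hab' hb' hcd' hd' hcard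
    rw [ncard_block hb' hd', ncard_block hb hd] at hcard
    rw [LinearMap.sub_apply, LinearMap.proj_apply]
    have hlast : (if h : b < ℓ + 1 then LinearMap.proj (.top ⟨b, h⟩) else 0 :
        (LadderVertex ℓ → ℝ) →ₗ[ℝ] ℝ) ((block ℓ a b' c d').indicator 1) =
        if b < b' then 1 else 0 := by
      by_cases h : b < ℓ + 1
      · rw [dif_pos h, LinearMap.proj_apply, Set.indicator_apply]
        simp only [top_mem_block, Pi.one_apply]
        exact if_congr (by omega) rfl rfl
      · rw [dif_neg h, LinearMap.zero_apply, if_neg (by omega)]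
    have hfirst : (block ℓ a b' c d').indicator (1 : LadderVertex ℓ → ℝ) (.top ⟨b - 1, by omega⟩) =
        if b ≤ b' then 1 else 0 := by
      rw [Set.indicator_apply]
      simp only [top_mem_block, Pi.one_apply]
      exact if_congr (by omega) rfl rfl
    rw [hlast, hfirst]
    rcases lt_trichotomy b b' with h | h | h
    · rw [if_pos h.le, if_pos h, if_neg, sub_self]
      intro heq
      have : (.top ⟨b, by omega⟩ : LadderVertex ℓ) ∈ block ℓ a b c d := by
        rw [← heq, top_mem_block]
        simp only
        omega
      rw [top_mem_block] at this
      simp at this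
    · obtain rfl : d' = d := by omega
      rw [h]
      simp
    · rw [if_neg (by omega), if_neg (by omega), if_neg, sub_self]
      intro heq
      have : (.top ⟨b - 1, by omega⟩ : LadderVertex ℓ) ∈ block ℓ a b' c d' := by
        rw [heq, top_mem_block]
        simp only
        omega
      rw [top_mem_block] at this
      simp only at this
      omega
  rcases hR.cases with ⟨a, b, d, hab, hb, had, hdb, rfl⟩ | ⟨a, c, b, d, hca, had, hdb, hb, rfl⟩ |
    ⟨c, d, hcd, hd, rfl⟩
  · obtain ⟨φ, hφ⟩ := hdiff a a b d hab hb had (by omega)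
    refine ⟨φ, fun R' hR' hmin hcard => ?_⟩
    rw [minSet_block_top hab] at hmin
    rcases hR'.cases with ⟨a', b', d', hab', hb', had', hdb', rfl⟩ |
      ⟨a', c', b', d', _, _, _, -, rfl⟩ | ⟨c', d', hcd', -, rfl⟩
    · rw [minSet_block_top hab'] at hmin
      obtain rfl : a' = a := by simpa using hmin
      exact hφ b' d' hab' hb' had' (by omega) hcard
    · rw [minSet_block_pair (by omega) (by omega) (by omega)] at hmin
      exact absurd hmin pair_ne_singleton
    · rw [minSet_block_bot hcd'] at hmin
      simp at hmin
  · obtain ⟨φ, hφ⟩ := hdiff a c b d (by omega) hb (by omega) (by omega)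
    refine ⟨φ, fun R' hR' hmin hcard => ?_⟩
    rw [minSet_block_pair (by omega) (by omega) (by omega)] at hmin
    rcases hR'.cases with ⟨a', b', d', hab', hb', had', hdb', rfl⟩ |
      ⟨a', c', b', d', _, _, _, _, rfl⟩ | ⟨c', d', hcd', -, rfl⟩
    · rw [minSet_block_top hab'] at hmin
      exact absurd hmin.symm pair_ne_singleton
    · rw [minSet_block_pair (by omega) (by omega) (by omega), pair_eq_pair_iff] at hmin
      obtain ⟨rfl, rfl⟩ := hmin
      exact hφ b' d' (by omega) (by omega) (by omega) (by omega) hcard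
    · rw [minSet_block_bot hcd'] at hmin
      exact absurd hmin.symm pair_ne_singleton
  · refine ⟨LinearMap.proj (.bot c), fun R' hR' hmin hcard => ?_⟩
    rw [minSet_block_bot hcd] at hmin
    rcases hR'.cases with ⟨a', b', d', hab', hb', had', hdb', rfl⟩ |
      ⟨a', c', b', d', _, _, _, _, rfl⟩ | ⟨c', d', hcd', hd', rfl⟩
    · rw [minSet_block_top hab'] at hmin
      simp at hmin
    · rw [minSet_block_pair (by omega) (by omega) (by omega)] at hmin
      exact absurd hmin pair_ne_singleton
    · rw [minSet_block_bot hcd'] at hmin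
      obtain rfl : c' = c := by simpa using hmin
      rw [ncard_block (by omega) hd', ncard_block (by omega) hd] at hcard
      obtain rfl : d' = d := by omega
      rw [if_pos rfl, LinearMap.proj_apply, Set.indicator_of_mem, Pi.one_apply]
      exact bot_mem_block.mpr ⟨le_rfl, hcd⟩

end Blocks

/-! ### Indecomposability of blocks, completeness and linear independence -/

section Completeness

variable {ℓ : ℕ} {K : Type u} [Field K]

/-- Blocks are connected: a single generator reaches all vertices, and in the case of two generators
both reach the bottom vertex of column a. -/
theorem IsBlock.exists_hub {P : Set (LadderVertex ℓ)} (h : IsBlock P) {C : Set (LadderVertex ℓ)}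
    (hC : ∀ x ∈ P, ∀ y ∈ P, Nonempty (Quiver.Path x y) → (x ∈ C ↔ y ∈ C)) :
    ∃ z, ∀ x ∈ P, (x ∈ C ↔ z ∈ C) := by
  simp only [nonempty_ladder_path_iff] at hC
  rcases h.cases with ⟨a, b, d, hab, -, -, -, rfl⟩ | ⟨a, c, b, d, _, _, _, _, rfl⟩ |
    ⟨c, d, hcd, -, rfl⟩
  · refine ⟨.top a, fun x hx => (hC _ (top_mem_block.mpr ⟨le_rfl, hab⟩) x hx ?_).symm⟩
    rcases x with i | i
    · exact ⟨le_rfl, (top_mem_block.mp hx).1⟩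
    · exact ⟨Nat.zero_le _, (bot_mem_block.mp hx).1⟩
  · have ha : .top a ∈ block ℓ a b c d := top_mem_block.mpr ⟨le_rfl, by omega⟩
    have hc : .bot c ∈ block ℓ a b c d := bot_mem_block.mpr ⟨le_rfl, by omega⟩
    have hz : .bot a ∈ block ℓ a b c d := bot_mem_block.mpr ⟨by omega, by omega⟩
    have h1 := hC _ ha _ hz ⟨Nat.zero_le _, le_rfl⟩
    have h2 := hC _ hc _ hz ⟨le_rfl, by simp only [LadderVertex.col]; omega⟩
    refine ⟨.bot a, fun x hx => ?_⟩
    rcases x with i | i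
    · exact (hC _ ha _ hx ⟨le_rfl, (top_mem_block.mp hx).1⟩).symm.trans h1
    · exact (hC _ hc _ hx ⟨le_rfl, (bot_mem_block.mp hx).1⟩).symm.trans h2
  · refine ⟨.bot c, fun x hx => (hC _ (bot_mem_block.mpr ⟨le_rfl, hcd⟩) x hx ?_).symm⟩
    rcases x with i | i
    · have := (top_mem_block.mp hx).2
      omega
    · exact ⟨le_rfl, (bot_mem_block.mp hx).1⟩

/-- In a decomposition, the supports of the two summands partition P. Maps inside P are injective,
so each support is closed under paths in P; by connectedness one of them is empty. -/
theorem IsBlock.isIndecomposable {P : Set (LadderVertex ℓ)} (h : IsBlock P) :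
    (thin K P).IsIndecomposable := by
  classical
  refine ⟨fun hz => ?_, fun U W hUW => ?_⟩
  · obtain ⟨x, hx⟩ := h.nonempty
    have := isZero_iff.mp hz x
    rw [dimVec_thin, if_pos hx] at this
    exact one_ne_zero this
  · have hdim : ∀ x, U.dimVec x + W.dimVec x = if x ∈ P then 1 else 0 := fun x => by
      rw [← dimVec_prod, ← hUW.dimVec_eq, dimVec_thin]
    -- a nonzero summand at `x` persists at all vertices reachable from `x` within `P`
    have hret : ∀ {U W : QuiverRep K (LadderVertex ℓ)}, (thin K P).Isomorphic (U.prod W) →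
        ∀ x ∈ P, ∀ y ∈ P, Nonempty (Quiver.Path x y) → W.dimVec x ≠ 0 → W.dimVec y ≠ 0 := by
      rintro U W hUW x hx y hy ⟨p⟩
      obtain ⟨ι, π, hπ⟩ := IsRetract.of_isomorphic_prod hUW
      rw [← mem_support_iff, ← mem_support_iff]
      rintro (hn : Nontrivial (W.obj x))
      obtain ⟨w, hw⟩ := exists_ne (0 : W.obj x)
      change Nontrivial (W.obj y)
      refine ⟨W.mapPath p w, 0, fun h0 => hw ?_⟩
      have h1 := ι.mapPath p w
      rw [h0, map_zero] at h1
      have h2 := thin_mapPath h.pathConvex p hx hy (ι.app x w)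
      rw [← h1] at h2
      have h3 : ι.app x w = 0 := Subtype.ext h2.symm
      rw [← hπ x w, h3, map_zero]
    have hswap : (thin K P).Isomorphic (W.prod U) := hUW.trans
      ⟨fun x => LinearEquiv.prodComm K _ _, fun _ _ _ _ => rfl⟩
    obtain ⟨z, hz⟩ := h.exists_hub (C := {x | W.dimVec x ≠ 0}) fun x hx y hy hxy => by
      refine ⟨hret hUW x hx y hy hxy, fun hy' hx' => ?_⟩
      have h1 := hdim x
      have h2 := hdim y
      have h3 := hret hswap x hx y hy hxy
      rw [if_pos hx] at h1
      rw [if_pos hy] at h2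
      have h4 : W.dimVec y ≠ 0 := hy'
      omega
    by_cases hzC : z ∈ {x | W.dimVec x ≠ 0}
    · left
      refine isZero_iff.mpr fun x => ?_
      have h1 := hdim x
      by_cases hx : x ∈ P
      · have h2 : W.dimVec x ≠ 0 := (hz x hx).mpr hzC
        rw [if_pos hx] at h1
        omega
      · rw [if_neg hx] at h1
        omega
    · right
      refine isZero_iff.mpr fun x => ?_
      by_cases hx : x ∈ P
      · exact not_not.mp fun h2 => hzC ((hz x hx).mp h2)
      · have h1 := hdim x
        rw [if_neg hx] at h1
        omega

theorem IsBlock.isNestfree {P : Set (LadderVertex ℓ)} (h : IsBlock P) :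
    IsNestfree (thin K P) := by
  classical
  have hdim : ∀ x, (thin K P).dimVec x ≤ 1 := fun x => by
    rw [dimVec_thin]
    split_ifs <;> simp
  exact ⟨thin_isEqualised h.pathConvex, hasNoNestedIntervals_of_dimVec_le_one fun x => hdim _,
    hasNoNestedIntervals_of_dimVec_le_one fun x => hdim _⟩

theorem minSupport_thin (P : Set (LadderVertex ℓ)) : (thin K P).minSupport = minSet P := by
  unfold minSupport minSet
  rw [support_thin]

theorem IsBlock.thin_mem_ladderClass {P : Set (LadderVertex ℓ)} (h : IsBlock P) :
    thin K P ∈ ladderClass K ℓ P.ncard (minSet P) :=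
  ⟨h.isIndecomposable, h.isNestfree, totalDim_thin P, minSupport_thin P⟩

theorem QuiverRep.Isomorphic.minSupport_eq {Q : Type} [Quiver.{0} Q] {V W : QuiverRep K Q}
    (h : V.Isomorphic W) : V.minSupport = W.minSupport := by
  have hs : V.support = W.support := by
    ext x
    rw [mem_support_iff, mem_support_iff, h.dimVec_eq]
  unfold minSupport
  rw [hs]

/-- The members of `ladderClass` are the thin representations on blocks. -/
theorem exists_block_of_mem_ladderClass {k : ℕ} {S : Set (LadderVertex ℓ)}
    {V : QuiverRep K (LadderVertex ℓ)} (hV : V ∈ ladderClass K ℓ k S) :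
    ∃ P, IsBlock P ∧ V.Isomorphic (thin K P) ∧ P.ncard = k ∧ minSet P = S := by
  obtain ⟨⟨hne, hind⟩, hnf, hk, hS⟩ := hV
  obtain ⟨l, hl, hiso⟩ := hnf.exists_isomorphic_listSum
  cases l with
  | nil =>
    refine absurd (isZero_iff.mpr fun x => ?_) hne
    rw [hiso.dimVec_eq]
    exact isZero_iff.mp isZero_zero x
  | cons P l =>
    have hP := hl P List.mem_cons_self
    have hz : (listSum K l).IsZero := (hind _ _ hiso).resolve_left
      (hP.isIndecomposable (K := K)).1
    have hiso' : V.Isomorphic (thin K P) := hiso.trans (isomorphic_prod_of_isZero _ hz)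
    refine ⟨P, hP, hiso', ?_, ?_⟩
    · rw [← hk, hiso'.totalDim_eq, totalDim_thin]
    · rw [← hS, hiso'.minSupport_eq, minSupport_thin]

/-- Lists are determined up to order by counting the members above any given one. -/
theorem perm_of_countP_eq {ι : Type*} (rel : ι → ι → Prop) [DecidableRel rel] (r : ι → ℕ)
    (p : ι → Prop) (hrefl : ∀ x, p x → rel x x) (hlt : ∀ x y, p x → p y → rel x y → x ≠ y →
      r x < r y) (l l' : List ι) (hl : ∀ x ∈ l, p x) (hl' : ∀ x ∈ l', p x)
    (h : ∀ x, p x → l.countP (fun y => rel x y) = l'.countP (fun y => rel x y)) :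
    l.Perm l' := by
  classical
  induction hn : l.length generalizing l l' with
  | zero =>
    obtain rfl := List.length_eq_zero_iff.mp hn
    cases l' with
    | nil => exact .nil
    | cons y l' =>
      have hy := hl' y List.mem_cons_self
      have h1 := h y hy
      rw [List.countP_nil, List.countP_cons_of_pos (by simpa using hrefl y hy)] at h1
      omega
  | succ n ih =>
    -- a member of maximal rank
    have hne : (l ++ l').toFinset.Nonempty := by
      cases l with
      | nil => simp at hn
      | cons x l => exact ⟨x, by simp⟩
    obtain ⟨x, hx, hmax⟩ := (l ++ l').toFinset.exists_max_image r hne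
    replace hmax : ∀ y, y ∈ l ∨ y ∈ l' → r y ≤ r x := fun y hy => hmax y (by simpa using hy)
    replace hx : x ∈ l ∨ x ∈ l' := by simpa using hx
    have hpx : p x := hx.elim (hl x) (hl' x)
    -- By maximality of the rank, only copies of x are counted at x, so x occurs in one list if and
    -- only if it occurs in the other, and it can be removed from both.
    have hrel : ∀ y, y ∈ l ∨ y ∈ l' → rel x y → y = x := fun y hy hxy => by
      by_contra hne
      have := hlt x y hpx (hy.elim (hl y) (hl' y)) hxy (Ne.symm hne)
      have := hmax y hy
      omega
    have hpos : ∀ m : List ι, x ∈ m ↔ 0 < m.countP (fun y => rel x y) ∧ x ∈ m := fun m => by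
      refine ⟨fun hm => ⟨List.countP_pos_iff.mpr ⟨x, hm, by simpa using hrefl x hpx⟩, hm⟩,
        fun h => h.2⟩
    have hmem : ∀ m : List ι, (∀ y ∈ m, y ∈ l ∨ y ∈ l') → 0 < m.countP (fun y => rel x y) →
        x ∈ m := fun m hm h0 => by
      obtain ⟨y, hy, hxy⟩ := List.countP_pos_iff.mp h0
      rw [← hrel y (hm y hy) (by simpa using hxy)]
      exact hy
    have hxl : x ∈ l ∧ x ∈ l' := by
      have heq := h x hpx
      rcases hx with hx | hx
      · exact ⟨hx, hmem l' (fun y hy => Or.inr hy) (heq ▸ ((hpos l).mp hx).1)⟩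
      · exact ⟨hmem l (fun y hy => Or.inl hy) (heq ▸ ((hpos l').mp hx).1), hx⟩
    have p1 := List.perm_cons_erase hxl.1
    have p2 := List.perm_cons_erase hxl.2
    refine p1.trans (((ih (l.erase x) (l'.erase x) (fun y hy => hl y (List.mem_of_mem_erase hy))
      (fun y hy => hl' y (List.mem_of_mem_erase hy)) (fun y hy => ?_) ?_).cons x).trans p2.symm)
    · have h1 := h y hy
      rw [p1.countP_eq, p2.countP_eq, List.countP_cons, List.countP_cons] at h1
      omega
    · rw [List.length_erase_of_mem hxl.1]
      omega

/-- For each block R, the charge of R and the dual functional of R extract from the type the number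
of summands P in which the minimal vertices of R generate R. This relation between R and P is
reflexive and raises the size when P ≠ R, so the counts determine the summands. -/
theorem isCompleteOn_ladderCharges {t : ℕ → ℕ → ℝ} (ht : IsAdmissibleParam t) :
    QuiverRep.IsCompleteOn (ladderCharges K ℓ t)
      (fun V : QuiverRep K (LadderVertex ℓ) => IsNestfree V) := by
  classical
  intro V W hV hW hVW
  obtain ⟨l, hl, hVl⟩ := IsNestfree.exists_isomorphic_listSum hV
  obtain ⟨l', hl', hWl⟩ := IsNestfree.exists_isomorphic_listSum hW
  refine hVl.trans ((listSum_perm ?_).trans hWl.symm)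
  refine perm_of_countP_eq (fun R P => gen P (minSet R) = R) Set.ncard IsBlock
    (fun R hR => hR.gen_minSet) (fun R P _ _ hRP hne => ?_) l l' hl hl' fun R hR => ?_
  · have hsub : R ⊆ P := by
      rw [← hRP]
      exact fun x hx => hx.1
    exact Set.ncard_lt_ncard (hsub.ssubset_of_ne hne) P.toFinite
  · obtain ⟨α, θ, hα, hpart⟩ := exists_charge_hasPart K ht hR
    obtain ⟨φ, hφ⟩ := exists_dual hR
    have htype := hVW α ⟨_, _, ⟨_, hR.thin_mem_ladderClass⟩, hα⟩
    let M : Set (LadderVertex ℓ) → Prop := fun P => IsBlock (gen P (minSet R)) ∧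
      minSet (gen P (minSet R)) = minSet R ∧ (gen P (minSet R)).ncard = R.ncard
    let D : Set (LadderVertex ℓ) → LadderVertex ℓ → ℕ := fun P =>
      if M P then (gen P (minSet R)).indicator 1 else 0
    have hD : ∀ P, IsBlock P → (thin K P).HasPart (fun x => α x - θ) (D P) := fun P hP =>
      hpart P hP (D P) (fun h => if_pos h) (fun h => if_neg h)
    have h1 := hVl.symm.hasPart (hasPart_listSum fun P hP => hD P (hl P hP))
    have h2 := hWl.symm.hasPart (hasPart_listSum fun P hP => hD P (hl' P hP))
    -- Uniqueness of parts turns equality of the types into equality of the sums of `D` over the two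
    -- lists.
    have h3 := h1.unique (hasPart_hnType α θ V)
    have h4 := h2.unique (hasPart_hnType α θ W)
    rw [htype, ← h4] at h3
    have hcount : ∀ m : List (Set (LadderVertex ℓ)),
        φ (fun x => (((m.map D).sum x : ℕ) : ℝ)) =
          (m.countP (fun P => gen P (minSet R) = R) : ℕ) := by
      intro m
      induction m with
      | nil =>
        rw [show (fun x => (((([] : List (Set (LadderVertex ℓ))).map D).sum x : ℕ) : ℝ)) = 0 from
          funext fun x => by simp, map_zero]
        simp
      | cons P m ih =>
        have hsplit : (fun x => ((((P :: m).map D).sum x : ℕ) : ℝ)) =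
            (fun x => ((D P x : ℕ) : ℝ)) + fun x => (((m.map D).sum x : ℕ) : ℝ) := by
          funext x
          rw [List.map_cons, List.sum_cons, Pi.add_apply, Pi.add_apply, Nat.cast_add]
        have hDP : φ (fun x => ((D P x : ℕ) : ℝ)) = if gen P (minSet R) = R then 1 else 0 := by
          by_cases hM : M P
          · rw [← hφ _ hM.1 hM.2.1 hM.2.2]
            congr 1
            funext x
            simp only [D, if_pos hM]
            by_cases hx : x ∈ gen P (minSet R) <;> simp [hx]
          · rw [if_neg]
            · simp only [D, if_neg hM]
              rw [show (fun x : LadderVertex ℓ =>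
                (((0 : LadderVertex ℓ → ℕ) x : ℕ) : ℝ)) = 0 from funext fun x => by simp, map_zero]
            · intro heq
              refine hM ?_
              exact ⟨by rwa [heq], by rw [heq], by rw [heq]⟩
        rw [hsplit, map_add, ih, hDP, List.countP_cons]
        by_cases hg : gen P (minSet R) = R
        · simp [hg, add_comm]
        · simp [hg]
    have h5 := hcount l
    rw [h3, hcount l'] at h5
    exact_mod_cast h5.symm

theorem dimVec_eq_indicator {V : QuiverRep K (LadderVertex ℓ)} {P : Set (LadderVertex ℓ)}
    (h : V.Isomorphic (thin K P)) :
    (fun x => (V.dimVec x : ℝ)) = P.indicator (1 : LadderVertex ℓ → ℝ) := by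
  classical
  funext x
  rw [h.dimVec_eq, dimVec_thin]
  by_cases hx : x ∈ P <;> simp [hx]

theorem linearIndepOn_dimVec_ladderClass (K : Type u) [Field K] (k : ℕ)
    (S : Set (LadderVertex ℓ)) :
    LinearIndepOn ℝ id ((fun (V : QuiverRep K (LadderVertex ℓ)) x => (V.dimVec x : ℝ)) ''
      ladderClass K ℓ k S) := by
  classical
  have hblock : ∀ v : ((fun (V : QuiverRep K (LadderVertex ℓ)) x => (V.dimVec x : ℝ)) ''
      ladderClass K ℓ k S), ∃ P, IsBlock P ∧ P.ncard = k ∧ minSet P = S ∧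
        v.1 = P.indicator (1 : LadderVertex ℓ → ℝ) := by
    rintro ⟨_, V, hV, rfl⟩
    obtain ⟨P, hP, hiso, hk, hS⟩ := exists_block_of_mem_ladderClass hV
    exact ⟨P, hP, hk, hS, dimVec_eq_indicator hiso⟩
  choose P hP hk hS hv using hblock
  choose φ hφ using fun v => exists_dual (hP v)
  refine LinearIndependent.of_pairwise_dual_eq_zero_one _ φ (fun v w hvw => ?_) fun v => ?_
  · change φ v w.1 = 0
    rw [hv w, hφ v (P w) (hP w) ((hS w).trans (hS v).symm) ((hk w).trans (hk v).symm), if_neg]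
    intro heq
    refine hvw (Subtype.ext ?_)
    rw [hv v, hv w, heq]
  · change φ v v.1 = 1
    rw [hv v, hφ v (P v) (hP v) rfl rfl, if_pos rfl]

theorem existsUnique_isLadderCharge {t : ℕ → ℕ → ℝ} {k : ℕ} {S : Set (LadderVertex ℓ)}
    (h : (ladderClass K ℓ k S).Nonempty) :
    ∃! α, IsLadderCharge t k S α := by
  obtain ⟨V, hV⟩ := h
  obtain ⟨P, hP, -, -, rfl⟩ := exists_block_of_mem_ladderClass hV
  have hsingle : ∀ s, minSet P = {s} → ∃! α, IsLadderCharge t k (minSet P) α := by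
    intro s hs
    rw [hs]
    refine ⟨skyscraper s, Or.inl ⟨s, rfl, rfl⟩, ?_⟩
    rintro α (⟨x, hx, rfl⟩ | ⟨a, c, -, hS, -⟩)
    · rw [Set.singleton_eq_singleton_iff.mp hx]
    · exact absurd hS.symm pair_ne_singleton
  rcases hP.cases with ⟨a, b, d, hab, -, -, -, rfl⟩ | ⟨a, c, b, d, hca, _, _, _, rfl⟩ |
    ⟨c, d, hcd, -, rfl⟩
  · exact hsingle _ (minSet_block_top hab)
  · rw [minSet_block_pair (by omega) hca (by omega)]
    refine ⟨_, Or.inr ⟨a, c, hca, rfl, rfl⟩, ?_⟩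
    rintro α (⟨x, hx, -⟩ | ⟨a', c', -, hS, rfl⟩)
    · exact absurd hx pair_ne_singleton
    · obtain ⟨rfl, rfl⟩ := pair_eq_pair_iff.mp hS
      rfl
  · exact hsingle _ (minSet_block_bot hcd)

end Completeness

/-! ### Counting the central charges -/

section Count

variable {ℓ : ℕ}

/-- The central charge of a pair of minimal vertices. -/
noncomputable def pairCharge (t : ℕ → ℕ → ℝ) (a c : Fin (ℓ + 1)) (k : ℕ) :
    LadderVertex ℓ → ℝ :=
  skyscraper (.top a) + t k (a.val - c.val) • skyscraper (.bot c)

theorem pairCharge_top (t : ℕ → ℕ → ℝ) (a c i : Fin (ℓ + 1)) (k : ℕ) :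
    pairCharge t a c k (.top i) = if i = a then 1 else 0 := by
  simp [pairCharge, skyscraper, Pi.single_apply]

theorem pairCharge_bot (t : ℕ → ℕ → ℝ) (a c i : Fin (ℓ + 1)) (k : ℕ) :
    pairCharge t a c k (.bot i) = if i = c then t k (a.val - c.val) else 0 := by
  simp [pairCharge, skyscraper, Pi.single_apply]

theorem pairCharge_eq {t : ℕ → ℕ → ℝ} {a c a' c' : Fin (ℓ + 1)} {k k' : ℕ}
    (h0 : t k (a.val - c.val) ≠ 0) (h : pairCharge t a c k = pairCharge t a' c' k') :
    a = a' ∧ c = c' ∧ t k (a.val - c.val) = t k' (a'.val - c'.val) := by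
  have h1 := congrFun h (.top a)
  have h2 := congrFun h (.bot c)
  rw [pairCharge_top, pairCharge_top, if_pos rfl] at h1
  rw [pairCharge_bot, pairCharge_bot, if_pos rfl] at h2
  have h3 : a = a' := by
    by_contra hne
    rw [if_neg hne] at h1
    exact one_ne_zero h1
  have h4 : c = c' := by
    by_contra hne
    rw [if_neg hne] at h2
    exact h0 h2
  rw [if_pos h4] at h2
  exact ⟨h3, h4, h2⟩

theorem skyscraper_ne_pairCharge {t : ℕ → ℕ → ℝ} {a c : Fin (ℓ + 1)} {k : ℕ}
    (h0 : t k (a.val - c.val) ≠ 0) (x : LadderVertex ℓ) : skyscraper x ≠ pairCharge t a c k := by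
  intro h
  have h1 := congrFun h (.top a)
  have h2 := congrFun h (.bot c)
  rw [pairCharge_top, if_pos rfl] at h1
  rw [pairCharge_bot, if_pos rfl] at h2
  simp only [skyscraper, Pi.single_apply] at h1 h2
  have h3 : LadderVertex.top a = x := by
    by_contra hne
    rw [if_neg hne] at h1
    exact zero_ne_one h1
  have h4 : LadderVertex.bot c = x := by
    by_contra hne
    rw [if_neg hne] at h2
    exact h0 h2.symm
  rw [← h4] at h3
  cases h3

/-- For minimal vertices in columns c < a, the ends satisfy a < d ≤ b ≤ ℓ + 1. The excess i of the
size over the minimal a - c + 2 is the sum of b - a - 1 and d - a - 1, and every value from 0 to 2(ℓ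
- a) occurs, by splitting i into halves rounded up and down. -/
theorem mem_ladderCharges_iff {K : Type u} [Field K] {t : ℕ → ℕ → ℝ} {α : LadderVertex ℓ → ℝ} :
    α ∈ ladderCharges K ℓ t ↔ (∃ x, α = skyscraper x) ∨
      ∃ a c : Fin (ℓ + 1), ∃ i : ℕ, c < a ∧ i < 2 * (ℓ - a.val) + 1 ∧
        α = pairCharge t a c (a.val - c.val + 2 + i) := by
  constructor
  · rintro ⟨k, S, ⟨V, hV⟩, ⟨x, -, rfl⟩ | ⟨a, c, hca, hS, rfl⟩⟩
    · exact Or.inl ⟨x, rfl⟩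
    · obtain ⟨P, hP, -, hk, hmin⟩ := exists_block_of_mem_ladderClass hV
      rw [hS] at hmin
      have hca' := Fin.lt_def.mp hca
      rcases hP.cases with ⟨a', b, d, hab, -, -, -, rfl⟩ | ⟨a', c', b, d, _, _, _, _, rfl⟩ |
        ⟨c', d, hcd, -, rfl⟩
      · rw [minSet_block_top hab] at hmin
        exact absurd hmin.symm pair_ne_singleton
      · rw [minSet_block_pair (by omega) (by omega) (by omega), pair_eq_pair_iff] at hmin
        obtain ⟨rfl, rfl⟩ := hmin
        rw [ncard_block (by omega) (by omega)] at hk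
        refine Or.inr ⟨a', c', (b - a'.val - 1) + (d - a'.val - 1), hca, by omega, ?_⟩
        have : a'.val - c'.val + 2 + ((b - a'.val - 1) + (d - a'.val - 1)) = k := by omega
        rw [this]
        rfl
      · rw [minSet_block_bot hcd] at hmin
        exact absurd hmin.symm pair_ne_singleton
  · rintro (⟨x, rfl⟩ | ⟨a, c, i, hca, hi, rfl⟩)
    · have hex : ∃ P : Set (LadderVertex ℓ), IsBlock P ∧ minSet P = {x} := by
        rcases x with a | c
        · exact ⟨block ℓ a (a.val + 1) a a, isBlock_top (by omega) (by omega) le_rfl (by omega),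
            minSet_block_top (by omega)⟩
        · exact ⟨block ℓ 0 0 c (c.val + 1), isBlock_bot (by omega) (by omega),
            minSet_block_bot (by omega)⟩
      obtain ⟨P, hP, hmin⟩ := hex
      exact ⟨P.ncard, {x}, ⟨_, hmin ▸ hP.thin_mem_ladderClass⟩, Or.inl ⟨x, rfl, rfl⟩⟩
    · have hca' := Fin.lt_def.mp hca
      have hP : IsBlock (block ℓ a (a.val + 1 + (i - i / 2)) c (a.val + 1 + i / 2)) :=
        isBlock_pair hca' (by omega) (by omega) (by omega)
      have hmin : minSet (block ℓ a (a.val + 1 + (i - i / 2)) c (a.val + 1 + i / 2)) =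
          {.top a, .bot c} := minSet_block_pair (by omega) hca' (by omega)
      have hk : (block ℓ a (a.val + 1 + (i - i / 2)) c (a.val + 1 + i / 2)).ncard =
          a.val - c.val + 2 + i := by
        rw [ncard_block (by omega) (by omega)]
        omega
      exact ⟨_, _, ⟨_, hmin ▸ hk ▸ hP.thin_mem_ladderClass⟩, Or.inr ⟨a, c, hca, rfl, rfl⟩⟩

/-- The indices of the central charges of pairs of minimal vertices. -/
def pairIndex (ℓ : ℕ) : Finset ((_ : Fin (ℓ + 1)) × Fin (ℓ + 1) × ℕ) :=
  Finset.univ.sigma fun a => Finset.Iio a ×ˢ Finset.range (2 * (ℓ - a.val) + 1)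

theorem card_pairIndex (ℓ : ℕ) : 6 * (pairIndex ℓ).card = 2 * ℓ ^ 3 + 3 * ℓ ^ 2 + ℓ := by
  -- There are a choices of c for each a. The contribution of the squares is kept on the left to
  -- avoid subtraction of natural numbers.
  have h : ∀ n ≤ ℓ, (6 * ∑ a ∈ Finset.range (n + 1), a * (2 * (ℓ - a) + 1) : ℕ) +
      2 * n * (n + 1) * (2 * n + 1) = 3 * n * (n + 1) * (2 * ℓ + 1) := by
    intro n
    induction n with
    | zero => simp
    | succ n ih =>
      intro hn
      obtain ⟨m, rfl⟩ := Nat.exists_eq_add_of_le hn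
      rw [Finset.sum_range_succ, mul_add]
      have h1 := ih (by omega)
      have h2 : n + 1 + m - (n + 1) = m := by omega
      rw [h2]
      nlinarith
  unfold pairIndex
  rw [Finset.card_sigma]
  simp only [Finset.card_product, Fin.card_Iio, Finset.card_range]
  rw [Fin.sum_univ_eq_sum_range (fun a => a * (2 * (ℓ - a) + 1))]
  have := h ℓ le_rfl
  nlinarith

open Classical in
theorem ladderCharges_eq_coe (K : Type u) [Field K] (t : ℕ → ℕ → ℝ) :
    ladderCharges K ℓ t = ((Finset.univ.image skyscraper ∪ (pairIndex ℓ).image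
      fun p => pairCharge t p.1 p.2.1 (p.1.val - p.2.1.val + 2 + p.2.2) :
        Finset (LadderVertex ℓ → ℝ)) : Set (LadderVertex ℓ → ℝ)) := by
  ext α
  rw [mem_ladderCharges_iff]
  simp only [Finset.coe_union, Finset.coe_image, Set.mem_union, Set.mem_image, Finset.mem_coe,
    Finset.mem_univ, true_and, pairIndex, Finset.mem_sigma, Finset.mem_product, Finset.mem_Iio,
    Finset.mem_range]
  refine or_congr ⟨fun ⟨x, h⟩ => ⟨x, h.symm⟩, fun ⟨x, h⟩ => ⟨x, h.symm⟩⟩ ⟨?_, ?_⟩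
  · rintro ⟨a, c, i, hca, hi, rfl⟩
    exact ⟨⟨a, c, i⟩, ⟨hca, hi⟩, rfl⟩
  · rintro ⟨⟨a, c, i⟩, ⟨hca, hi⟩, rfl⟩
    exact ⟨a, c, i, hca, hi, rfl⟩

theorem finite_ladderCharges (K : Type u) [Field K] (t : ℕ → ℕ → ℝ) :
    (ladderCharges K ℓ t).Finite := by
  rw [ladderCharges_eq_coe]
  exact Finset.finite_toSet _

theorem card_ladderVertex (ℓ : ℕ) : Fintype.card (LadderVertex ℓ) = 2 * (ℓ + 1) := by
  let e : LadderVertex ℓ ≃ Fin (ℓ + 1) ⊕ Fin (ℓ + 1) :=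
    { toFun := fun x => match x with
        | .top i => .inl i
        | .bot i => .inr i
      invFun := fun x => match x with
        | .inl i => .top i
        | .inr i => .bot i
      left_inv := by rintro (i | i) <;> rfl
      right_inv := by rintro (i | i) <;> rfl }
  rw [Fintype.card_congr e, Fintype.card_sum, Fintype.card_fin]
  ring

theorem ncard_ladderCharges_le (K : Type u) [Field K] (ℓ : ℕ) (t : ℕ → ℕ → ℝ) :
    6 * (ladderCharges K ℓ t).ncard ≤ 2 * ℓ ^ 3 + 3 * ℓ ^ 2 + 13 * ℓ + 12 := by
  classical
  rw [ladderCharges_eq_coe, Set.ncard_coe_finset]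
  refine (Nat.mul_le_mul_left 6 ((Finset.card_union_le _ _).trans
    (add_le_add Finset.card_image_le Finset.card_image_le))).trans ?_
  rw [Finset.card_univ, card_ladderVertex, mul_add, card_pairIndex]
  apply le_of_eq
  ring

theorem IsAdmissibleParam.ne_zero {t : ℕ → ℕ → ℝ} (ht : IsAdmissibleParam t) {p q : ℕ}
    (h : q < p) : t p q ≠ 0 := (ht p q h).1.ne_zero

theorem skyscraper_injective : Function.Injective (skyscraper : LadderVertex ℓ → _) := by
  intro x y h
  by_contra hne
  have := congrFun h x
  simp [skyscraper, hne] at this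

theorem ncard_ladderCharges_eq (K : Type u) [Field K] (ℓ : ℕ) {t : ℕ → ℕ → ℝ}
    (ht : IsAdmissibleParam t) (hd : IsDistinctParam t) :
    6 * (ladderCharges K ℓ t).ncard = 2 * ℓ ^ 3 + 3 * ℓ ^ 2 + 13 * ℓ + 12 := by
  classical
  rw [ladderCharges_eq_coe, Set.ncard_coe_finset, Finset.card_union_of_disjoint,
    Finset.card_image_of_injective _ skyscraper_injective, Finset.card_image_of_injOn,
    Finset.card_univ, card_ladderVertex, mul_add, card_pairIndex]
  · ring
  · rintro ⟨a, c, i⟩ - ⟨a', c', i'⟩ - h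
    obtain ⟨rfl, rfl, h3⟩ := pairCharge_eq (ht.ne_zero (by omega)) h
    have hq : ∀ j, a.val - c.val ∈ {q | q < a.val - c.val + 2 + j} := fun j =>
      show a.val - c.val < a.val - c.val + 2 + j by omega
    have h4 := hd (a.val - c.val) (hq i) (hq i') h3
    obtain rfl : i = i' := by simpa using h4
    rfl
  · rw [Finset.disjoint_left]
    intro α h1 h2
    obtain ⟨x, -, rfl⟩ := Finset.mem_image.mp h1
    obtain ⟨⟨a, c, i⟩, -, h3⟩ := Finset.mem_image.mp h2
    exact skyscraper_ne_pairCharge (ht.ne_zero (by omega)) x h3.symm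

/-- For fixed `q`, the intervals in which the parameters lie are disjoint for sufficiently
different `p`. -/
theorem IsAdmissibleParam.lt_of_add_two_le {t : ℕ → ℕ → ℝ} (ht : IsAdmissibleParam t)
    {q m m' : ℕ} (hm : 0 < m) (hmq : m ≤ q) (hmm' : m + 2 ≤ m') :
    t (q + m') q < t (q + m) q := by
  obtain ⟨-, -, h1⟩ := ht (q + m') q (by omega)
  obtain ⟨-, h2, -⟩ := ht (q + m) q (by omega)
  replace h1 := h1 (by omega)
  refine (h1.trans_le ?_).trans h2
  have e1 : (1 : ℝ) ≤ m := by exact_mod_cast hm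
  have e2 : (m : ℝ) ≤ q := by exact_mod_cast hmq
  have e3 : (m : ℝ) + 2 ≤ m' := by exact_mod_cast hmm'
  push_cast
  rw [div_le_div_iff₀ (by linarith) (by linarith)]
  nlinarith

/-- With a slightly beyond the middle part of the ladder and c near its left end, q = a - c is large
compared with the chosen values m = k - q, so the parameters for values of m differing by 2 or more
are distinct. -/
theorem pow_le_ncard_ladderCharges (K : Type u) [Field K] {t : ℕ → ℕ → ℝ}
    (ht : IsAdmissibleParam t) (r : ℕ) (hr : 6 * r ≤ ℓ) :
    r ^ 3 ≤ (ladderCharges K ℓ t).ncard := by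
  classical
  -- Only even excesses 2j are used, which keeps the sizes 2 apart. For u, v, j < r one has m = 2 +
  -- 2j ≤ 2r, while q = ℓ - r - u - v exceeds 3r.
  let f : ℕ × ℕ × ℕ → LadderVertex ℓ → ℝ := fun p =>
    pairCharge t ⟨ℓ - r - p.1, by omega⟩ (Fin.ofNat (ℓ + 1) p.2.1)
      (ℓ - r - p.1 - p.2.1 + 2 + 2 * p.2.2)
  set J : Finset (ℕ × ℕ × ℕ) := Finset.range r ×ˢ Finset.range r ×ˢ Finset.range r with hJ
  have hval : ∀ v < r, (Fin.ofNat (ℓ + 1) v).val = v := fun v hv =>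
    Nat.mod_eq_of_lt (by omega)
  have hmem : ∀ p ∈ J, f p ∈ ladderCharges K ℓ t := by
    rintro ⟨u, v, j⟩ hp
    simp only [hJ, Finset.mem_product, Finset.mem_range] at hp
    obtain ⟨hu, hv, hj⟩ := hp
    rw [mem_ladderCharges_iff]
    refine Or.inr ⟨⟨ℓ - r - u, by omega⟩, Fin.ofNat (ℓ + 1) v, 2 * j, ?_, ?_, ?_⟩
    · rw [Fin.lt_def, hval v hv]
      simp only
      omega
    · simp only
      omega
    · simp only [f, hval v hv]
  have hinj : Set.InjOn f J := by
    rintro ⟨u, v, j⟩ hp ⟨u', v', j'⟩ hp' h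
    simp only [hJ, Finset.coe_product, Finset.coe_range, Set.mem_prod, Set.mem_Iio] at hp hp'
    obtain ⟨hu, hv, hj⟩ := hp
    obtain ⟨hu', hv', hj'⟩ := hp'
    have hne : t (ℓ - r - u - v + 2 + 2 * j)
        ((⟨ℓ - r - u, by omega⟩ : Fin (ℓ + 1)).val - (Fin.ofNat (ℓ + 1) v).val) ≠ 0 := by
      rw [hval v hv]
      exact ht.ne_zero (by simp only; omega)
    obtain ⟨h1, h2, h3⟩ := pairCharge_eq hne h
    have h4 : u = u' := by
      have := congrArg Fin.val h1
      simp only at this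
      omega
    have h5 : v = v' := by
      have := congrArg Fin.val h2
      rwa [hval v hv, hval v' hv'] at this
    subst h4 h5
    simp only [hval v hv] at h3
    have h6 : ∀ j : ℕ, ℓ - r - u - v + 2 + 2 * j = (ℓ - r - u - v) + (2 + 2 * j) := fun j => by
      omega
    rw [h6, h6] at h3
    have h7 : j = j' := by
      rcases lt_trichotomy j j' with h | h | h
      · exact absurd h3 (ht.lt_of_add_two_le (by omega) (by omega) (by omega)).ne'
      · exact h
      · exact absurd h3 (ht.lt_of_add_two_le (by omega) (by omega) (by omega)).ne
    rw [h7]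
  have hcard : J.card = r ^ 3 := by
    simp only [hJ, Finset.card_product, Finset.card_range]
    ring
  rw [← hcard, ← Set.ncard_coe_finset, ← hinj.ncard_image]
  refine Set.ncard_le_ncard ?_ (finite_ladderCharges K t)
  rintro _ ⟨p, hp, rfl⟩
  exact hmem p hp

theorem ncard_ladderCharges_isTheta (K : Type u) [Field K] {t : ℕ → ℕ → ℝ}
    (ht : IsAdmissibleParam t) :
    (fun ℓ : ℕ => ((ladderCharges K ℓ t).ncard : ℝ)) =Θ[atTop] (fun ℓ : ℕ => (ℓ : ℝ) ^ 3) := by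
  constructor
  · refine IsBigO.of_bound 5 ?_
    filter_upwards [eventually_ge_atTop 1] with ℓ hℓ
    have h1 := ncard_ladderCharges_le K ℓ t
    -- The coefficients of the bound add up to 2 + 3 + 13 + 12 = 6 · 5.
    have h2 : (ladderCharges K ℓ t).ncard ≤ 5 * ℓ ^ 3 := by
      have h3 : ℓ ^ 2 ≤ ℓ ^ 3 := Nat.pow_le_pow_right hℓ (by norm_num)
      have h4 : ℓ ^ 1 ≤ ℓ ^ 3 := Nat.pow_le_pow_right hℓ (by norm_num)
      have h5 : ℓ ^ 0 ≤ ℓ ^ 3 := Nat.pow_le_pow_right hℓ (by norm_num)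
      simp only [pow_one, pow_zero] at h4 h5
      omega
    rw [Real.norm_of_nonneg (by positivity), Real.norm_of_nonneg (by positivity)]
    exact_mod_cast h2
  · refine IsBigO.of_bound (12 ^ 3) ?_
    filter_upwards [eventually_ge_atTop 6] with ℓ hℓ
    have h1 := pow_le_ncard_ladderCharges (ℓ := ℓ) K ht (ℓ / 6) (by omega)
    -- The floor costs at most a factor of 2 once ℓ ≥ 6, which gives ℓ ≤ 12 ⌊ℓ/6⌋.
    have h2 : ℓ ^ 3 ≤ (12 * (ℓ / 6)) ^ 3 := Nat.pow_le_pow_left (by omega) 3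
    rw [mul_pow] at h2
    have h3 : ℓ ^ 3 ≤ 12 ^ 3 * (ladderCharges K ℓ t).ncard :=
      h2.trans (Nat.mul_le_mul_left _ h1)
    rw [Real.norm_of_nonneg (by positivity), Real.norm_of_nonneg (by positivity)]
    exact_mod_cast h3

/-- The bounds are the values of the increasing function x/(p - x) at q and q + 1, so its value at q
+ s with s = √2 - 1 in (0,1) lies between them. It is strictly decreasing in p, hence injective for
fixed q. -/
theorem exists_isAdmissibleParam_isDistinctParam :
    ∃ t : ℕ → ℕ → ℝ, IsAdmissibleParam t ∧ IsDistinctParam t := by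
  have hs0 : 0 < √2 - 1 := by
    have : (1 : ℝ) < √2 := by
      rw [Real.lt_sqrt] <;> norm_num
    linarith
  have hs1 : √2 - 1 < 1 := by
    have : √2 < 2 := by
      rw [Real.sqrt_lt'] <;> norm_num
    linarith
  have hirr : Irrational (√2 - 1) := by
    simpa using irrational_sqrt_two.sub_natCast 1
  set s := √2 - 1
  have hden : ∀ p q : ℕ, q < p → 0 < (p : ℝ) - (q + s) := fun p q h => by
    have : (q : ℝ) + 1 ≤ p := by exact_mod_cast h
    linarith
  refine ⟨fun p q => (q + s) / (p - (q + s)), fun p q h => ⟨?_, ?_, fun h' => ?_⟩,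
    fun q p hp p' hp' h => ?_⟩
  · rintro ⟨x, hx⟩
    have h1 := hden p q h
    have h2 : (0 : ℝ) < x := by rw [hx]; positivity
    rw [eq_div_iff h1.ne'] at hx
    -- Solving x = (q + s)/(p - (q + s)) for s would make s rational.
    refine hirr ⟨(x * (p - q) - q) / (1 + x), ?_⟩
    push_cast
    rw [div_eq_iff (by positivity)]
    linarith
  · have h1 := hden p q h
    have h2 : (0 : ℝ) < (p : ℝ) - q := by linarith
    rw [div_lt_div_iff₀ h2 h1]
    have : (0 : ℝ) ≤ q := by positivity
    nlinarith
  · have h1 := hden p q h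
    have h2 : (0 : ℝ) < (p : ℝ) - (q + 1) := by
      have : (q : ℝ) + 1 < p := by exact_mod_cast h'
      linarith
    rw [div_lt_div_iff₀ h1 h2]
    have : (0 : ℝ) ≤ q := by positivity
    nlinarith
  · have h1 := hden p q hp
    have h2 := hden p' q hp'
    have h3 : (0 : ℝ) < q + s := by positivity
    simp only at h
    rw [div_eq_div_iff h1.ne' h2.ne'] at h
    have h4 := mul_left_cancel₀ h3.ne' h
    have h5 : (p : ℝ) = p' := by linarith
    exact_mod_cast h5

end Count

theorem theorem6p4 {K : Type u} [Field K] :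
    (∃ t : ℕ → ℕ → ℝ, IsAdmissibleParam t ∧ IsDistinctParam t) ∧
    ∀ t : ℕ → ℕ → ℝ, IsAdmissibleParam t →
      (∀ ℓ : ℕ, 1 ≤ ℓ →
        (∀ (k : ℕ) (S : Set (LadderVertex ℓ)), (ladderClass K ℓ k S).Nonempty →
          ∃! α, IsLadderCharge t k S α) ∧
        (ladderCharges K ℓ t).Finite ∧
        QuiverRep.IsCompleteOn (ladderCharges K ℓ t)
          (fun V : QuiverRep K (LadderVertex ℓ) => IsNestfree V) ∧
        (∀ (k : ℕ) (S : Set (LadderVertex ℓ)),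
          LinearIndepOn ℝ id
            ((fun (V : QuiverRep K (LadderVertex ℓ)) x => (V.dimVec x : ℝ)) ''
              ladderClass K ℓ k S)) ∧
        6 * (ladderCharges K ℓ t).ncard ≤ 2 * ℓ ^ 3 + 3 * ℓ ^ 2 + 13 * ℓ + 12 ∧
        (IsDistinctParam t →
          6 * (ladderCharges K ℓ t).ncard = 2 * ℓ ^ 3 + 3 * ℓ ^ 2 + 13 * ℓ + 12)) ∧
      (fun ℓ : ℕ => ((ladderCharges K ℓ t).ncard : ℝ)) =Θ[atTop] (fun ℓ : ℕ => (ℓ : ℝ) ^ 3) := by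
  refine ⟨exists_isAdmissibleParam_isDistinctParam, fun t ht => ⟨fun ℓ _ => ⟨fun k S h =>
    existsUnique_isLadderCharge h, finite_ladderCharges K t, isCompleteOn_ladderCharges ht,
    linearIndepOn_dimVec_ladderClass K, ncard_ladderCharges_le K ℓ t,
    ncard_ladderCharges_eq K ℓ ht⟩, ncard_ladderCharges_isTheta K ht⟩⟩
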